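/- Let $1\le K<M$, $\tau\le T$ with $T\ge 1$, $\rho,\sigma,d,\lambda>0$, $0\neq\Phi\in\mathbb C$, and for $k=1,\dots,K$ let $\beta_k>0$, $\delta_k\ge 0$, pilot powers $p_k^p>0$, data powers $p_k^d\ge 0$ and angles $\theta_k^e,\phi_k$ be given; let $\vartheta$ be an angle and let $\mathbf Q=[\mathbf q_1,\dots,\mathbf q_K]\in\mathbb C^{\tau\times K}$ have orthonormal columns. Put $\alpha_k=\frac{\beta_k}{\delta_k+1}$, $\mu_k=\frac{\rho\tau p_k^p\alpha_k|\Phi|^2}{\rho\tau p_k^p\alpha_k|\Phi|^2+\sigma^2}$, $\mathbf D=\mathrm{diag}\big(e^{-j2\pi m d\sin\vartheta/\lambda}\big)_{m=0}^{M-1}$, $\bar{\mathbf h}_k=\big(e^{-j2\pi m\frac d\lambda\sin\theta_k^e\cos\phi_k}\big)_{m=0}^{M-1}$, $\bar{\mathbf H}=[\sqrt{\delta_1\alpha_1}\,\bar{\mathbf h}_1,\dots,\sqrt{\delta_K\alpha_K}\,\bar{\mathbf h}_K]$ and $\boldsymbol\Psi=\mathrm{Diag}\{\mu_1\alpha_1,\dots,\mu_K\alpha_K\}$.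 The Rician channels are $\mathbf h_k=\sqrt{\beta_k\delta_k/(\delta_k+1)}\,\bar{\mathbf h}_k+\sqrt{\beta_k/(\delta_k+1)}\,\tilde{\mathbf h}_k$ and $\mathbf H=[\mathbf h_1,\dots,\mathbf h_K]$. The pilot observation is $\mathbf Y=\sqrt\rho\,\Phi\mathbf D\mathbf H\,\mathrm{diag}\{\sqrt{\tau p_1^p},\dots,\sqrt{\tau p_K^p}\}\,\mathbf Q^H+\mathbf W$, and $\mathbf y_k=\mathbf Y\mathbf q_k$. The data-phase noise is $\mathbf w\in\mathbb C^M$ and the data symbols are $s_1,\dots,s_K$. All entries of $\tilde{\mathbf h}_1,\dots,\tilde{\mathbf h}_K$, $\mathbf W$, $\mathbf w$ and all $s_k$ are independent circularly symmetric complex Gaussian variables with mean zero, of variance $1$ for $\tilde{\mathbf h}_k$ and $s_k$ and of variance $\sigma^2$ for $\mathbf W$ and $\mathbf w$. The MMSE channel estimates are $$\hat{\mathbf h}_k=\sqrt{\tfrac{\beta_k\delta_k}{\delta_k+1}}\,\bar{\mathbf h}_k+\mathrm{Cov}\Big\{\sqrt{\tfrac{\beta_k}{\delta_k+1}}\,\tilde{\mathbf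 h}_k,\mathbf y_k\Big\}\,\mathrm{Cov}\{\mathbf y_k,\mathbf y_k\}^{-1}\big(\mathbf y_k-\mathbb E\{\mathbf y_k\}\big),\qquad \hat{\mathbf H}=[\hat{\mathbf h}_1,\dots,\hat{\mathbf h}_K],$$ and the ZF detection vectors $\mathbf c_k$ are the columns of $\mathbf A(\mathbf A^H\mathbf A)^{-1}$ with $\mathbf A=\Phi\mathbf D\hat{\mathbf H}$. With $g_{k,k'}=\sqrt{\rho p_{k'}^d}\,\Phi\,\mathbf c_k^H\mathbf D\mathbf h_{k'}$, put $\mathrm{Ds}_k=\mathbb E\{g_{k,k}\}s_k$, $\mathrm{Ls}_k=g_{k,k}s_k-\mathbb E\{g_{k,k}\}s_k$, $\mathrm{UI}_{k,k'}=g_{k,k'}s_{k'}$, $\mathrm N_k=\mathbf c_k^H\mathbf w$, and define the achievable rate of user $k$ as $$R_k=\frac{T-\tau}{T}\log_2\Big(1+\frac{\mathbb E|\mathrm{Ds}_k|^2}{\mathbb E|\mathrm{Ls}_k|^2+\sum_{k'\ne k}\mathbb E|\mathrm{UI}_{k,k'}|^2+\mathbb E|\mathrm N_k|^2}\Big).$$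 Then, for every $k$: $\hat{\mathbf H}^H\hat{\mathbf H}$ is almost surely invertible; $g_{k,k}$, $\mathrm{Ls}_k$, $\mathrm{UI}_{k,k'}$ ($k'\neq k$) and $\mathrm N_k$ are square integrable; and $$R_k\ \ge\ \frac{T-\tau}{T}\log_2\big(1+\mathrm{SINR}_k^{\mathrm{ZF}}\big),\qquad \mathrm{SINR}_k^{\mathrm{ZF}}=\frac{(M-K)\,p_k^d}{\Big(\sum_{k'=1}^K p_{k'}^d(\alpha_{k'}-\mu_{k'}\alpha_{k'})+\frac{\sigma^2}{\rho|\Phi|^2}\Big)\Big[\big(\boldsymbol\Psi+\tfrac1M\bar{\mathbf H}^H\bar{\mathbf H}\big)^{-1}\Big]_{k,k}}.$$ -/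

import Mathlib

open MeasureTheory ProbabilityTheory Matrix
open scoped NNReal ENNReal

noncomputable section

namespace RAQMIMO

/-- The circularly symmetric complex Gaussian law `CN(0, v)` on `ℂ`: real and imaginary parts are
independent, each real Gaussian with mean `0` and variance `v / 2`. -/
def circularGaussian (v : ℝ≥0) : Measure ℂ :=
  ((gaussianReal 0 (v / 2)).prod (gaussianReal 0 (v / 2))).map (fun z => (⟨z.1, z.2⟩ : ℂ))

/-- Deterministic parameters of a system with `M` vapor cells, `K` users and pilot length `τ`. -/
structure Params (M K τ : ℕ) where
  /-- effective gain of the cells -/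
  ρ : ℝ
  /-- common phase-shift factor -/
  Φ : ℂ
  /-- noise standard deviation: the noise power is `σ ^ 2` -/
  σ : ℝ
  /-- spacing between adjacent vapor cells -/
  d : ℝ
  /-- wavelength -/
  wavelength : ℝ
  /-- angle of arrival of the local oscillator signal -/
  arrival : ℝ
  /-- elevation angles of the users -/
  elevation : Fin K → ℝ
  /-- azimuth angles of the users -/
  azimuth : Fin K → ℝ
  /-- large-scale fading factors -/
  β : Fin K → ℝ
  /-- Rician factors -/
  δ : Fin K → ℝ
  /-- pilot powers -/
  pPilot : Fin K → ℝ
  /-- data transmit powers -/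
  pData : Fin K → ℝ
  /-- pilot matrix, whose columns are the pilot sequences -/
  Q : Matrix (Fin τ) (Fin K) ℂ
  ρ_pos : 0 < ρ
  Φ_ne_zero : Φ ≠ 0
  σ_pos : 0 < σ
  d_pos : 0 < d
  wavelength_pos : 0 < wavelength
  β_pos : ∀ k, 0 < β k
  δ_nonneg : ∀ k, 0 ≤ δ k
  pPilot_pos : ∀ k, 0 < pPilot k
  pData_nonneg : ∀ k, 0 ≤ pData k
  /-- the pilot sequences are orthonormal -/
  Q_orthonormal : Qᴴ * Q = 1

/-- The random quantities of the system on a probability space `(Ω, P)`. All the scalars involved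
are jointly independent. -/
structure Model {M K τ : ℕ} (p : Params M K τ) {Ω : Type*} [MeasurableSpace Ω]
    (P : Measure Ω) where
  /-- non-line-of-sight components of the channels, `hTilde m k` for cell `m` and user `k` -/
  hTilde : Fin M → Fin K → Ω → ℂ
  /-- background noise matrix of the pilot phase -/
  W : Fin M → Fin τ → Ω → ℂ
  /-- noise vector of the data phase -/
  w : Fin M → Ω → ℂ
  /-- data symbols -/
  s : Fin K → Ω → ℂ
  law_hTilde : ∀ m k, HasLaw (hTilde m k) (circularGaussian 1) P
  law_W : ∀ m t, HasLaw (W m t) (circularGaussian (p.σ ^ 2).toNNReal) P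
  law_w : ∀ m, HasLaw (w m) (circularGaussian (p.σ ^ 2).toNNReal) P
  law_s : ∀ k, HasLaw (s k) (circularGaussian 1) P
  indep : iIndepFun
    (Sum.elim (fun i : Fin M × Fin K => hTilde i.1 i.2)
      (Sum.elim (fun i : Fin M × Fin τ => W i.1 i.2) (Sum.elim w s))) P

section Deterministic

variable {M K τ : ℕ} (p : Params M K τ)

/-- `α_k = β_k / (δ_k + 1)` -/
def Params.α (k : Fin K) : ℝ := p.β k / (p.δ k + 1)

/-- `μ_k = ρ τ p_k^p α_k |Φ|² / (ρ τ p_k^p α_k |Φ|² + σ²)` -/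
def Params.μ (k : Fin K) : ℝ :=
  p.ρ * τ * p.pPilot k * p.α k * ‖p.Φ‖ ^ 2 /
    (p.ρ * τ * p.pPilot k * p.α k * ‖p.Φ‖ ^ 2 + p.σ ^ 2)

/-- Phase shifts across the array caused by the local oscillator. -/
def Params.D : Matrix (Fin M) (Fin M) ℂ :=
  diagonal fun m => Complex.exp (-Complex.I *
    ((2 * Real.pi * m * p.d * Real.sin p.arrival / p.wavelength : ℝ) : ℂ))

/-- Line-of-sight steering vector of user `k`. -/
def Params.hBar (k : Fin K) : Fin M → ℂ := fun m =>
  Complex.exp (-Complex.I * ((2 * Real.pi * m * (p.d / p.wavelength) *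
    Real.sin (p.elevation k) * Real.cos (p.azimuth k) : ℝ) : ℂ))

/-- The matrix with columns `√(δ_k α_k) h̄_k`. -/
def Params.HBar : Matrix (Fin M) (Fin K) ℂ :=
  of fun m k => ((Real.sqrt (p.δ k * p.α k) : ℝ) : ℂ) * p.hBar k m

/-- `Ψ = Diag{μ_1 α_1, …, μ_K α_K}` -/
def Params.Ψ : Matrix (Fin K) (Fin K) ℂ :=
  diagonal fun k => ((p.μ k * p.α k : ℝ) : ℂ)

/-- Pilot energy matrix `Diag{√(τ p_1^p), …, √(τ p_K^p)}`. -/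
def Params.pilotEnergy : Matrix (Fin K) (Fin K) ℂ :=
  diagonal fun k => ((Real.sqrt (τ * p.pPilot k) : ℝ) : ℂ)

/-- The closed-form ZF SINR. The matrix that is inverted is Hermitian positive definite, so the
diagonal entries of its inverse are real. -/
def Params.sinrZF (k : Fin K) : ℝ :=
  ((M : ℝ) - K) * p.pData k /
    ((∑ k', p.pData k' * (p.α k' - p.μ k' * p.α k') + p.σ ^ 2 / (p.ρ * ‖p.Φ‖ ^ 2)) *
      ((p.Ψ + (M : ℂ)⁻¹ • (p.HBarᴴ * p.HBar))⁻¹ k k).re)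

end Deterministic

section Covariance

variable {Ω : Type*} [MeasurableSpace Ω] (P : Measure Ω) {m n : ℕ}

/-- Mean of a random vector. -/
def meanVec (X : Ω → Fin n → ℂ) : Fin n → ℂ := fun i => ∫ ω, X ω i ∂P

/-- Cross-covariance matrix `E[(X - E X)(Y - E Y)ᴴ]` of two random vectors. -/
def cov (X : Ω → Fin m → ℂ) (Y : Ω → Fin n → ℂ) : Matrix (Fin m) (Fin n) ℂ :=
  of fun i j => ∫ ω, (X ω i - meanVec P X i) * star (Y ω j - meanVec P Y j) ∂P

end Covariance

section Random

variable {M K τ : ℕ} {p : Params M K τ} {Ω : Type*} [MeasurableSpace Ω] {P : Measure Ω}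
  (X : Model p P)

/-- Non-line-of-sight part `√(β_k / (δ_k + 1)) h̃_k` of the channel of user `k`. -/
def Model.nlos (k : Fin K) (ω : Ω) : Fin M → ℂ := fun m =>
  ((Real.sqrt (p.β k / (p.δ k + 1)) : ℝ) : ℂ) * X.hTilde m k ω

/-- Rician channel vector of user `k`. -/
def Model.h (k : Fin K) (ω : Ω) : Fin M → ℂ :=
  ((Real.sqrt (p.β k * p.δ k / (p.δ k + 1)) : ℝ) : ℂ) • p.hBar k + X.nlos k ω

/-- Channel matrix with columns `h_k`. -/
def Model.H (ω : Ω) : Matrix (Fin M) (Fin K) ℂ := of fun m k => X.h k ω m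

/-- Received pilot signal `√ρ Φ D H P Qᴴ + W`. -/
def Model.Y (ω : Ω) : Matrix (Fin M) (Fin τ) ℂ :=
  (((Real.sqrt p.ρ : ℝ) : ℂ) * p.Φ) • (p.D * X.H ω * p.pilotEnergy * p.Qᴴ)
    + of fun m t => X.W m t ω

/-- Received pilot signal correlated with the pilot sequence of user `k`. -/
def Model.y (k : Fin K) (ω : Ω) : Fin M → ℂ := X.Y ω *ᵥ fun t => p.Q t k

/-- MMSE estimate of the channel of user `k`. -/
def Model.hHat (k : Fin K) (ω : Ω) : Fin M → ℂ :=
  ((Real.sqrt (p.β k * p.δ k / (p.δ k + 1)) : ℝ) : ℂ) • p.hBar k +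
    (cov P (X.nlos k) (X.y k) * (cov P (X.y k) (X.y k))⁻¹) *ᵥ (X.y k ω - meanVec P (X.y k))

/-- Estimated channel matrix with columns `ĥ_k`. -/
def Model.HHat (ω : Ω) : Matrix (Fin M) (Fin K) ℂ := of fun m k => X.hHat k ω m

/-- ZF detection matrix `C = A (Aᴴ A)⁻¹`, where `A = Φ D Ĥ`. -/
def Model.zf (ω : Ω) : Matrix (Fin M) (Fin K) ℂ :=
  (p.Φ • (p.D * X.HHat ω)) * ((p.Φ • (p.D * X.HHat ω))ᴴ * (p.Φ • (p.D * X.HHat ω)))⁻¹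

/-- ZF detection vector of user `k`, the `k`-th column of the detection matrix. -/
def Model.c (k : Fin K) (ω : Ω) : Fin M → ℂ := fun m => X.zf ω m k

/-- Effective gain `√(ρ p_{k'}^d) Φ c_kᴴ D h_{k'}` of user `k'` after detection for user `k`. -/
def Model.gain (k k' : Fin K) (ω : Ω) : ℂ :=
  ((Real.sqrt (p.ρ * p.pData k') : ℝ) : ℂ) * p.Φ * (star (X.c k ω) ⬝ᵥ (p.D *ᵥ X.h k' ω))

/-- Effective signal of user `k`. -/
def Model.Ds (k : Fin K) (ω : Ω) : ℂ := (∫ ω', X.gain k k ω' ∂P) * X.s k ω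

/-- Leaked signal of user `k`. -/
def Model.Ls (k : Fin K) (ω : Ω) : ℂ :=
  X.gain k k ω * X.s k ω - (∫ ω', X.gain k k ω' ∂P) * X.s k ω

/-- Interference of user `k'` to user `k`. -/
def Model.UI (k k' : Fin K) (ω : Ω) : ℂ := X.gain k k' ω * X.s k' ω

/-- Noise after detection for user `k`. -/
def Model.N (k : Fin K) (ω : Ω) : ℂ := star (X.c k ω) ⬝ᵥ fun m => X.w m ω

/-- Mean power of a complex random variable. -/
def power (P : Measure Ω) (Z : Ω → ℂ) : ℝ := ∫ ω, ‖Z ω‖ ^ 2 ∂P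

/-- Achievable rate of user `k` under ZF detection with coherence interval `T`. -/
def Model.rate (T : ℕ) (k : Fin K) : ℝ :=
  ((T : ℝ) - τ) / T * Real.logb 2 (1 + power P (X.Ds k) /
    (power P (X.Ls k) + ∑ k' ∈ Finset.univ.erase k, power P (X.UI k k') + power P (X.N k)))

end Random

end RAQMIMO

end

open MeasureTheory ProbabilityTheory Matrix
open scoped NNReal ENNReal

set_option linter.unusedSectionVars false

noncomputable section
namespace RAQMIMO


/-! The channel statistics enter the SINR through a single number. The MMSE filter splits every
channel into an estimate plus an error, and a rotation of the primitive Gaussians (`mix`,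
`stdC_map_mix`) turns them into independent standard families: estimates, symbols, errors, data
noise. Since the detector inverts Φ D Ĥ, `Model.gain_eq` writes the gain of user k' in the output
for user k as a constant (zero unless k = k') plus a form that is linear in the errors, with
coefficients depending on the estimates only. Conditioning on the estimates then gives every power
exactly (`Model.interference_eq`): the denominator is ρ|Φ|² E‖c_k‖² times the first factor in the
denominator of the closed form, and |Φ|² E‖c_k‖² = E[(ĤᴴĤ)⁻¹]_kk. The rate bound follows from
E[(ĤᴴĤ)⁻¹]_kk ≤ (M-K)⁻¹ [(Ψ + H̄ᴴH̄/M)⁻¹]_kk.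

This is an estimate on the inverse of a noncentral complex Wishart matrix W. Scaling the columns,
then rotating by the eigenvectors of the Gram matrix of the mean, reduces it to unit variances and a
mean with orthogonal columns. Reflections then kill the off-diagonal means
(`integral_invGram_off_diag`), and what remains is E[W⁻¹]_kk ≤ M / ((M-K)(M+‖a‖²)) with a the k-th
column of the mean (`lintegral_inv_gram_le`).

Here [W⁻¹]_kk is the reciprocal of the squared distance from column k to the span of the others.
Given the others, that squared distance is noncentral chi-square, so its mean reciprocal is an
integral over s of (1+s)^(-(M-K+1)) exp(-(s/(1+s)) q), where q is the squared distance from a to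
that span. By a Laplace-order comparison (`lintegral_exp_resid_le`) the integral can only grow when
the other columns are centred. With centred columns, a fixed y has mean reciprocal squared distance
at most (M-1)/(M-K) · ‖y‖⁻², and `lintegral_laplace_le` bounds E‖a+x‖⁻² by M/((M-1)(M+‖a‖²)). The
product of the two bounds is the claim. -/

/-! ### Complex Gaussian laws and their characteristic functions. -/

instance (v : ℝ≥0) : IsProbabilityMeasure (circularGaussian v) := by
  unfold circularGaussian
  exact Measure.isProbabilityMeasure_map (by
    apply Measurable.aemeasurable
    exact Complex.measurableEquivRealProd.symm.measurable)

theorem measurable_complex_mk : Measurable (fun z : ℝ × ℝ => (⟨z.1, z.2⟩ : ℂ)) :=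
  Complex.measurableEquivRealProd.symm.measurable

/-- The constant 1/4 combines the variance v/2 of each real coordinate with the 1/2 in the exponent
of the real Gaussian characteristic function. -/
theorem integral_circularGaussian_exp (v : ℝ≥0) (t : ℂ) :
    ∫ z, Complex.exp (((star t * z).re : ℝ) * Complex.I) ∂circularGaussian v
      = Complex.exp (-((v * ‖t‖ ^ 2 / 4 : ℝ) : ℂ)) := by
  unfold circularGaussian
  rw [integral_map measurable_complex_mk.aemeasurable
    (by apply Measurable.aestronglyMeasurable; fun_prop)]
  have h : ∀ z : ℝ × ℝ, Complex.exp (((star t * (⟨z.1, z.2⟩ : ℂ)).re : ℝ) * Complex.I)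
      = Complex.exp (t.re * z.1 * Complex.I) * Complex.exp (t.im * z.2 * Complex.I) := by
    intro z
    rw [← Complex.exp_add]
    congr 1
    simp [Complex.mul_re]
    ring
  simp_rw [h]
  rw [integral_prod_mul (fun x : ℝ => Complex.exp (t.re * x * Complex.I))
    (fun y : ℝ => Complex.exp (t.im * y * Complex.I)), ← charFun_apply_real, ← charFun_apply_real,
    charFun_gaussianReal, charFun_gaussianReal, ← Complex.exp_add]
  congr 1
  rw [← Complex.normSq_eq_norm_sq, Complex.normSq_apply]
  push_cast
  ring

/-- The standard complex Gaussian law on `ι → ℂ`: independent `CN(0, 1)` coordinates. -/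
def stdC (ι : Type*) [Fintype ι] : Measure (ι → ℂ) := Measure.pi fun _ => circularGaussian 1

instance (ι : Type*) [Fintype ι] : IsProbabilityMeasure (stdC ι) := by
  unfold stdC; infer_instance

section charfun
variable {ι κ : Type*} [Fintype ι] [Fintype κ]

theorem integral_stdC_exp (t : ι → ℂ) :
    ∫ z, Complex.exp (((star t ⬝ᵥ z).re : ℝ) * Complex.I) ∂stdC ι
      = Complex.exp (-((∑ i, ‖t i‖ ^ 2) / 4 : ℝ)) := by
  have h : ∀ z : ι → ℂ, Complex.exp (((star t ⬝ᵥ z).re : ℝ) * Complex.I)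
      = ∏ i, Complex.exp (((star (t i) * z i).re : ℝ) * Complex.I) := by
    intro z
    rw [← Complex.exp_sum, ← Finset.sum_mul]
    congr 2
    simp [dotProduct]
  simp_rw [h]
  unfold stdC
  rw [integral_fintype_prod_eq_prod (f := fun i z =>
    Complex.exp (((star (t i) * z).re : ℝ) * Complex.I))]
  simp_rw [integral_circularGaussian_exp]
  rw [← Complex.exp_sum]
  congr 1
  push_cast
  simp [Finset.sum_div]

/-- Translates between real functionals, which `Measure.ext_of_charFunDual` quantifies over, and the
Hermitian pairing used everywhere else. -/
theorem exists_dual_eq [DecidableEq ι] (L : StrongDual ℝ (ι → ℂ)) :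
    ∃ t : ι → ℂ, ∀ z, L z = (star t ⬝ᵥ z).re := by
  refine ⟨fun i => ⟨L (Pi.single i 1), L (Pi.single i Complex.I)⟩, fun z => ?_⟩
  have hz : z = ∑ i, ((z i).re • (Pi.single i 1 : ι → ℂ)
      + (z i).im • (Pi.single i Complex.I : ι → ℂ)) := by
    ext j
    simp [Finset.sum_apply, Pi.single_apply, Finset.sum_add_distrib]
  conv_lhs => rw [hz]
  simp only [map_sum, map_add, map_smul, dotProduct, Complex.re_sum, smul_eq_mul]
  refine Finset.sum_congr rfl fun i _ => ?_
  simp [Complex.mul_re]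
  ring

/-- Measures on `ι → ℂ` with the same complex characteristic function agree. -/
theorem ext_of_integral_exp (μ ν : Measure (ι → ℂ)) [IsFiniteMeasure μ] [IsFiniteMeasure ν]
    (h : ∀ t : ι → ℂ, ∫ z, Complex.exp (((star t ⬝ᵥ z).re : ℝ) * Complex.I) ∂μ
      = ∫ z, Complex.exp (((star t ⬝ᵥ z).re : ℝ) * Complex.I) ∂ν) : μ = ν := by
  classical
  apply Measure.ext_of_charFunDual
  ext L
  obtain ⟨t, ht⟩ := exists_dual_eq L
  simp_rw [charFunDual_apply, ht]
  exact h t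

/-- Images of the standard Gaussian law under co-isometries are standard Gaussian. -/
theorem stdC_map (f : (ι → ℂ) → (κ → ℂ)) (g : (κ → ℂ) → (ι → ℂ)) (hf : Measurable f)
    (hfg : ∀ t z, star t ⬝ᵥ f z = star (g t) ⬝ᵥ z)
    (hg : ∀ t, ∑ i, ‖g t i‖ ^ 2 = ∑ j, ‖t j‖ ^ 2) :
    (stdC ι).map f = stdC κ := by
  have : IsProbabilityMeasure ((stdC ι).map f) := Measure.isProbabilityMeasure_map hf.aemeasurable
  apply ext_of_integral_exp
  intro t
  rw [integral_map hf.aemeasurable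
    (by apply Measurable.aestronglyMeasurable; unfold dotProduct; fun_prop)]
  simp_rw [hfg, integral_stdC_exp, hg]

theorem lintegral_stdC_comp (f : (ι → ℂ) → (κ → ℂ)) (g : (κ → ℂ) → (ι → ℂ)) (hf : Measurable f)
    (hfg : ∀ t z, star t ⬝ᵥ f z = star (g t) ⬝ᵥ z)
    (hg : ∀ t, ∑ i, ‖g t i‖ ^ 2 = ∑ j, ‖t j‖ ^ 2) (F : (κ → ℂ) → ℝ≥0∞) (hF : Measurable F) :
    ∫⁻ z, F (f z) ∂stdC ι = ∫⁻ z, F z ∂stdC κ := by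
  rw [← stdC_map f g hf hfg hg, lintegral_map hF hf]

end charfun

/-! Reindexing and splitting -/

section split
variable {ι κ α β : Type*} [Fintype ι] [Fintype κ] [Fintype α] [Fintype β]

theorem stdC_map_equiv (e : κ ≃ ι) : (stdC ι).map (fun z => z ∘ e) = stdC κ := by
  refine stdC_map _ (fun t => t ∘ e.symm) (by fun_prop) (fun t z => ?_) fun t => ?_
  · simp only [dotProduct, Pi.star_apply, Function.comp]
    exact Fintype.sum_equiv e _ _ (by simp)
  · exact (Fintype.sum_equiv e _ _ (by simp)).symm

theorem stdC_sum : (stdC (α ⊕ β)).map (fun z => (fun a => z (Sum.inl a), fun b => z (Sum.inr b)))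
    = (stdC α).prod (stdC β) :=
  (measurePreserving_sumPiEquivProdPi (fun _ : α ⊕ β => circularGaussian 1)).map_eq

theorem stdC_sum_symm : ((stdC α).prod (stdC β)).map (fun p => Sum.elim p.1 p.2)
    = stdC (α ⊕ β) := by
  rw [← stdC_sum, Measure.map_map]
  · convert Measure.map_id using 2
    ext z i
    cases i <;> rfl
  · refine measurable_pi_iff.2 fun i => ?_
    cases i <;> simp <;> fun_prop
  · fun_prop

theorem lintegral_stdC_sum (F : (α ⊕ β → ℂ) → ℝ≥0∞) (hF : Measurable F) :
    ∫⁻ z, F z ∂stdC (α ⊕ β) = ∫⁻ x, ∫⁻ y, F (Sum.elim x y) ∂stdC β ∂stdC α := by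
  have hm : Measurable (fun p : (α → ℂ) × (β → ℂ) => Sum.elim p.1 p.2) := by
    refine measurable_pi_iff.2 fun i => ?_
    cases i <;> simp <;> fun_prop
  rw [← stdC_sum_symm, lintegral_map hF hm, lintegral_prod (fun p => F (Sum.elim p.1 p.2)) (hF.comp hm).aemeasurable]

end split

/-! Scalar moments -/

theorem lintegral_circularGaussian (v : ℝ≥0) (F : ℂ → ℝ≥0∞) (hF : Measurable F) :
    ∫⁻ z, F z ∂circularGaussian v
      = ∫⁻ x, ∫⁻ y, F ⟨x, y⟩ ∂gaussianReal 0 (v / 2) ∂gaussianReal 0 (v / 2) := by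
  unfold circularGaussian
  rw [lintegral_map hF measurable_complex_mk,
    lintegral_prod (fun p => F ⟨p.1, p.2⟩) (hF.comp measurable_complex_mk).aemeasurable]

theorem lintegral_gaussianReal_exp {s : ℝ} (hs : 0 ≤ s) (a : ℝ) :
    ∫⁻ x, ENNReal.ofReal (Real.exp (-s * (a + x) ^ 2)) ∂gaussianReal 0 (1 / 2)
      = ENNReal.ofReal ((1 + s) ^ (-(1 / 2 : ℝ)) * Real.exp (-(s / (1 + s)) * a ^ 2)) := by
  have h1 : (0 : ℝ) < 1 + s := by linarith
  -- Completing the square turns the integrand into a multiple of the Gaussian density with mean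
  -- -(s/(1+s)) a and this variance v.
  obtain ⟨v, hvc⟩ : ∃ v : ℝ≥0, (v : ℝ) = 1 / (2 * (1 + s)) := ⟨⟨_, by positivity⟩, rfl⟩
  have hv0 : v ≠ 0 := by
    rw [← NNReal.coe_ne_zero, hvc]
    positivity
  rw [gaussianReal_of_var_ne_zero 0 (by norm_num), lintegral_withDensity_eq_lintegral_mul _
    (measurable_gaussianPDF _ _) (by fun_prop)]
  have key : ∀ x, gaussianPDFReal 0 (1 / 2) x * Real.exp (-s * (a + x) ^ 2)
      = ((1 + s) ^ (-(1 / 2 : ℝ)) * Real.exp (-(s / (1 + s)) * a ^ 2))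
        * gaussianPDFReal (-(s / (1 + s)) * a) v x := by
    intro x
    simp only [gaussianPDFReal, hvc]
    have e1 : (1 + s) ^ (-(1 / 2 : ℝ)) = (Real.sqrt (1 + s))⁻¹ := by
      rw [Real.rpow_neg h1.le, Real.sqrt_eq_rpow]
    have e2 : Real.sqrt (2 * Real.pi * (1 / (2 * (1 + s)))) = Real.sqrt Real.pi / Real.sqrt (1 + s) := by
      rw [← Real.sqrt_div Real.pi_pos.le]
      congr 1
      field_simp
    have e3 : Real.sqrt (2 * Real.pi * ((1 / 2 : ℝ≥0) : ℝ)) = Real.sqrt Real.pi := by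
      congr 1
      push_cast
      ring
    have hs1 : Real.sqrt (1 + s) ≠ 0 := by positivity
    have hs2 : Real.sqrt Real.pi ≠ 0 := by positivity
    rw [e1, e2, e3, mul_assoc, ← Real.exp_add, mul_mul_mul_comm, ← Real.exp_add]
    congr 1
    · field_simp
    · congr 1
      push_cast
      field_simp
      ring
  simp only [Pi.mul_apply, gaussianPDF]
  simp_rw [← ENNReal.ofReal_mul (gaussianPDFReal_nonneg _ _ _), key]
  simp_rw [ENNReal.ofReal_mul (show 0 ≤ (1 + s) ^ (-(1 / 2 : ℝ)) * Real.exp (-(s / (1 + s)) * a ^ 2)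
    by positivity)]
  rw [lintegral_const_mul _ (by fun_prop)]
  have := lintegral_gaussianPDF_eq_one (-(s / (1 + s)) * a) hv0
  simp only [gaussianPDF] at this
  rw [this, mul_one]

theorem lintegral_circularGaussian_exp {s : ℝ} (hs : 0 ≤ s) (a : ℂ) :
    ∫⁻ z, ENNReal.ofReal (Real.exp (-s * ‖a + z‖ ^ 2)) ∂circularGaussian 1
      = ENNReal.ofReal ((1 + s)⁻¹ * Real.exp (-(s / (1 + s)) * ‖a‖ ^ 2)) := by
  have h1 : (0 : ℝ) < 1 + s := by linarith
  rw [lintegral_circularGaussian _ _ (by fun_prop)]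
  have h : ∀ x y : ℝ, ENNReal.ofReal (Real.exp (-s * ‖a + (⟨x, y⟩ : ℂ)‖ ^ 2))
      = ENNReal.ofReal (Real.exp (-s * (a.re + x) ^ 2)) *
        ENNReal.ofReal (Real.exp (-s * (a.im + y) ^ 2)) := by
    intro x y
    rw [← ENNReal.ofReal_mul (Real.exp_nonneg _), ← Real.exp_add, ← Complex.normSq_eq_norm_sq,
      Complex.normSq_apply]
    simp only [Complex.add_re, Complex.add_im]
    congr 2
    ring
  simp_rw [h]
  simp_rw [lintegral_const_mul _ (show Measurable fun y : ℝ =>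
    ENNReal.ofReal (Real.exp (-s * (a.im + y) ^ 2)) by fun_prop), lintegral_gaussianReal_exp hs]
  rw [lintegral_mul_const _ (by fun_prop), lintegral_gaussianReal_exp hs,
    ← ENNReal.ofReal_mul (by positivity)]
  congr 1
  rw [mul_mul_mul_comm, ← Real.exp_add, ← Real.rpow_add h1, ← Complex.normSq_eq_norm_sq,
    Complex.normSq_apply]
  norm_num [Real.rpow_neg_one]
  left
  ring

theorem lintegral_circularGaussian_sq (v : ℝ≥0) :
    ∫⁻ z, ENNReal.ofReal (‖z‖ ^ 2) ∂circularGaussian v = v := by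
  rw [lintegral_circularGaussian _ _ (by fun_prop)]
  have hr : ∫⁻ x, ENNReal.ofReal (x ^ 2) ∂gaussianReal 0 (v / 2) = (v / 2 : ℝ≥0) := by
    have h2 : MemLp id 2 (gaussianReal 0 (v / 2)) := memLp_id_gaussianReal 2
    have hv := variance_id_gaussianReal (μ := 0) (v := v / 2)
    rw [variance_eq_sub h2] at hv
    simp only [integral_id_gaussianReal, Pi.pow_apply, id] at hv
    rw [← ofReal_integral_eq_lintegral_ofReal]
    · simp only [ne_eq, OfNat.ofNat_ne_zero, not_false_eq_true, zero_pow, sub_zero] at hv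
      rw [hv]
      exact ENNReal.ofReal_coe_nnreal
    · exact h2.integrable_sq
    · filter_upwards with x using sq_nonneg x
  have h : ∀ x y : ℝ, ENNReal.ofReal (‖(⟨x, y⟩ : ℂ)‖ ^ 2)
      = ENNReal.ofReal (x ^ 2) + ENNReal.ofReal (y ^ 2) := by
    intro x y
    rw [← ENNReal.ofReal_add (sq_nonneg _) (sq_nonneg _), ← Complex.normSq_eq_norm_sq,
      Complex.normSq_apply]
    congr 1
    simp only
    ring
  simp_rw [h]
  have hi : ∀ x : ℝ, ∫⁻ y, (ENNReal.ofReal (x ^ 2) + ENNReal.ofReal (y ^ 2))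
      ∂gaussianReal 0 (v / 2) = ENNReal.ofReal (x ^ 2) + (v / 2 : ℝ≥0) := by
    intro x
    rw [lintegral_add_left measurable_const, hr]
    simp
  simp_rw [hi]
  rw [lintegral_add_right _ measurable_const, hr, lintegral_const, measure_univ, mul_one,
    ← ENNReal.coe_add, add_halves]

theorem circularGaussian_map_mul (c : ℝ) :
    (circularGaussian 1).map (fun z => (c : ℂ) * z) = circularGaussian (c ^ 2).toNNReal := by
  have h1 : (gaussianReal 0 (1 / 2)).map (fun x => c * x)
      = gaussianReal 0 ((c ^ 2).toNNReal / 2) := by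
    have := gaussianReal_map_const_mul (μ := 0) (v := 1 / 2) c
    rw [this, mul_zero]
    congr 1
    apply NNReal.eq
    push_cast
    rw [Real.coe_toNNReal _ (sq_nonneg c)]
    change c ^ 2 * (1 / 2) = _
    ring
  unfold circularGaussian
  rw [Measure.map_map (by fun_prop) measurable_complex_mk, ← h1, Measure.map_prod_map _ _ (by fun_prop)
    (by fun_prop), Measure.map_map measurable_complex_mk (by fun_prop)]
  congr 1
  ext z
  simp [Complex.ext_iff, Prod.map]



/-! ### Gram matrices: residuals, Schur complements, row deletion. -/

section algebra
open scoped ComplexOrder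
variable {ι κ : Type*} [Fintype ι] [Fintype κ] [DecidableEq ι] [DecidableEq κ]

/-- Orthogonal projection off the column space of `H` (when its Gram matrix is invertible). -/
def projOff (H : Matrix ι κ ℂ) : Matrix ι ι ℂ := 1 - H * (Hᴴ * H)⁻¹ * Hᴴ

/-- Squared norm of the part of `x` orthogonal to the columns of `H`. -/
def resid (H : Matrix ι κ ℂ) (x : ι → ℂ) : ℝ := (star x ⬝ᵥ (projOff H *ᵥ x)).re

theorem projOff_isHermitian (H : Matrix ι κ ℂ) : (projOff H).IsHermitian := by
  unfold projOff
  apply IsHermitian.sub isHermitian_one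
  exact isHermitian_mul_mul_conjTranspose _ (isHermitian_conjTranspose_mul_self H).inv

theorem projOff_mul_self (H : Matrix ι κ ℂ) : projOff H * projOff H = projOff H := by
  by_cases h : IsUnit (Hᴴ * H).det
  · have h1 : H * (Hᴴ * H)⁻¹ * Hᴴ * (H * (Hᴴ * H)⁻¹ * Hᴴ) = H * (Hᴴ * H)⁻¹ * Hᴴ := by
      calc _ = H * ((Hᴴ * H)⁻¹ * (Hᴴ * H)) * (Hᴴ * H)⁻¹ * Hᴴ := by simp only [Matrix.mul_assoc]
        _ = _ := by rw [nonsing_inv_mul _ h, Matrix.mul_one]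
    unfold projOff
    rw [sub_mul, mul_sub, mul_sub, h1]
    simp
  -- A singular Gram matrix has inverse `0` by convention, so `projOff H` is the identity, which is
  -- still idempotent.
  · simp [projOff, nonsing_inv_apply_not_isUnit _ h]

theorem trace_projOff (H : Matrix ι κ ℂ) (h : IsUnit (Hᴴ * H).det) :
    (projOff H).trace = (Fintype.card ι : ℂ) - Fintype.card κ := by
  unfold projOff
  rw [trace_sub, trace_one, Matrix.mul_assoc, trace_mul_comm, Matrix.mul_assoc,
    nonsing_inv_mul _ h, trace_one]

theorem star_dotProduct_self (x : ι → ℂ) : star x ⬝ᵥ x = ((∑ i, ‖x i‖ ^ 2 : ℝ) : ℂ) := by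
  simp [dotProduct, Complex.conj_mul']

theorem dotProduct_projOff (H : Matrix ι κ ℂ) (x : ι → ℂ) :
    star x ⬝ᵥ (projOff H *ᵥ x) = star (projOff H *ᵥ x) ⬝ᵥ (projOff H *ᵥ x) := by
  rw [star_mulVec, (projOff_isHermitian H).eq, ← dotProduct_mulVec, mulVec_mulVec,
    projOff_mul_self]

theorem resid_eq_sum (H : Matrix ι κ ℂ) (x : ι → ℂ) :
    resid H x = ∑ i, ‖(projOff H *ᵥ x) i‖ ^ 2 := by
  unfold resid
  rw [dotProduct_projOff, star_dotProduct_self, Complex.ofReal_re]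

theorem coe_resid (H : Matrix ι κ ℂ) (x : ι → ℂ) :
    (resid H x : ℂ) = star x ⬝ᵥ (projOff H *ᵥ x) := by
  rw [resid_eq_sum, dotProduct_projOff, star_dotProduct_self]

theorem resid_nonneg (H : Matrix ι κ ℂ) (x : ι → ℂ) : 0 ≤ resid H x := by
  rw [resid_eq_sum]; positivity

theorem projOff_unitary_mul {U : Matrix ι ι ℂ} (hU : Uᴴ * U = 1) (H : Matrix ι κ ℂ) :
    projOff (U * H) = U * projOff H * Uᴴ := by
  have hU' : U * Uᴴ = 1 := mul_eq_one_comm.1 hU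
  have h1 : (U * H)ᴴ * (U * H) = Hᴴ * H := by
    rw [conjTranspose_mul, Matrix.mul_assoc, ← Matrix.mul_assoc Uᴴ, hU, Matrix.one_mul]
  unfold projOff
  rw [h1, conjTranspose_mul, mul_sub, sub_mul, Matrix.mul_one, hU']
  simp only [Matrix.mul_assoc]

theorem resid_unitary_mul {U : Matrix ι ι ℂ} (hU : Uᴴ * U = 1) (H : Matrix ι κ ℂ) (x : ι → ℂ) :
    resid (U * H) (U *ᵥ x) = resid H x := by
  unfold resid
  rw [projOff_unitary_mul hU, star_mulVec, ← dotProduct_mulVec, mulVec_mulVec, mulVec_mulVec]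
  congr 3
  rw [← Matrix.mul_assoc, ← Matrix.mul_assoc, hU, Matrix.one_mul, Matrix.mul_assoc, hU,
    Matrix.mul_one]

theorem resid_mul_of_orthogonal {a : ι → ℂ} {H : Matrix ι κ ℂ} (h : Hᴴ *ᵥ a = 0) :
    resid H a = ∑ i, ‖a i‖ ^ 2 := by
  unfold resid projOff
  rw [sub_mulVec, one_mulVec, ← mulVec_mulVec, h, mulVec_zero, sub_zero, star_dotProduct_self,
    Complex.ofReal_re]

/-- `H` without its column `k`. -/
def dropCol (H : Matrix ι κ ℂ) (k : κ) : Matrix ι {j // j ≠ k} ℂ := H.submatrix id Subtype.val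

/-- `H` without its row `i`. -/
def dropRow (H : Matrix ι κ ℂ) (i : ι) : Matrix {j // j ≠ i} κ ℂ := H.submatrix Subtype.val id

/-- Separation of one element. -/
def splitOne (k : κ) : κ ≃ {j // j ≠ k} ⊕ Unit where
  toFun j := if h : j = k then Sum.inr () else Sum.inl ⟨j, h⟩
  invFun := Sum.elim Subtype.val fun _ => k
  left_inv j := by by_cases h : j = k <;> simp [h]
  right_inv x := by
    rcases x with ⟨j, h⟩ | u
    · simp [h]
    · simp

theorem gram_split (H : Matrix ι κ ℂ) (k : κ) :
    (Hᴴ * H).submatrix (splitOne k).symm (splitOne k).symm =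
      fromBlocks ((dropCol H k)ᴴ * dropCol H k) ((dropCol H k)ᴴ * replicateCol Unit (H.col k))
        ((replicateCol Unit (H.col k))ᴴ * dropCol H k)
        ((replicateCol Unit (H.col k))ᴴ * replicateCol Unit (H.col k)) := by
  ext i j
  rcases i with i | i <;> rcases j with j | j <;>
    simp [splitOne, dropCol, Matrix.mul_apply, replicateCol, Matrix.col]

/-- The residual of column k is the Schur complement of the Gram block of the other columns. Both
the determinant recursion `det_gram` and the inverse entry `inv_gram_apply` come from this. -/
theorem schur_gram (H : Matrix ι κ ℂ) (k : κ) :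
    (replicateCol Unit (H.col k))ᴴ * replicateCol Unit (H.col k)
      - (replicateCol Unit (H.col k))ᴴ * dropCol H k * ((dropCol H k)ᴴ * dropCol H k)⁻¹ *
        ((dropCol H k)ᴴ * replicateCol Unit (H.col k))
      = of fun _ _ => (resid (dropCol H k) (H.col k) : ℂ) := by
  ext u v
  rw [of_apply, coe_resid]
  unfold projOff
  rw [sub_mulVec, one_mulVec, dotProduct_sub, Matrix.sub_apply]
  congr 1
  rw [Matrix.mul_assoc, Matrix.mul_assoc, ← Matrix.mul_assoc _ (dropCol H k)ᴴ]
  rw [← Matrix.mul_assoc (dropCol H k), ← Matrix.mul_assoc (dropCol H k)]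
  generalize dropCol H k * ((dropCol H k)ᴴ * dropCol H k)⁻¹ * (dropCol H k)ᴴ = P
  rfl

theorem det_gram (H : Matrix ι κ ℂ) (k : κ) (h : IsUnit ((dropCol H k)ᴴ * dropCol H k).det) :
    (Hᴴ * H).det = ((dropCol H k)ᴴ * dropCol H k).det * resid (dropCol H k) (H.col k) := by
  rw [← det_submatrix_equiv_self (splitOne k).symm, gram_split]
  let _ := invertibleOfIsUnitDet _ h
  rw [det_fromBlocks₁₁, invOf_eq_nonsing_inv, schur_gram]
  simp

/-- The lower right block of the inverse of a block matrix is the inverse of the Schur complement,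
here a scalar. -/
theorem inv_gram_apply (H : Matrix ι κ ℂ) (k : κ)
    (h : IsUnit ((dropCol H k)ᴴ * dropCol H k).det) (h0 : resid (dropCol H k) (H.col k) ≠ 0) :
    (Hᴴ * H)⁻¹ k k = ((resid (dropCol H k) (H.col k))⁻¹ : ℝ) := by
  have hdet : IsUnit (Hᴴ * H).det := by
    rw [det_gram H k h]
    exact h.mul (by simpa using h0)
  have e1 : (Hᴴ * H)⁻¹ k k = ((Hᴴ * H).submatrix (splitOne k).symm (splitOne k).symm)⁻¹
      (Sum.inr ()) (Sum.inr ()) := by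
    rw [inv_submatrix_equiv]
    simp [splitOne]
  have hdet' : IsUnit ((Hᴴ * H).submatrix (splitOne k).symm (splitOne k).symm).det := by
    rwa [det_submatrix_equiv_self]
  rw [e1]
  rw [gram_split] at hdet' ⊢
  let _ := invertibleOfIsUnitDet _ h
  let _ := invertibleOfIsUnitDet _ hdet'
  have hs := schur_gram H k
  rw [← invOf_eq_nonsing_inv] at hs
  have hs' : IsUnit ((replicateCol Unit (H.col k))ᴴ * replicateCol Unit (H.col k)
      - (replicateCol Unit (H.col k))ᴴ * dropCol H k * ⅟((dropCol H k)ᴴ * dropCol H k) *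
        ((dropCol H k)ᴴ * replicateCol Unit (H.col k))).det := by
    rw [hs]; simpa using h0
  let _ := invertibleOfIsUnitDet _ hs'
  rw [← invOf_eq_nonsing_inv, invOf_fromBlocks₁₁_eq, fromBlocks_apply₂₂, invOf_eq_nonsing_inv, hs,
    inv_subsingleton]
  simp

/-- The quadratic form `r (Hᴴ H)⁻¹ rᴴ`. -/
def quadInv (H : Matrix ι κ ℂ) (r : κ → ℂ) : ℝ := (r ⬝ᵥ ((Hᴴ * H)⁻¹ *ᵥ star r)).re

theorem coe_quadInv (H : Matrix ι κ ℂ) (r : κ → ℂ) :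
    (quadInv H r : ℂ) = r ⬝ᵥ ((Hᴴ * H)⁻¹ *ᵥ star r) := by
  have h := (posSemidef_conjTranspose_mul_self H).inv.dotProduct_mulVec_nonneg (star r)
  rw [star_star] at h
  exact (Complex.ext (by simp [quadInv]) (by simpa using (Complex.nonneg_iff.1 h).2))

theorem quadInv_nonneg (H : Matrix ι κ ℂ) (r : κ → ℂ) : 0 ≤ quadInv H r := by
  have h := (posSemidef_conjTranspose_mul_self H).inv.dotProduct_mulVec_nonneg (star r)
  rw [star_star] at h
  exact (Complex.nonneg_iff.1 h).1

theorem gram_eq_dropRow (H : Matrix ι κ ℂ) (i : ι) :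
    Hᴴ * H = vecMulVec (star (H i)) (H i) + (dropRow H i)ᴴ * dropRow H i := by
  ext a b
  simp only [Matrix.mul_apply, conjTranspose_apply, Matrix.add_apply, vecMulVec_apply, dropRow,
    submatrix_apply, id, Pi.star_apply]
  rw [← (splitOne i).symm.sum_comp, Fintype.sum_sum_type, add_comm]
  simp [splitOne]

theorem isUnit_gram_of_dropRow (H : Matrix ι κ ℂ) (i : ι)
    (h : IsUnit ((dropRow H i)ᴴ * dropRow H i).det) : IsUnit (Hᴴ * H).det := by
  rw [← isUnit_iff_isUnit_det] at h ⊢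
  rw [gram_eq_dropRow H i, add_comm]
  apply PosDef.isUnit
  apply PosDef.add_posSemidef
  · exact (posSemidef_conjTranspose_mul_self _).posDef_iff_isUnit.2 h
  · simpa using posSemidef_vecMulVec_self_star (star (H i))

/-- Sherman–Morrison: the Gram matrix is that of the remaining rows plus a rank-one term from row i,
so with t = r (RᴴR)⁻¹ rᴴ the projection keeps the fraction t/(1+t) of the i-th basis vector and the
residual is the rest, 1/(1+t). -/
theorem resid_single (H : Matrix ι κ ℂ) (i : ι) (α : ℂ)
    (h : IsUnit ((dropRow H i)ᴴ * dropRow H i).det) :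
    resid H (Pi.single i α) = ‖α‖ ^ 2 / (1 + quadInv (dropRow H i) (H i)) := by
  set R := dropRow H i
  set r := H i with hr
  have ht := quadInv_nonneg R r
  have h1 : (1 + (quadInv R r : ℂ)) ≠ 0 := by
    rw [← Complex.ofReal_one, ← Complex.ofReal_add, Complex.ofReal_ne_zero]
    positivity
  have e1 : (Hᴴ * H) *ᵥ ((Rᴴ * R)⁻¹ *ᵥ star r) = (1 + (quadInv R r : ℂ)) • star r := by
    rw [gram_eq_dropRow H i, add_mulVec, mulVec_mulVec _ (Rᴴ * R), mul_nonsing_inv _ h, one_mulVec,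
      vecMulVec_mulVec, coe_quadInv, add_smul, one_smul, add_comm]
    simp [R, r]
  have e2 : (Hᴴ * H)⁻¹ *ᵥ star r = (1 + (quadInv R r : ℂ))⁻¹ • ((Rᴴ * R)⁻¹ *ᵥ star r) := by
    have := congrArg (fun v => (1 + (quadInv R r : ℂ))⁻¹ • ((Hᴴ * H)⁻¹ *ᵥ v)) e1
    simp only [mulVec_mulVec, mulVec_smul, smul_smul, inv_mul_cancel₀ h1, one_smul] at this
    rw [← this, ← Matrix.mul_assoc, nonsing_inv_mul _ (isUnit_gram_of_dropRow H i h),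
      Matrix.one_mul]
  have e3 : Hᴴ *ᵥ Pi.single i α = α • star r := by
    ext j
    simp [hr, mul_comm]
  have e4 : star (Pi.single i α : ι → ℂ) ⬝ᵥ (H *ᵥ ((Hᴴ * H)⁻¹ *ᵥ star r))
      = star α * ((1 + (quadInv R r : ℂ))⁻¹ * quadInv R r) := by
    rw [e2, coe_quadInv, ← Pi.single_star, single_dotProduct, mulVec_smul, Pi.smul_apply,
      smul_eq_mul]
    rfl
  rw [← Complex.ofReal_inj, coe_resid]
  unfold projOff
  rw [sub_mulVec, one_mulVec, dotProduct_sub, ← mulVec_mulVec, ← mulVec_mulVec, e3, mulVec_smul,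
    mulVec_smul, dotProduct_smul, e4, ← Pi.single_star, single_dotProduct, Pi.single_eq_same]
  push_cast
  rw [← Complex.conj_mul']
  simp only [smul_eq_mul, RCLike.star_def]
  field_simp
  ring

/-- The normalized vector is extended to an orthonormal basis in which it has index i; the
conjugated basis vectors are the rows of U. -/
theorem exists_unitary_mulVec_eq_single (x : ι → ℂ) (i : ι) :
    ∃ U : Matrix ι ι ℂ, Uᴴ * U = 1 ∧
      U *ᵥ x = Pi.single i ((Real.sqrt (∑ j, ‖x j‖ ^ 2) : ℝ) : ℂ) := by
  by_cases hx : x = 0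
  · exact ⟨1, by simp, by simp [hx]⟩
  set y : EuclideanSpace ℂ ι := WithLp.toLp 2 x with hy
  have hy0 : ‖y‖ ≠ 0 := by
    rw [norm_ne_zero_iff, hy]
    simpa using hx
  have hn : ‖y‖ = Real.sqrt (∑ j, ‖x j‖ ^ 2) := EuclideanSpace.norm_eq y
  have ho : Orthonormal ℂ (({i} : Set ι).domRestrict fun _ : ι => ((‖y‖⁻¹ : ℝ) : ℂ) • y) := by
    rw [orthonormal_iff_ite]
    rintro ⟨a, ha⟩ ⟨b, hb⟩
    simp only [Set.mem_singleton_iff] at ha hb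
    subst ha; subst hb
    simp only [if_true, Set.domRestrict_apply, inner_self_eq_norm_sq_to_K, norm_smul]
    norm_num
    field_simp
    simp
  obtain ⟨b, hb⟩ := ho.exists_orthonormalBasis_extension_of_card_eq
    (by simp : Module.finrank ℂ (EuclideanSpace ℂ ι) = Fintype.card ι)
  have hbi := hb i rfl
  have hinner : ∀ a c : EuclideanSpace ℂ ι, inner ℂ a c = ∑ j, star (a j) * c j := by
    intro a c
    simp [PiLp.inner_apply, mul_comm]
  refine ⟨of fun a j => star (b a j), mul_eq_one_comm.1 ?_, ?_⟩
  · ext a c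
    have := orthonormal_iff_ite.1 b.orthonormal a c
    rw [hinner] at this
    simpa [Matrix.mul_apply, Matrix.one_apply] using this
  · have hyb : x = WithLp.ofLp ((‖y‖ : ℂ) • b i) := by
      rw [hbi, smul_smul]
      push_cast
      rw [mul_inv_cancel₀ (by exact_mod_cast hy0), one_smul]
    ext a
    have := orthonormal_iff_ite.1 b.orthonormal a i
    rw [hinner] at this
    rw [← hn, hyb]
    simp only [mulVec, dotProduct, of_apply, WithLp.ofLp_smul, Pi.smul_apply, smul_eq_mul]
    rw [Finset.sum_congr rfl fun j _ => mul_left_comm _ _ _, ← Finset.mul_sum, this,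
      Pi.single_apply]
    simp

end algebra


/-! ### Measurability of matrix expressions. -/

section measurability
variable {Ω : Type*} [MeasurableSpace Ω] {ι κ ν : Type*} [Fintype ι] [Fintype κ] [Fintype ν]
  [DecidableEq ι] [DecidableEq κ]

/-- A matrix-valued function all of whose entries are measurable. -/
def EntryMeasurable (F : Ω → Matrix ι κ ℂ) : Prop := ∀ i j, Measurable fun ω => F ω i j

theorem EntryMeasurable.const (A : Matrix ι κ ℂ) : EntryMeasurable fun _ : Ω => A :=
  fun _ _ => measurable_const

theorem EntryMeasurable.add {F G : Ω → Matrix ι κ ℂ} (hF : EntryMeasurable F)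
    (hG : EntryMeasurable G) : EntryMeasurable fun ω => F ω + G ω :=
  fun i j => (hF i j).add (hG i j)

theorem EntryMeasurable.sub {F G : Ω → Matrix ι κ ℂ} (hF : EntryMeasurable F)
    (hG : EntryMeasurable G) : EntryMeasurable fun ω => F ω - G ω :=
  fun i j => (hF i j).sub (hG i j)

theorem EntryMeasurable.mul {F : Ω → Matrix ι κ ℂ} {G : Ω → Matrix κ ν ℂ}
    (hF : EntryMeasurable F) (hG : EntryMeasurable G) : EntryMeasurable fun ω => F ω * G ω := by
  intro i j
  simp only [Matrix.mul_apply]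
  exact Finset.measurable_sum _ fun l _ => (hF i l).mul (hG l j)

theorem EntryMeasurable.conjTranspose {F : Ω → Matrix ι κ ℂ} (hF : EntryMeasurable F) :
    EntryMeasurable fun ω => (F ω)ᴴ := by
  intro i j
  exact continuous_star.measurable.comp (hF j i)

theorem EntryMeasurable.det {F : Ω → Matrix ι ι ℂ} (hF : EntryMeasurable F) :
    Measurable fun ω => (F ω).det := by
  simp only [Matrix.det_apply]
  exact Finset.measurable_sum _ fun σ _ =>
    (Finset.measurable_prod _ fun i _ => hF (σ i) i).const_smul _

/-- By Cramer's rule an entry is a cofactor times the scalar inverse of the determinant. Scalar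
inversion is measurable on all of ℂ, so singular matrices need no exclusion. -/
theorem EntryMeasurable.inv {F : Ω → Matrix ι ι ℂ} (hF : EntryMeasurable F) :
    EntryMeasurable fun ω => (F ω)⁻¹ := by
  intro i j
  have h2 : Measurable fun ω => (F ω).adjugate i j := by
    simp only [adjugate_apply]
    refine EntryMeasurable.det fun a b => ?_
    by_cases h : a = j
    · subst h
      simp only [updateRow_self]
      exact measurable_const
    · simp only [updateRow_ne h]
      exact hF a b
  simp only [Matrix.inv_def, Matrix.smul_apply, Ring.inverse_eq_inv', smul_eq_mul]
  exact hF.det.inv.mul h2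

theorem EntryMeasurable.mulVec {F : Ω → Matrix ι κ ℂ} {x : Ω → κ → ℂ} (hF : EntryMeasurable F)
    (hx : Measurable x) : Measurable fun ω => F ω *ᵥ x ω := by
  refine measurable_pi_iff.2 fun i => ?_
  simp only [Matrix.mulVec, dotProduct]
  exact Finset.measurable_sum _ fun l _ => (hF i l).mul (measurable_pi_iff.1 hx l)

theorem measurable_dotProduct {x y : Ω → κ → ℂ} (hx : Measurable x) (hy : Measurable y) :
    Measurable fun ω => x ω ⬝ᵥ y ω := by
  simp only [dotProduct]
  exact Finset.measurable_sum _ fun l _ => (measurable_pi_iff.1 hx l).mul (measurable_pi_iff.1 hy l)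

theorem measurable_star_vec {x : Ω → κ → ℂ} (hx : Measurable x) : Measurable fun ω => star (x ω) :=
  measurable_pi_iff.2 fun i => continuous_star.measurable.comp (measurable_pi_iff.1 hx i)

theorem EntryMeasurable.resid {F : Ω → Matrix ι κ ℂ} {x : Ω → ι → ℂ} (hF : EntryMeasurable F)
    (hx : Measurable x) : Measurable fun ω => resid (F ω) (x ω) := by
  unfold RAQMIMO.resid projOff
  refine Complex.measurable_re.comp (measurable_dotProduct (measurable_star_vec hx) ?_)
  refine EntryMeasurable.mulVec ?_ hx
  exact (EntryMeasurable.const 1).sub ((hF.mul (hF.conjTranspose.mul hF).inv).mul hF.conjTranspose)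

theorem EntryMeasurable.quadInv {F : Ω → Matrix ι κ ℂ} {x : Ω → κ → ℂ} (hF : EntryMeasurable F)
    (hx : Measurable x) : Measurable fun ω => quadInv (F ω) (x ω) := by
  unfold RAQMIMO.quadInv
  exact Complex.measurable_re.comp (measurable_dotProduct hx
    ((hF.conjTranspose.mul hF).inv.mulVec (measurable_star_vec hx)))

end measurability

/-! ### Unitary invariance, conditioning on columns or rows, and the law of a residual. -/

section laws
variable {ι κ : Type*} [Fintype ι] [Fintype κ] [DecidableEq ι] [DecidableEq κ]

/-- The matrix with the given family of entries. -/
def mat (z : ι × κ → ℂ) : Matrix ι κ ℂ := of fun i j => z (i, j)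

theorem entryMeasurable_mat : EntryMeasurable (mat : (ι × κ → ℂ) → Matrix ι κ ℂ) :=
  fun i j => measurable_pi_apply (i, j)

/-- The pairing becomes a Frobenius inner product, so the adjoints of left and right multiplication
can be read off from cyclicity of the trace. -/
theorem star_dotProduct_eq_trace (t z : ι × κ → ℂ) :
    star t ⬝ᵥ z = ((mat t)ᴴ * mat z).trace := by
  simp only [dotProduct, trace, Matrix.mul_apply, mat, diag_apply, conjTranspose_apply, of_apply,
    Pi.star_apply, Fintype.sum_prod_type]
  exact Finset.sum_comm

theorem sum_sq_eq_of_trace {t s : ι × κ → ℂ}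
    (h : ((mat t)ᴴ * mat t).trace = ((mat s)ᴴ * mat s).trace) :
    ∑ i, ‖t i‖ ^ 2 = ∑ i, ‖s i‖ ^ 2 := by
  rw [← star_dotProduct_eq_trace, ← star_dotProduct_eq_trace, star_dotProduct_self,
    star_dotProduct_self] at h
  exact_mod_cast h

theorem lintegral_unitary_mul {U : Matrix ι ι ℂ} (hU : Uᴴ * U = 1) (F : Matrix ι κ ℂ → ℝ≥0∞)
    (hF : Measurable fun z : ι × κ → ℂ => F (mat z)) :
    ∫⁻ z, F (U * mat z) ∂stdC (ι × κ) = ∫⁻ z, F (mat z) ∂stdC (ι × κ) := by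
  refine lintegral_stdC_comp (fun z p => (U * mat z : Matrix ι κ ℂ) p.1 p.2) 
    (fun t p => (Uᴴ * mat t : Matrix ι κ ℂ) p.1 p.2)
    ?_ (fun t z => ?_) (fun t => ?_) _ hF
  · exact measurable_pi_iff.2 fun p =>
      ((EntryMeasurable.const U).mul entryMeasurable_mat) p.1 p.2
  · rw [star_dotProduct_eq_trace, star_dotProduct_eq_trace]
    change ((mat t)ᴴ * (U * mat z)).trace = ((Uᴴ * mat t)ᴴ * mat z).trace
    rw [conjTranspose_mul, conjTranspose_conjTranspose, Matrix.mul_assoc]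
  · apply sum_sq_eq_of_trace
    change ((Uᴴ * mat t)ᴴ * (Uᴴ * mat t)).trace = _
    rw [conjTranspose_mul, conjTranspose_conjTranspose, Matrix.mul_assoc, ← Matrix.mul_assoc U,
      mul_eq_one_comm.1 hU, Matrix.one_mul]

theorem lintegral_mul_unitary {V : Matrix κ κ ℂ} (hV : Vᴴ * V = 1) (F : Matrix ι κ ℂ → ℝ≥0∞)
    (hF : Measurable fun z : ι × κ → ℂ => F (mat z)) :
    ∫⁻ z, F (mat z * V) ∂stdC (ι × κ) = ∫⁻ z, F (mat z) ∂stdC (ι × κ) := by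
  refine lintegral_stdC_comp (fun z p => (mat z * V : Matrix ι κ ℂ) p.1 p.2) 
    (fun t p => (mat t * Vᴴ : Matrix ι κ ℂ) p.1 p.2)
    ?_ (fun t z => ?_) (fun t => ?_) _ hF
  · exact measurable_pi_iff.2 fun p =>
      (entryMeasurable_mat.mul (EntryMeasurable.const V)) p.1 p.2
  · rw [star_dotProduct_eq_trace, star_dotProduct_eq_trace]
    change ((mat t)ᴴ * (mat z * V)).trace = ((mat t * Vᴴ)ᴴ * mat z).trace
    rw [conjTranspose_mul, conjTranspose_conjTranspose, Matrix.mul_assoc, trace_mul_comm V,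
      Matrix.mul_assoc]
  · apply sum_sq_eq_of_trace
    change ((mat t * Vᴴ)ᴴ * (mat t * Vᴴ)).trace = _
    rw [conjTranspose_mul, conjTranspose_conjTranspose, trace_mul_comm, Matrix.mul_assoc,
      ← Matrix.mul_assoc Vᴴ, hV, Matrix.one_mul, trace_mul_comm]

theorem lintegral_unitary_mulVec {U : Matrix ι ι ℂ} (hU : Uᴴ * U = 1) (F : (ι → ℂ) → ℝ≥0∞)
    (hF : Measurable F) :
    ∫⁻ z, F (U *ᵥ z) ∂stdC ι = ∫⁻ z, F z ∂stdC ι := by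
  refine lintegral_stdC_comp (fun z => U *ᵥ z) (fun t => Uᴴ *ᵥ t)
    ?_ (fun t z => ?_) (fun t => ?_) _ hF
  · exact (EntryMeasurable.const U).mulVec measurable_id
  · rw [star_mulVec, conjTranspose_conjTranspose, ← dotProduct_mulVec]
  · have h : star (Uᴴ *ᵥ t) ⬝ᵥ (Uᴴ *ᵥ t) = star t ⬝ᵥ t := by
      rw [star_mulVec, conjTranspose_conjTranspose, ← dotProduct_mulVec, mulVec_mulVec,
        mul_eq_one_comm.1 hU, one_mulVec]
    rw [star_dotProduct_self, star_dotProduct_self] at h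
    exact_mod_cast h

theorem lintegral_stdC_equiv_sum {α β : Type*} [Fintype α] [Fintype β] (e : α ⊕ β ≃ ι)
    (F : (α → ℂ) → (β → ℂ) → ℝ≥0∞) (hF : Measurable fun p : (α → ℂ) × (β → ℂ) => F p.1 p.2) :
    ∫⁻ z, F (fun a => z (e (Sum.inl a))) (fun b => z (e (Sum.inr b))) ∂stdC ι
      = ∫⁻ x, ∫⁻ y, F x y ∂stdC β ∂stdC α := by
  have hm : Measurable fun w : α ⊕ β → ℂ => F (fun a => w (Sum.inl a)) (fun b => w (Sum.inr b)) :=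
    hF.comp (f := fun w : α ⊕ β → ℂ => ((fun a => w (Sum.inl a)), (fun b => w (Sum.inr b))))
      (by fun_prop)
  have h1 := lintegral_stdC_sum _ hm
  rw [← stdC_map_equiv e, lintegral_map hm (by fun_prop)] at h1
  exact h1

theorem lintegral_stdC_prod (f : ι → ℂ → ℝ≥0∞) (hf : ∀ i, Measurable (f i)) :
    ∫⁻ z, ∏ i, f i (z i) ∂stdC ι = ∏ i, ∫⁻ z, f i z ∂circularGaussian 1 := by
  have h := lintegral_prod_eq_prod_lintegral_of_indepFun (μ := stdC ι) Finset.univ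
    (fun i z => f i (z i))
    (iIndepFun_pi (μ := fun _ : ι => circularGaussian 1) fun i => (hf i).aemeasurable)
    fun i => (hf i).comp (measurable_pi_apply i)
  rw [h]
  refine Finset.prod_congr rfl fun i _ => ?_
  exact (measurePreserving_eval (fun _ : ι => circularGaussian 1) i).lintegral_comp (hf i)

/-- Separation of a column. -/
def splitColEquiv (ι : Type*) (k : κ) : (ι × {j // j ≠ k}) ⊕ ι ≃ ι × κ where
  toFun := Sum.elim (fun p => (p.1, p.2.1)) fun i => (i, k)
  invFun p := if h : p.2 = k then Sum.inr p.1 else Sum.inl (p.1, ⟨p.2, h⟩)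
  left_inv x := by
    rcases x with ⟨i, j, h⟩ | i
    · simp [h]
    · simp
  right_inv p := by
    obtain ⟨i, j⟩ := p
    by_cases h : j = k <;> simp [h]

/-- Separation of a row. -/
def splitRowEquiv (κ : Type*) (i : ι) : ({l // l ≠ i} × κ) ⊕ κ ≃ ι × κ where
  toFun := Sum.elim (fun p => (p.1.1, p.2)) fun j => (i, j)
  invFun p := if h : p.1 = i then Sum.inr p.2 else Sum.inl (⟨p.1, h⟩, p.2)
  left_inv x := by
    rcases x with ⟨⟨i, h⟩, j⟩ | j
    · simp [h]
    · simp
  right_inv p := by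
    obtain ⟨l, j⟩ := p
    by_cases h : l = i <;> simp [h]

theorem lintegral_split_col (k : κ) (F : Matrix ι {j // j ≠ k} ℂ → (ι → ℂ) → ℝ≥0∞)
    (hF : Measurable fun p : (ι × {j // j ≠ k} → ℂ) × (ι → ℂ) => F (mat p.1) p.2) :
    ∫⁻ z, F (dropCol (mat z) k) ((mat z).col k) ∂stdC (ι × κ)
      = ∫⁻ h, ∫⁻ x, F (mat h) x ∂stdC ι ∂stdC (ι × {j // j ≠ k}) :=
  lintegral_stdC_equiv_sum (splitColEquiv ι k) (fun h x => F (mat h) x) hF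

theorem lintegral_split_row (i : ι) (F : Matrix {l // l ≠ i} κ ℂ → (κ → ℂ) → ℝ≥0∞)
    (hF : Measurable fun p : ({l // l ≠ i} × κ → ℂ) × (κ → ℂ) => F (mat p.1) p.2) :
    ∫⁻ z, F (dropRow (mat z) i) (mat z i) ∂stdC (ι × κ)
      = ∫⁻ h, ∫⁻ x, F (mat h) x ∂stdC κ ∂stdC ({l // l ≠ i} × κ) :=
  lintegral_stdC_equiv_sum (splitRowEquiv κ i) (fun h x => F (mat h) x) hF

/-- Laplace transform of the squared norm of the projection of a Gaussian vector. -/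
theorem lintegral_exp_resid (H : Matrix ι κ ℂ) (hH : IsUnit (Hᴴ * H).det) {n : ℕ}
    (hn : n + Fintype.card κ = Fintype.card ι) (a : ι → ℂ) {s : ℝ} (hs : 0 ≤ s) :
    ∫⁻ x, ENNReal.ofReal (Real.exp (-s * resid H (a + x))) ∂stdC ι
      = ENNReal.ofReal (((1 + s) ^ n)⁻¹ * Real.exp (-(s / (1 + s)) * resid H a)) := by
  have hP := projOff_isHermitian H
  set U : Matrix ι ι ℂ := (hP.eigenvectorUnitary : Matrix ι ι ℂ) with hU
  -- In an eigenbasis of the projection the residual is the sum of |y_i|² over the eigenvalues equal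
  -- to 1, and the Gaussian law is unchanged by the rotation. The trace counts n such eigenvalues.
  have hUU : Uᴴ * U = 1 := by
    have := Unitary.coe_star_mul_self hP.eigenvectorUnitary
    rwa [star_eq_conjTranspose] at this
  have hUU' : U * Uᴴ = 1 := mul_eq_one_comm.1 hUU
  set l := hP.eigenvalues with hl
  have hspec : projOff H = U * diagonal (fun i => (l i : ℂ)) * Uᴴ := by
    have := hP.spectral_theorem
    rw [Unitary.conjStarAlgAut_apply] at this
    exact this
  have hl01 : ∀ i, l i = 0 ∨ l i = 1 := by
    have h2 : Uᴴ * projOff H * U = diagonal (fun i => (l i : ℂ)) := by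
      rw [hspec]
      simp only [Matrix.mul_assoc, hUU, Matrix.mul_one]
      rw [← Matrix.mul_assoc, hUU, Matrix.one_mul]
    have h3 : diagonal (fun i => (l i : ℂ)) * diagonal (fun i => (l i : ℂ))
        = diagonal (fun i => (l i : ℂ)) := by
      rw [← h2]
      calc _ = Uᴴ * projOff H * (U * Uᴴ) * projOff H * U := by simp only [Matrix.mul_assoc]
        _ = Uᴴ * (projOff H * projOff H) * U := by
          rw [hUU', Matrix.mul_one]; simp only [Matrix.mul_assoc]
        _ = _ := by rw [projOff_mul_self]
    intro i
    have h4 := congrFun (congrFun h3 i) i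
    simp only [diagonal_mul_diagonal, diagonal_apply_eq] at h4
    have h5 : l i * l i = l i := by exact_mod_cast h4
    have : l i * (l i - 1) = 0 := by linarith
    rcases mul_eq_zero.1 this with h | h
    · exact Or.inl h
    · exact Or.inr (by linarith)
  have hsum : ∑ i, l i = n := by
    have h1 := hP.trace_eq_sum_eigenvalues
    rw [trace_projOff H hH, ← hn] at h1
    have h2 : ((∑ i, l i : ℝ) : ℂ) = ((n : ℝ) : ℂ) := by
      push_cast
      have h1' := h1.symm
      push_cast at h1'
      rw [add_sub_cancel_right] at h1'
      exact h1'
    exact_mod_cast h2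
  have hprod : ∏ i, (1 + s * l i) = (1 + s) ^ n := by
    have h1 : ∀ i, (1 + s * l i) = if l i = 1 then 1 + s else 1 := by
      intro i
      rcases hl01 i with h | h <;> simp [h]
    have h2 : ((Finset.univ.filter fun i => l i = 1).card : ℝ) = n := by
      rw [← hsum, Finset.card_filter]
      push_cast
      refine Finset.sum_congr rfl fun i _ => ?_
      rcases hl01 i with h | h <;> simp [h]
    simp_rw [h1]
    rw [← Finset.prod_filter, Finset.prod_const]
    congr 1
    exact_mod_cast h2
  have hres : ∀ x, resid H x = ∑ i, l i * ‖(Uᴴ *ᵥ x) i‖ ^ 2 := by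
    intro x
    rw [← Complex.ofReal_inj, coe_resid, hspec, ← mulVec_mulVec, ← mulVec_mulVec,
      dotProduct_mulVec (star x)]
    have : star x ᵥ* U = star (Uᴴ *ᵥ x) := by rw [star_mulVec, conjTranspose_conjTranspose]
    rw [this]
    simp only [dotProduct, mulVec_diagonal, Pi.star_apply, RCLike.star_def]
    push_cast
    refine Finset.sum_congr rfl fun i _ => ?_
    rw [← Complex.conj_mul']
    ring
  have hone : ∀ i, 0 ≤ l i := fun i => by rcases hl01 i with h | h <;> simp [h]
  have hUH : (Uᴴ)ᴴ * Uᴴ = 1 := by rwa [conjTranspose_conjTranspose]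
  have e1 : ∀ x, ENNReal.ofReal (Real.exp (-s * resid H (a + x)))
      = (fun y : ι → ℂ => ∏ i, ENNReal.ofReal (Real.exp (-(s * l i) * ‖(Uᴴ *ᵥ a) i + y i‖ ^ 2)))
        (Uᴴ *ᵥ x) := by
    intro x
    simp only
    rw [← ENNReal.ofReal_prod_of_nonneg (fun _ _ => Real.exp_nonneg _), ← Real.exp_sum, hres,
      Finset.mul_sum]
    simp only [mulVec_add, Pi.add_apply]
    congr 2
    exact Finset.sum_congr rfl fun i _ => by ring
  rw [lintegral_congr e1, lintegral_unitary_mulVec hUH (fun y : ι → ℂ =>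
    ∏ i, ENNReal.ofReal (Real.exp (-(s * l i) * ‖(Uᴴ *ᵥ a) i + y i‖ ^ 2))) (by fun_prop)]
  rw [lintegral_stdC_prod (fun i y =>
    ENNReal.ofReal (Real.exp (-(s * l i) * ‖(Uᴴ *ᵥ a) i + y‖ ^ 2))) (by fun_prop)]
  simp_rw [fun i => lintegral_circularGaussian_exp (mul_nonneg hs (hone i))]
  rw [← ENNReal.ofReal_prod_of_nonneg (fun i _ => by
    have := mul_nonneg hs (hone i)
    positivity), Finset.prod_mul_distrib, Finset.prod_inv_distrib, hprod, ← Real.exp_sum, hres,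
    Finset.mul_sum]
  congr 3
  refine Finset.sum_congr rfl fun i _ => ?_
  -- For l ∈ {0, 1} one has s l / (1 + s l) = (s / (1 + s)) l.
  rcases hl01 i with h | h <;> simp [h]

/-- For every s ≥ 0 the probability of {q = 0} is at most E exp(-s q), and with at least one degree
of freedom this is at most 1/(1+s), which tends to 0. -/
theorem ae_resid_ne_zero (H : Matrix ι κ ℂ) (hH : IsUnit (Hᴴ * H).det)
    (hn : Fintype.card κ < Fintype.card ι) (a : ι → ℂ) :
    ∀ᵐ x ∂stdC ι, resid H (a + x) ≠ 0 := by
  obtain ⟨n, hn'⟩ := Nat.exists_eq_add_of_lt hn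
  have hm : Measurable fun x : ι → ℂ => resid H (a + x) :=
    (EntryMeasurable.const H).resid (by fun_prop)
  have hb : ∀ s : ℕ, stdC ι {x | resid H (a + x) = 0} ≤ ENNReal.ofReal ((1 + (s : ℝ))⁻¹) := by
    intro s
    have hs : (0 : ℝ) ≤ s := Nat.cast_nonneg s
    calc stdC ι {x | resid H (a + x) = 0}
        = ∫⁻ x in {x | resid H (a + x) = 0}, 1 ∂stdC ι := by simp
      _ = ∫⁻ x in {x | resid H (a + x) = 0},
          ENNReal.ofReal (Real.exp (-s * resid H (a + x))) ∂stdC ι := by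
        refine setLIntegral_congr_fun (hm (measurableSet_singleton 0)) fun x hx => ?_
        simp only [Set.mem_ofPred_eq] at hx
        simp [hx]
      _ ≤ ∫⁻ x, ENNReal.ofReal (Real.exp (-s * resid H (a + x))) ∂stdC ι :=
        setLIntegral_le_lintegral _ _
      _ = _ := lintegral_exp_resid H hH (n := n + 1) (by omega) a hs
      _ ≤ _ := by
        apply ENNReal.ofReal_le_ofReal
        have h1 : Real.exp (-((s : ℝ) / (1 + s)) * resid H a) ≤ 1 := by
          apply Real.exp_le_one_iff.2
          have := resid_nonneg H a
          have : 0 ≤ (s : ℝ) / (1 + s) * resid H a := by positivity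
          linarith
        have h2 : ((1 + (s : ℝ)) ^ (n + 1))⁻¹ ≤ (1 + (s : ℝ))⁻¹ := by
          apply inv_anti₀ (by positivity)
          exact le_self_pow₀ (by linarith) (by omega)
        calc _ ≤ (1 + (s : ℝ))⁻¹ * 1 := mul_le_mul h2 h1 (Real.exp_nonneg _) (by positivity)
          _ = _ := mul_one _
  rw [ae_iff]
  simp only [ne_eq, not_not]
  refine le_antisymm (ge_of_tendsto' (x := Filter.atTop) ?_ hb) zero_le
  rw [← ENNReal.ofReal_zero]
  apply ENNReal.tendsto_ofReal
  have := tendsto_one_div_add_atTop_nhds_zero_nat (𝕜 := ℝ)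
  refine this.congr fun n => ?_
  rw [one_div, add_comm]

/-- Fubini for null sets, applied to the indicator of the exceptional set. -/
theorem ae_split_col (k : κ) (p : Matrix ι {j // j ≠ k} ℂ → (ι → ℂ) → Prop)
    (hp : MeasurableSet {q : (ι × {j // j ≠ k} → ℂ) × (ι → ℂ) | p (mat q.1) q.2})
    (h : ∀ᵐ h ∂stdC (ι × {j // j ≠ k}), ∀ᵐ x ∂stdC ι, p (mat h) x) :
    ∀ᵐ z ∂stdC (ι × κ), p (dropCol (mat z) k) ((mat z).col k) := by
  classical
  let F : Matrix ι {j // j ≠ k} ℂ → (ι → ℂ) → ℝ≥0∞ := fun H x => if p H x then 0 else 1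
  have hF : Measurable fun q : (ι × {j // j ≠ k} → ℂ) × (ι → ℂ) => F (mat q.1) q.2 :=
    Measurable.ite hp measurable_const measurable_const
  have h0 : ∫⁻ z, F (dropCol (mat z) k) ((mat z).col k) ∂stdC (ι × κ) = 0 := by
    rw [lintegral_split_col k F hF, lintegral_eq_zero_iff (Measurable.lintegral_prod_right hF)]
    filter_upwards [h] with h hh
    refine (lintegral_eq_zero_iff (hF.comp (measurable_const.prodMk measurable_id))).2 ?_
    filter_upwards [hh] with x hx
    simp [F, hx]
  rw [lintegral_eq_zero_iff] at h0
  · filter_upwards [h0] with z hz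
    by_contra hc
    simp [F, hc] at hz
  · refine hF.comp (f := fun z : ι × κ → ℂ =>
      ((fun q : ι × {j // j ≠ k} => z (q.1, q.2.1)), fun i => z (i, k))) (by fun_prop)

end laws

/-- Induction on the number of columns: by `det_gram` the determinant is that of the other columns
times the residual of the new one, and given the others that residual is almost surely nonzero. The
column type is quantified inside the induction because removing a column changes it. -/
theorem ae_isUnit_gram {ι : Type*} [Fintype ι] [DecidableEq ι] : ∀ (c : ℕ) {κ : Type*} [Fintype κ]
    [DecidableEq κ], Fintype.card κ = c → c ≤ Fintype.card ι → ∀ (A : Matrix ι κ ℂ),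
    ∀ᵐ z ∂stdC (ι × κ), IsUnit ((A + mat z)ᴴ * (A + mat z)).det := by
  intro c
  induction c with
  | zero =>
    intro κ _ _ hc _ A
    have : IsEmpty κ := Fintype.card_eq_zero_iff.1 hc
    simp
  | succ c ih =>
    intro κ _ _ hc hci A
    obtain ⟨k⟩ : Nonempty κ := Fintype.card_pos_iff.1 (by omega)
    have hcard : Fintype.card {j // j ≠ k} = c := by
      rw [Fintype.card_subtype_compl]; simp [hc]
    have h1 := ae_split_col (ι := ι) k (fun H x =>
      ((dropCol A k + H)ᴴ * (dropCol A k + H)).det ≠ 0 ∧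
        resid (dropCol A k + H) (A.col k + x) ≠ 0) (by
        have hm : EntryMeasurable fun q : (ι × {j // j ≠ k} → ℂ) × (ι → ℂ) =>
            dropCol A k + mat q.1 :=
          (EntryMeasurable.const _).add fun i j =>
            (measurable_pi_apply (i, j)).comp measurable_fst
        refine MeasurableSet.inter ?_ ?_
        · exact (hm.conjTranspose.mul hm).det (measurableSet_singleton 0).compl
        · exact (hm.resid (measurable_const.add measurable_snd)) (measurableSet_singleton 0).compl)
      (by
        filter_upwards [ih hcard (by omega) (dropCol A k)] with h hh
        filter_upwards [ae_resid_ne_zero _ hh (by omega) (A.col k)] with x hx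
        exact ⟨hh.ne_zero, hx⟩)
    filter_upwards [h1] with z hz
    have e : dropCol (A + mat z) k = dropCol A k + dropCol (mat z) k := rfl
    have e' : (A + mat z).col k = A.col k + (mat z).col k := rfl
    rw [det_gram _ k (by rw [e]; exact isUnit_iff_ne_zero.2 hz.1), e, e']
    exact isUnit_iff_ne_zero.2 (mul_ne_zero hz.1 (by exact_mod_cast hz.2))

/-! ### Two one-dimensional integrals. -/

section calculus

/-- At q = 0 both sides are `⊤`, so reciprocals of residuals can be expanded without first
discarding a null set. -/
theorem lintegral_exp_neg_mul {q : ℝ} (hq : 0 ≤ q) :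
    ∫⁻ s in Set.Ioi (0 : ℝ), ENNReal.ofReal (Real.exp (-s * q)) = (ENNReal.ofReal q)⁻¹ := by
  rcases hq.eq_or_lt with rfl | hq
  · simp
  · have h := integral_exp_mul_Ioi (a := -q) (by linarith) 0
    have hi := integrableOn_exp_mul_Ioi (a := -q) (by linarith) 0
    simp only [neg_mul, mul_comm q] at h hi
    rw [← ENNReal.ofReal_inv_of_pos hq]
    simp only [neg_mul]
    rw [← ofReal_integral_eq_lintegral_ofReal hi (by filter_upwards with s using Real.exp_nonneg _), h]
    simp

/-- The left side is the mean reciprocal of a noncentral squared norm with m complex degrees of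
freedom. The bound is sharp at l = 0 and rests on an explicit function whose derivative dominates
the integrand. -/
theorem lintegral_laplace_le {m : ℕ} (hm : 2 ≤ m) {l : ℝ} (hl : 0 ≤ l) :
    ∫⁻ s in Set.Ioi (0 : ℝ), ENNReal.ofReal (((1 + s) ^ m)⁻¹ * Real.exp (-(s / (1 + s)) * l))
      ≤ ENNReal.ofReal (m / ((m - 1) * (m + l))) := by
  obtain ⟨m, rfl⟩ := Nat.exists_eq_add_of_le' hm
  let u : ℝ → ℝ := fun s => (1 + s)⁻¹
  -- After the shift m ↦ m + 2, this θ is chosen so that -θ' is the integrand times (m+1)(m+2+l)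
  -- plus the nonnegative excess from l² u (1-u). Dropping the excess bounds the integral by θ(0) =
  -- m+2 over (m+1)(m+2+l).
  let θ : ℝ → ℝ := fun s => u s ^ (m + 1) * (m + 2 + l * (1 - u s)) * Real.exp (-l * (1 - u s))
  let θ' : ℝ → ℝ := fun s => -(u s ^ (m + 2) * Real.exp (-l * (1 - u s)) *
    ((m + 1) * (m + 2 + l) + l ^ 2 * u s * (1 - u s)))
  have hu : ∀ s : ℝ, 0 ≤ s → HasDerivAt u (-(u s) ^ 2) s := by
    intro s hs
    have h := ((hasDerivAt_id s).const_add 1).inv (by simp; linarith)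
    refine h.congr_deriv ?_
    simp [u]
    field_simp
  have hu0 : ∀ s : ℝ, 0 ≤ s → 0 < u s ∧ u s ≤ 1 := by
    intro s hs
    exact ⟨by positivity, inv_le_one_of_one_le₀ (by linarith)⟩
  have hθ : ∀ s ∈ Set.Ici (0 : ℝ), HasDerivAt θ (θ' s) s := by
    intro s hs
    have h1 := hu s hs
    have h2 := (((h1.pow (m + 1)).mul (((h1.const_sub 1).const_mul l).const_add ((m : ℝ) + 2))).mul
      (((h1.const_sub 1).const_mul (-l)).exp))
    refine h2.congr_deriv ?_
    simp only [θ', Pi.mul_apply, Pi.pow_apply, add_tsub_cancel_right]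
    push_cast
    ring
  have hneg : ∀ s ∈ Set.Ioi (0 : ℝ), θ' s ≤ 0 := by
    intro s hs
    obtain ⟨h1, h2⟩ := hu0 s (le_of_lt hs)
    have : 0 ≤ l ^ 2 * u s * (1 - u s) := mul_nonneg (by positivity) (by linarith)
    simp only [θ', neg_nonpos]
    positivity
  have hu_lim : Filter.Tendsto u Filter.atTop (nhds 0) :=
    (Filter.tendsto_atTop_add_const_left _ 1 Filter.tendsto_id).inv_tendsto_atTop
  have hlim : Filter.Tendsto θ Filter.atTop (nhds 0) := by
    have hc : Continuous fun x : ℝ => x ^ (m + 1) * (m + 2 + l * (1 - x)) *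
      Real.exp (-l * (1 - x)) := by fun_prop
    have := (hc.tendsto 0).comp hu_lim
    rwa [zero_pow (by omega), zero_mul, zero_mul] at this
  have hint := integrableOn_Ioi_deriv_of_nonpos' hθ hneg hlim
  have hval := integral_Ioi_of_hasDerivAt_of_nonpos' hθ hneg hlim
  have hθ0 : θ 0 = m + 2 := by simp [θ, u]
  rw [hθ0, zero_sub] at hval
  have hc : (0 : ℝ) < (m + 1) * (m + 2 + l) := by positivity
  calc ∫⁻ s in Set.Ioi (0 : ℝ),
        ENNReal.ofReal (((1 + s) ^ (m + 2))⁻¹ * Real.exp (-(s / (1 + s)) * l))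
      ≤ ∫⁻ s in Set.Ioi (0 : ℝ),
        ENNReal.ofReal (((m + 1) * (m + 2 + l))⁻¹) * ENNReal.ofReal (-θ' s) := by
        refine setLIntegral_mono' measurableSet_Ioi fun s hs => ?_
        rw [← ENNReal.ofReal_mul (by positivity)]
        apply ENNReal.ofReal_le_ofReal
        obtain ⟨h1, h2⟩ := hu0 s (le_of_lt hs)
        have h3 : s / (1 + s) = 1 - u s := by
          have : (1 : ℝ) + s ≠ 0 := by have : 0 < s := hs; positivity
          simp only [u]
          field_simp
          ring
        have h4 : ((1 + s) ^ (m + 2))⁻¹ = u s ^ (m + 2) := by simp [u]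
        have h5 : 0 ≤ l ^ 2 * u s * (1 - u s) := mul_nonneg (by positivity) (by linarith)
        rw [h3, h4, show -(1 - u s) * l = -l * (1 - u s) by ring, inv_mul_eq_div, le_div_iff₀ hc]
        simp only [θ', neg_neg]
        gcongr
        linarith
    _ = ENNReal.ofReal (((m + 1) * (m + 2 + l))⁻¹) * ENNReal.ofReal (m + 2) := by
        rw [lintegral_const_mul' _ _ ENNReal.ofReal_ne_top, ← ofReal_integral_eq_lintegral_ofReal
          (f := fun s => -θ' s) hint.neg, integral_neg, hval, neg_neg]
        filter_upwards [ae_restrict_mem measurableSet_Ioi] with s hs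
        have := hneg s hs
        simpa using this
    _ = _ := by
        rw [← ENNReal.ofReal_mul (by positivity)]
        congr 1
        push_cast
        rw [show (m : ℝ) + 2 - 1 = m + 1 by ring, inv_mul_eq_div]

end calculus



/-! ### Comparison of Laplace transforms. -/

section laplaceOrder
variable {Ω₁ Ω₂ : Type*} [MeasurableSpace Ω₁] [MeasurableSpace Ω₂] {μ₁ : Measure Ω₁}
  {μ₂ : Measure Ω₂} [SFinite μ₁] [SFinite μ₂] {f₁ : Ω₁ → ℝ} {f₂ : Ω₂ → ℝ}

/-- One factor 1/(f+b) is written as the integral of exp(-r(f+b)) over r > 0. This lowers the power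
by one at the price of replacing s by s + r, which is why the comparison in `laplace_mono_inv_pow`
is carried along for all s ≥ 0. -/
theorem lintegral_exp_mul_inv_pow_succ {Ω : Type*} [MeasurableSpace Ω] {μ : Measure Ω} [SFinite μ]
    {f : Ω → ℝ} (hf : Measurable f) (hf0 : ∀ ω, 0 ≤ f ω) {b : ℝ} (hb : 0 < b) (j : ℕ) (s : ℝ) :
    ∫⁻ ω, ENNReal.ofReal (Real.exp (-s * f ω) * ((f ω + b) ^ (j + 1))⁻¹) ∂μ
      = ∫⁻ r in Set.Ioi (0 : ℝ), ENNReal.ofReal (Real.exp (-r * b)) *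
        ∫⁻ ω, ENNReal.ofReal (Real.exp (-(s + r) * f ω) * ((f ω + b) ^ j)⁻¹) ∂μ := by
  have h : ∀ ω, ENNReal.ofReal (Real.exp (-s * f ω) * ((f ω + b) ^ (j + 1))⁻¹)
      = ∫⁻ r in Set.Ioi (0 : ℝ), ENNReal.ofReal (Real.exp (-r * b)) *
        ENNReal.ofReal (Real.exp (-(s + r) * f ω) * ((f ω + b) ^ j)⁻¹) := by
    intro ω
    have hpos : 0 < f ω + b := add_pos_of_nonneg_of_pos (hf0 ω) hb
    have h1 : ∀ r : ℝ, ENNReal.ofReal (Real.exp (-r * b)) *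
        ENNReal.ofReal (Real.exp (-(s + r) * f ω) * ((f ω + b) ^ j)⁻¹)
        = ENNReal.ofReal (Real.exp (-s * f ω) * ((f ω + b) ^ j)⁻¹) *
          ENNReal.ofReal (Real.exp (-r * (f ω + b))) := by
      intro r
      rw [← ENNReal.ofReal_mul (Real.exp_nonneg _), ← ENNReal.ofReal_mul (by positivity),
        ← mul_assoc, ← Real.exp_add, mul_right_comm, ← Real.exp_add]
      congr 3
      ring
    simp_rw [h1]
    rw [lintegral_const_mul' _ _ ENNReal.ofReal_ne_top, lintegral_exp_neg_mul hpos.le,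
      ← ENNReal.ofReal_inv_of_pos hpos, ← ENNReal.ofReal_mul (by positivity), pow_succ, mul_inv,
      mul_assoc]
  simp_rw [h]
  rw [lintegral_lintegral_swap (by fun_prop)]
  refine lintegral_congr fun r => ?_
  rw [lintegral_const_mul' _ _ ENNReal.ofReal_ne_top]

theorem laplace_mono_inv_pow (hf₁ : Measurable f₁) (hf₂ : Measurable f₂) (h₁ : ∀ ω, 0 ≤ f₁ ω)
    (h₂ : ∀ ω, 0 ≤ f₂ ω)
    (h : ∀ s : ℝ, 0 ≤ s → ∫⁻ ω, ENNReal.ofReal (Real.exp (-s * f₁ ω)) ∂μ₁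
      ≤ ∫⁻ ω, ENNReal.ofReal (Real.exp (-s * f₂ ω)) ∂μ₂) {b : ℝ} (hb : 0 < b) (j : ℕ) :
    ∀ s : ℝ, 0 ≤ s → ∫⁻ ω, ENNReal.ofReal (Real.exp (-s * f₁ ω) * ((f₁ ω + b) ^ j)⁻¹) ∂μ₁
      ≤ ∫⁻ ω, ENNReal.ofReal (Real.exp (-s * f₂ ω) * ((f₂ ω + b) ^ j)⁻¹) ∂μ₂ := by
  induction j with
  | zero => simpa using h
  | succ j ih =>
    intro s hs
    rw [lintegral_exp_mul_inv_pow_succ hf₁ h₁ hb, lintegral_exp_mul_inv_pow_succ hf₂ h₂ hb]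
    refine setLIntegral_mono' measurableSet_Ioi fun r hr => ?_
    exact mul_le_mul' le_rfl (ih (s + r) (add_nonneg hs (le_of_lt hr)))

/-- Since q/(q+b) = 1 - b/(q+b), the exponential series in cb/(q+b) has nonnegative coefficients.
Hence the function is a positive combination of powers of 1/(q+b), each of which respects the
Laplace order. -/
theorem ofReal_exp_neg_div {c b q : ℝ} (hc : 0 ≤ c) (hb : 0 < b) (hq : 0 ≤ q) :
    ENNReal.ofReal (Real.exp (-c * (q / (q + b))))
      = ∑' j : ℕ, ENNReal.ofReal (Real.exp (-c) * (c * b) ^ j / j.factorial) *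
        ENNReal.ofReal ((q + b) ^ j)⁻¹ := by
  have hpos : 0 < q + b := by linarith
  have h1 : -c * (q / (q + b)) = -c + c * b / (q + b) := by
    field_simp
    ring
  have hs := NormedSpace.expSeries_div_hasSum_exp (c * b / (q + b))
  rw [← Real.exp_eq_exp_ℝ] at hs
  have hs2 := hs.mul_left (Real.exp (-c))
  rw [h1, Real.exp_add, ← hs2.tsum_eq, ENNReal.ofReal_tsum_of_nonneg (fun j => by positivity)
    hs2.summable]
  refine tsum_congr fun j => ?_
  rw [← ENNReal.ofReal_mul (by positivity)]
  congr 1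
  rw [div_pow]
  field_simp

/-- A pointwise comparison of Laplace transforms is inherited by `exp (-c q / (q + b))`. -/
theorem laplace_mono_exp_neg_div (hf₁ : Measurable f₁) (hf₂ : Measurable f₂) (h₁ : ∀ ω, 0 ≤ f₁ ω)
    (h₂ : ∀ ω, 0 ≤ f₂ ω)
    (h : ∀ s : ℝ, 0 ≤ s → ∫⁻ ω, ENNReal.ofReal (Real.exp (-s * f₁ ω)) ∂μ₁
      ≤ ∫⁻ ω, ENNReal.ofReal (Real.exp (-s * f₂ ω)) ∂μ₂) {b c : ℝ} (hb : 0 < b) (hc : 0 ≤ c) :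
    ∫⁻ ω, ENNReal.ofReal (Real.exp (-c * (f₁ ω / (f₁ ω + b)))) ∂μ₁
      ≤ ∫⁻ ω, ENNReal.ofReal (Real.exp (-c * (f₂ ω / (f₂ ω + b)))) ∂μ₂ := by
  simp_rw [fun ω => ofReal_exp_neg_div hc hb (h₁ ω), fun ω => ofReal_exp_neg_div hc hb (h₂ ω)]
  rw [lintegral_tsum (fun j => by fun_prop), lintegral_tsum (fun j => by fun_prop)]
  refine ENNReal.tsum_le_tsum fun j => ?_
  rw [lintegral_const_mul' _ _ ENNReal.ofReal_ne_top, lintegral_const_mul' _ _ ENNReal.ofReal_ne_top]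
  refine mul_le_mul' le_rfl ?_
  simpa using laplace_mono_inv_pow hf₁ hf₂ h₁ h₂ h hb j 0 le_rfl

end laplaceOrder

/-! ### Residuals and inverse Gram matrices of noncentral Gaussian matrices. -/

section wishart
variable {ι κ : Type*} [Fintype ι] [Fintype κ] [DecidableEq ι] [DecidableEq κ]

theorem entryMeasurable_add_mat (A : Matrix ι κ ℂ) : EntryMeasurable fun z => A + mat z :=
  (EntryMeasurable.const A).add entryMeasurable_mat

theorem entryMeasurable_fst {Ω : Type*} [MeasurableSpace Ω] (A : Matrix ι κ ℂ) :
    EntryMeasurable fun q : (ι × κ → ℂ) × Ω => A + mat q.1 :=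
  (EntryMeasurable.const A).add fun i j => (measurable_pi_apply (i, j)).comp measurable_fst

theorem card_ne (k : κ) : Fintype.card {j // j ≠ k} + 1 = Fintype.card κ := by
  rw [Fintype.card_subtype_compl]
  have : 0 < Fintype.card κ := Fintype.card_pos_iff.2 ⟨k⟩
  simp
  omega

theorem stdC_map_comp_inj {α : Type*} [Fintype α] {f : α → ι} (hf : Function.Injective f) :
    (stdC ι).map (fun z => z ∘ f) = stdC α := by
  classical
  refine stdC_map _ (fun t => Function.extend f t 0) (by fun_prop) (fun t z => ?_) fun t => ?_
  · simp only [dotProduct, Pi.star_apply, Function.comp]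
    rw [← Finset.sum_subset (Finset.subset_univ (Finset.univ.map ⟨f, hf⟩)), Finset.sum_map]
    · simp [hf.extend_apply]
    · intro i _ hi
      rw [Function.extend_apply' _ _ _ (by simpa using hi)]
      simp
  · rw [← Finset.sum_subset (Finset.subset_univ (Finset.univ.map ⟨f, hf⟩)), Finset.sum_map]
    · simp [hf.extend_apply]
    · intro i _ hi
      rw [Function.extend_apply' _ _ _ (by simpa using hi)]
      simp

theorem ae_dropRow (i : ι) {p : Matrix {l // l ≠ i} κ ℂ → Prop}
    (h : ∀ᵐ z ∂stdC ({l // l ≠ i} × κ), p (mat z)) :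
    ∀ᵐ z ∂stdC (ι × κ), p (dropRow (mat z) i) := by
  have hinj : Function.Injective fun q : {l // l ≠ i} × κ => ((q.1.1, q.2) : ι × κ) := by
    rintro ⟨⟨a, ha⟩, b⟩ ⟨⟨c, hc⟩, d⟩ h
    simpa using h
  rw [← stdC_map_comp_inj hinj] at h
  have := ae_of_ae_map (p := fun z => p (mat z))
    (f := fun z : ι × κ → ℂ => z ∘ fun q : {l // l ≠ i} × κ => (q.1.1, q.2))
    (Measurable.aemeasurable (by fun_prop)) h
  exact this

/-- Almost sure full rank, column by column. -/
theorem ae_col_generic (A : Matrix ι κ ℂ) (k : κ) (h : Fintype.card κ ≤ Fintype.card ι) :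
    ∀ᵐ z ∂stdC (ι × κ), IsUnit ((dropCol (A + mat z) k)ᴴ * dropCol (A + mat z) k).det ∧
      resid (dropCol (A + mat z) k) ((A + mat z).col k) ≠ 0 := by
  have hc := card_ne k
  have h1 := ae_split_col (ι := ι) k (fun H x =>
    ((dropCol A k + H)ᴴ * (dropCol A k + H)).det ≠ 0 ∧
      resid (dropCol A k + H) (A.col k + x) ≠ 0) (by
      have hm := entryMeasurable_fst (Ω := ι → ℂ) (dropCol A k)
      refine MeasurableSet.inter ?_ ?_
      · exact (hm.conjTranspose.mul hm).det (measurableSet_singleton 0).compl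
      · exact (hm.resid (measurable_const.add measurable_snd)) (measurableSet_singleton 0).compl)
    (by
      filter_upwards [ae_isUnit_gram _ rfl (by omega) (dropCol A k)] with h hh
      filter_upwards [ae_resid_ne_zero _ hh (by omega) (A.col k)] with x hx
      exact ⟨hh.ne_zero, hx⟩)
  filter_upwards [h1] with z hz
  exact ⟨isUnit_iff_ne_zero.2 hz.1, hz.2⟩

/-- Rotating the columns turns r into a multiple of a basis vector, so the quadratic form becomes
one diagonal entry of an inverse Gram matrix, to which `inv_gram_apply` applies. -/
theorem quadInv_eq_of_unitary {U : Matrix κ κ ℂ} (hU : Uᴴ * U = 1) (H : Matrix ι κ ℂ) (r : κ → ℂ)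
    (k : κ) {ρ : ℝ} (hr : U *ᵥ star r = Pi.single k (ρ : ℂ)) :
    quadInv H r = ρ ^ 2 * (((H * Uᴴ)ᴴ * (H * Uᴴ))⁻¹ k k).re := by
  have hU' : U * Uᴴ = 1 := mul_eq_one_comm.1 hU
  have hinv : ((H * Uᴴ)ᴴ * (H * Uᴴ))⁻¹ = U * (Hᴴ * H)⁻¹ * Uᴴ := by
    rw [conjTranspose_mul, conjTranspose_conjTranspose]
    have e : U * Hᴴ * (H * Uᴴ) = U * (Hᴴ * H) * Uᴴ := by simp only [Matrix.mul_assoc]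
    rw [e, Matrix.mul_inv_rev, Matrix.mul_inv_rev, inv_eq_left_inv hU, inv_eq_left_inv hU', Matrix.mul_assoc]
  have hr' : r ᵥ* Uᴴ = Pi.single k (ρ : ℂ) := by
    have := congrArg star hr
    rw [star_mulVec, star_star, ← Pi.single_star] at this
    simpa using this
  have e2 : r ⬝ᵥ ((Hᴴ * H)⁻¹ *ᵥ star r)
      = (r ᵥ* Uᴴ) ⬝ᵥ (((H * Uᴴ)ᴴ * (H * Uᴴ))⁻¹ *ᵥ (U *ᵥ star r)) := by
    rw [hinv, mulVec_mulVec, Matrix.mul_assoc, hU, Matrix.mul_one, ← dotProduct_mulVec,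
      mulVec_mulVec, ← Matrix.mul_assoc, hU, Matrix.one_mul]
  unfold quadInv
  rw [e2, hr, hr', single_dotProduct, mulVec_single]
  simp [sq, mul_comm, mul_assoc]

/-- Distribution of `r (Hᴴ H)⁻¹ rᴴ` for a Gaussian matrix `H`. -/
theorem exists_lintegral_quadInv (B : Matrix ι κ ℂ) (r : κ → ℂ) (k : κ)
    (hc : Fintype.card κ ≤ Fintype.card ι) :
    ∃ B' : Matrix ι κ ℂ, (B = 0 → B' = 0) ∧ ∀ g : ℝ → ℝ≥0∞, Measurable g →
      ∫⁻ z, g (quadInv (B + mat z) r) ∂stdC (ι × κ)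
        = ∫⁻ h, ∫⁻ x, g ((∑ j, ‖r j‖ ^ 2) / resid (dropCol B' k + mat h) (B'.col k + x)) ∂stdC ι
          ∂stdC (ι × {j // j ≠ k}) := by
  obtain ⟨U, hU, hUr⟩ := exists_unitary_mulVec_eq_single (star r) k
  have hρ : Real.sqrt (∑ j, ‖star r j‖ ^ 2) ^ 2 = ∑ j, ‖r j‖ ^ 2 := by
    rw [Real.sq_sqrt (by positivity)]
    simp
  -- The rotated mean is not used further, except that it vanishes when B does.
  refine ⟨B * Uᴴ, fun h => by rw [h, Matrix.zero_mul], fun g hg => ?_⟩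
  set B' := B * Uᴴ with hB'
  have hUH : (Uᴴ)ᴴ * Uᴴ = 1 := by
    rw [conjTranspose_conjTranspose]; exact mul_eq_one_comm.1 hU
  have hm := entryMeasurable_add_mat B'
  have e1 : ∀ z, g (quadInv (B + mat z) r)
      = (fun H : Matrix ι κ ℂ => g ((∑ j, ‖r j‖ ^ 2) * (((B' + H)ᴴ * (B' + H))⁻¹ k k).re))
        (mat z * Uᴴ) := by
    intro z
    rw [quadInv_eq_of_unitary hU _ r k hUr, hρ, Matrix.add_mul]
  rw [lintegral_congr e1, lintegral_mul_unitary hUH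
    (fun H : Matrix ι κ ℂ => g ((∑ j, ‖r j‖ ^ 2) * (((B' + H)ᴴ * (B' + H))⁻¹ k k).re))
    (hg.comp (measurable_const.mul
      (Complex.measurable_re.comp ((hm.conjTranspose.mul hm).inv k k))))]
  have e2 : ∀ᵐ z ∂stdC (ι × κ),
      g ((∑ j, ‖r j‖ ^ 2) * (((B' + mat z)ᴴ * (B' + mat z))⁻¹ k k).re)
      = (fun (H : Matrix ι {j // j ≠ k} ℂ) (x : ι → ℂ) =>
          g ((∑ j, ‖r j‖ ^ 2) / resid (dropCol B' k + H) (B'.col k + x)))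
        (dropCol (mat z) k) ((mat z).col k) := by
    filter_upwards [ae_col_generic B' k hc] with z hz
    rw [inv_gram_apply _ k hz.1 hz.2, Complex.ofReal_re]
    rfl
  rw [lintegral_congr_ae e2, lintegral_split_col k (fun (H : Matrix ι {j // j ≠ k} ℂ) (x : ι → ℂ) =>
    g ((∑ j, ‖r j‖ ^ 2) / resid (dropCol B' k + H) (B'.col k + x)))]
  exact hg.comp (measurable_const.div
    ((entryMeasurable_fst (dropCol B' k)).resid (measurable_const.add measurable_snd)))

/-- The quadratic form is b/q, with b = ‖r‖² and q the residual of one column, and exp(-c/(1+b/q)) =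
exp(-c q/(q+b)). A mean only lowers the Laplace transform of q, and `laplace_mono_exp_neg_div`
transfers this to the function at hand. -/
theorem lintegral_exp_quadInv_le (B : Matrix ι κ ℂ) (r : κ → ℂ)
    (hc : Fintype.card κ ≤ Fintype.card ι) {c : ℝ} (hc0 : 0 ≤ c) :
    ∫⁻ z, ENNReal.ofReal (Real.exp (-c / (1 + quadInv (B + mat z) r))) ∂stdC (ι × κ)
      ≤ ∫⁻ z, ENNReal.ofReal (Real.exp (-c / (1 + quadInv (mat z) r))) ∂stdC (ι × κ) := by
  by_cases hr : r = 0
  · simp [hr, quadInv]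
  obtain ⟨k, hk⟩ : ∃ k, r k ≠ 0 := by
    by_contra! h
    exact hr (funext h)
  set b := ∑ j, ‖r j‖ ^ 2 with hb
  have hb0 : 0 < b := Finset.sum_pos' (fun _ _ => by positivity)
    ⟨k, Finset.mem_univ _, by positivity⟩
  have hcard := card_ne k
  have hg : Measurable fun t : ℝ => ENNReal.ofReal (Real.exp (-c / (1 + t))) := by fun_prop
  obtain ⟨B', -, hB'⟩ := exists_lintegral_quadInv B r k hc
  obtain ⟨B0, hB0, hB0'⟩ := exists_lintegral_quadInv (0 : Matrix ι κ ℂ) r k hc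
  rw [hB0 rfl] at hB0'
  have h0 := hB0' _ hg
  have e0 : dropCol (0 : Matrix ι κ ℂ) k = 0 := rfl
  have e0' : (0 : Matrix ι κ ℂ).col k = 0 := rfl
  simp only [zero_add, e0, e0'] at h0
  rw [hB' _ hg, h0]
  -- Given the other columns, the Laplace transform of q depends on them only through the
  -- noncentrality, and it is largest when the noncentrality is 0. So any full-rank H₁ with a shift
  -- compares with any full-rank H₂ without one.
  have hgen : ∀ (H₁ H₂ : Matrix ι {j // j ≠ k} ℂ) (a : ι → ℂ), IsUnit (H₁ᴴ * H₁).det →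
      IsUnit (H₂ᴴ * H₂).det →
      ∫⁻ x, ENNReal.ofReal (Real.exp (-c / (1 + b / resid H₁ (a + x)))) ∂stdC ι
        ≤ ∫⁻ x, ENNReal.ofReal (Real.exp (-c / (1 + b / resid H₂ x))) ∂stdC ι := by
    intro H₁ H₂ a h₁ h₂
    have hn : (Fintype.card ι - Fintype.card {j // j ≠ k}) + Fintype.card {j // j ≠ k}
      = Fintype.card ι := by omega
    have hae₁ := ae_resid_ne_zero H₁ h₁ (by omega) a
    have hae₂ := ae_resid_ne_zero H₂ h₂ (by omega) 0
    simp only [zero_add] at hae₂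
    have hdiv : ∀ q : ℝ, 0 ≤ q → q ≠ 0 → -c / (1 + b / q) = -c * (q / (q + b)) := by
      intro q hq hq0
      have : 0 < q := lt_of_le_of_ne hq (Ne.symm hq0)
      field_simp
    have c₁ : ∀ᵐ x ∂stdC ι, ENNReal.ofReal (Real.exp (-c / (1 + b / resid H₁ (a + x))))
        = ENNReal.ofReal (Real.exp (-c * (resid H₁ (a + x) / (resid H₁ (a + x) + b)))) := by
      filter_upwards [hae₁] with x hx
      rw [hdiv _ (resid_nonneg _ _) hx]
    have c₂ : ∀ᵐ x ∂stdC ι, ENNReal.ofReal (Real.exp (-c / (1 + b / resid H₂ x)))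
        = ENNReal.ofReal (Real.exp (-c * (resid H₂ x / (resid H₂ x + b)))) := by
      filter_upwards [hae₂] with x hx
      rw [hdiv _ (resid_nonneg _ _) hx]
    rw [lintegral_congr_ae c₁, lintegral_congr_ae c₂]
    refine laplace_mono_exp_neg_div (f₁ := fun x => resid H₁ (a + x)) (f₂ := fun x => resid H₂ x)
      ((EntryMeasurable.const H₁).resid (by fun_prop))
      ((EntryMeasurable.const H₂).resid measurable_id) (fun _ => resid_nonneg _ _)
      (fun _ => resid_nonneg _ _) (fun s hs => ?_) hb0 hc0
    have l₂ := lintegral_exp_resid H₂ h₂ hn 0 hs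
    simp only [zero_add] at l₂
    rw [lintegral_exp_resid H₁ h₁ hn a hs, l₂]
    apply ENNReal.ofReal_le_ofReal
    have hz : resid H₂ 0 = 0 := by simp [resid]
    rw [hz, mul_zero, Real.exp_zero]
    gcongr
    rw [Real.exp_le_one_iff]
    have := resid_nonneg H₁ a
    have : 0 ≤ s / (1 + s) * resid H₁ a := by positivity
    linarith
  have hae₁ := ae_isUnit_gram (ι := ι) _ rfl (by omega) (dropCol B' k)
  have hae₂ := ae_isUnit_gram (ι := ι) _ rfl (by omega) (0 : Matrix ι {j // j ≠ k} ℂ)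
  simp only [zero_add] at hae₂
  -- Dummy integrations over a probability space make both sides double averages over independent H₁
  -- and H₂, so that the conditional comparison applies inside.
  calc _ = ∫⁻ _ : (ι × {j // j ≠ k}) → ℂ, (∫⁻ h, ∫⁻ x, ENNReal.ofReal (Real.exp (-c / (1 + b /
        resid (dropCol B' k + mat h) (B'.col k + x)))) ∂stdC ι ∂stdC (ι × {j // j ≠ k}))
        ∂stdC (ι × {j // j ≠ k}) := by
        rw [lintegral_const, measure_univ, mul_one]
    _ ≤ _ := by
        refine lintegral_mono_ae ?_
        filter_upwards [hae₂] with h₂ hh₂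
        calc _ ≤ ∫⁻ _ : (ι × {j // j ≠ k}) → ℂ, (∫⁻ x, ENNReal.ofReal (Real.exp (-c / (1 + b /
              resid (mat h₂) x))) ∂stdC ι) ∂stdC (ι × {j // j ≠ k}) := by
              refine lintegral_mono_ae ?_
              filter_upwards [hae₁] with h₁ hh₁
              exact hgen _ _ _ hh₁ hh₂
          _ = _ := by rw [lintegral_const, measure_univ, mul_one]

/-- Rotate a onto the i-th axis and apply `resid_single`. As a is orthogonal to the columns of B,
row i of the rotated mean vanishes: the row r is centred, and the mean survives only in the
remaining rows R. -/
theorem lintegral_resid_eq_quadInv (B : Matrix ι κ ℂ) {a : ι → ℂ} (ha : Bᴴ *ᵥ a = 0) (h0 : a ≠ 0)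
    (hc : Fintype.card κ < Fintype.card ι) (i : ι) :
    ∃ R : Matrix {l // l ≠ i} κ ℂ, (B = 0 → R = 0) ∧ ∀ g : ℝ → ℝ≥0∞, Measurable g →
      ∫⁻ z, g (resid (B + mat z) a) ∂stdC (ι × κ)
        = ∫⁻ r, ∫⁻ h, g ((∑ i, ‖a i‖ ^ 2) / (1 + quadInv (R + mat h) r))
          ∂stdC ({l // l ≠ i} × κ) ∂stdC κ := by
  obtain ⟨U, hU, hUa⟩ := exists_unitary_mulVec_eq_single a i
  set α := Real.sqrt (∑ j, ‖a j‖ ^ 2) with hα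
  have hα2 : ‖(α : ℂ)‖ ^ 2 = ∑ j, ‖a j‖ ^ 2 := by
    rw [Complex.norm_real, Real.norm_eq_abs, sq_abs, Real.sq_sqrt (by positivity)]
  have hα0 : (α : ℂ) ≠ 0 := by
    intro h
    apply h0
    rw [h, norm_zero, zero_pow two_ne_zero] at hα2
    ext j
    have := (Finset.sum_eq_zero_iff_of_nonneg (fun _ _ => by positivity)).1 hα2.symm j
      (Finset.mem_univ j)
    simpa using this
  have hrow : (U * B) i = 0 := by
    have h1 : (U * B)ᴴ *ᵥ (U *ᵥ a) = 0 := by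
      rw [conjTranspose_mul, mulVec_mulVec, Matrix.mul_assoc, hU, Matrix.mul_one, ha]
    rw [hUa] at h1
    generalize U * B = C at h1
    ext j
    have h2 := congrFun h1 j
    rw [mulVec_single] at h2
    simpa [hα0] using h2
  have hcard := card_ne i
  refine ⟨dropRow (U * B) i, fun h => by rw [h, Matrix.mul_zero]; rfl, fun g hg => ?_⟩
  set R := dropRow (U * B) i with hR
  have e1 : ∀ z, g (resid (B + mat z) a)
      = (fun H : Matrix ι κ ℂ => g (resid (U * B + H) (Pi.single i (α : ℂ)))) (U * mat z) := by
    intro z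
    rw [← resid_unitary_mul hU, hUa, Matrix.mul_add]
  have e2 : ∀ᵐ z ∂stdC (ι × κ), g (resid (U * B + mat z) (Pi.single i (α : ℂ)))
      = (fun (H : Matrix {l // l ≠ i} κ ℂ) (r : κ → ℂ) =>
          g ((∑ i, ‖a i‖ ^ 2) / (1 + quadInv (R + H) r))) (dropRow (mat z) i) (mat z i) := by
    filter_upwards [ae_dropRow (κ := κ) i (p := fun H => IsUnit ((R + H)ᴴ * (R + H)).det)
      (ae_isUnit_gram _ rfl (by omega) R)] with z hz
    have hz' : IsUnit ((dropRow (U * B + mat z) i)ᴴ * dropRow (U * B + mat z) i).det := by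
      have e : dropRow (U * B + mat z) i = R + dropRow (mat z) i := rfl
      rw [e]
      exact hz
    rw [resid_single _ i _ hz', hα2]
    have : (U * B + mat z) i = mat z i := by
      change (U * B) i + mat z i = mat z i
      rw [hrow, zero_add]
    rw [this]
    rfl
  have hm : Measurable fun p : ({l // l ≠ i} × κ → ℂ) × (κ → ℂ) =>
      g ((∑ i, ‖a i‖ ^ 2) / (1 + quadInv (R + mat p.1) p.2)) :=
    hg.comp (measurable_const.div (measurable_const.add
      ((entryMeasurable_fst R).quadInv measurable_snd)))
  rw [lintegral_congr e1, lintegral_unitary_mul hU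
    (fun H : Matrix ι κ ℂ => g (resid (U * B + H) (Pi.single i (α : ℂ))))
    (hg.comp ((entryMeasurable_add_mat _).resid measurable_const)), lintegral_congr_ae e2,
    lintegral_split_row i (fun (H : Matrix {l // l ≠ i} κ ℂ) (r : κ → ℂ) =>
      g ((∑ i, ‖a i‖ ^ 2) / (1 + quadInv (R + H) r))) hm, lintegral_lintegral_swap hm.aemeasurable]

/-- A mean orthogonal to `a` makes the residual of `a` larger in the Laplace order. -/
theorem lintegral_exp_resid_le (B : Matrix ι κ ℂ) {a : ι → ℂ} (ha : Bᴴ *ᵥ a = 0)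
    (hc : Fintype.card κ < Fintype.card ι) {c : ℝ} (hc0 : 0 ≤ c) :
    ∫⁻ z, ENNReal.ofReal (Real.exp (-c * resid (B + mat z) a)) ∂stdC (ι × κ)
      ≤ ∫⁻ z, ENNReal.ofReal (Real.exp (-c * resid (mat z) a)) ∂stdC (ι × κ) := by
  by_cases h0 : a = 0
  · simp [h0, resid]
  obtain ⟨i⟩ : Nonempty ι := Fintype.card_pos_iff.1 (by omega)
  have hcard := card_ne i
  have hg : Measurable fun t : ℝ => ENNReal.ofReal (Real.exp (-c * t)) := by fun_prop
  obtain ⟨R, -, hR⟩ := lintegral_resid_eq_quadInv B ha h0 hc i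
  obtain ⟨R0, hR0, hR0'⟩ := lintegral_resid_eq_quadInv (0 : Matrix ι κ ℂ) (a := a) (by simp) h0 hc i
  rw [hR0 rfl] at hR0'
  have h1 := hR0' _ hg
  simp only [zero_add] at h1
  rw [hR _ hg, h1]
  refine lintegral_mono fun r => ?_
  have := lintegral_exp_quadInv_le R r (by omega)
    (c := c * ∑ i, ‖a i‖ ^ 2) (by positivity)
  simpa only [neg_mul, neg_div, mul_div_assoc] using this

theorem lintegral_inv_resid (H : Matrix ι κ ℂ) (hH : IsUnit (Hᴴ * H).det) {n : ℕ}
    (hn : n + Fintype.card κ = Fintype.card ι) (a : ι → ℂ) :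
    ∫⁻ x, (ENNReal.ofReal (resid H (a + x)))⁻¹ ∂stdC ι
      = ∫⁻ s in Set.Ioi (0 : ℝ),
        ENNReal.ofReal (((1 + s) ^ n)⁻¹ * Real.exp (-(s / (1 + s)) * resid H a)) := by
  have hm : Measurable fun x : ι → ℂ => resid H (a + x) :=
    (EntryMeasurable.const H).resid (by fun_prop)
  simp_rw [← lintegral_exp_neg_mul (resid_nonneg H _)]
  rw [lintegral_lintegral_swap (Measurable.aemeasurable ((Real.measurable_exp.comp
    (measurable_snd.neg.mul (hm.comp measurable_fst))).ennreal_ofReal))]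
  refine setLIntegral_congr_fun measurableSet_Ioi fun s hs => ?_
  exact lintegral_exp_resid H hH hn a (le_of_lt hs)

/-- The form is ‖r‖²/q with q a central residual having |ι| - |κ| + 1 complex degrees of freedom,
and m degrees of freedom give mean reciprocal 1/(m-1). -/
theorem lintegral_quadInv_le (r : κ → ℂ) (hc : Fintype.card κ < Fintype.card ι) :
    ∫⁻ z, ENNReal.ofReal (quadInv (mat z) r) ∂stdC (ι × κ)
      ≤ ENNReal.ofReal ((∑ j, ‖r j‖ ^ 2) / ((Fintype.card ι : ℝ) - Fintype.card κ)) := by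
  by_cases hr : r = 0
  · simp [hr, quadInv]
  obtain ⟨k, hk⟩ : ∃ k, r k ≠ 0 := by
    by_contra! h
    exact hr (funext h)
  have hcard := card_ne k
  obtain ⟨B0, hB0, hB0'⟩ := exists_lintegral_quadInv (0 : Matrix ι κ ℂ) r k hc.le
  rw [hB0 rfl] at hB0'
  have h0 := hB0' _ ENNReal.measurable_ofReal
  have e0 : dropCol (0 : Matrix ι κ ℂ) k = 0 := rfl
  have e0' : (0 : Matrix ι κ ℂ).col k = 0 := rfl
  simp only [zero_add, e0, e0'] at h0
  rw [h0]
  obtain ⟨n, hn⟩ := Nat.exists_eq_add_of_lt hc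
  have hae := ae_isUnit_gram (ι := ι) _ rfl (by omega) (0 : Matrix ι {j // j ≠ k} ℂ)
  simp only [zero_add] at hae
  have hb : 0 ≤ ∑ j, ‖r j‖ ^ 2 := by positivity
  have hin : ∀ᵐ h ∂stdC (ι × {j // j ≠ k}),
      ∫⁻ x, ENNReal.ofReal ((∑ j, ‖r j‖ ^ 2) / resid (mat h) x) ∂stdC ι
        ≤ ENNReal.ofReal ((∑ j, ‖r j‖ ^ 2) / ((Fintype.card ι : ℝ) - Fintype.card κ)) := by
    filter_upwards [hae] with h hh
    -- Since |ι| = |κ| + n + 1 and only |κ| - 1 columns are projected out, n + 2 degrees of freedom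
    -- remain.
    have hl := lintegral_inv_resid (mat h) hh (n := n + 2) (by omega) 0
    simp only [zero_add] at hl
    have hz : resid (mat h) 0 = 0 := by simp [resid]
    rw [hz] at hl
    calc _ ≤ ∫⁻ x, ENNReal.ofReal (∑ j, ‖r j‖ ^ 2) * (ENNReal.ofReal (resid (mat h) x))⁻¹
          ∂stdC ι := by
          refine lintegral_mono fun x => ?_
          rcases (resid_nonneg (mat h) x).eq_or_lt with hq | hq
          · simp [← hq]
          · rw [div_eq_mul_inv, ENNReal.ofReal_mul hb, ENNReal.ofReal_inv_of_pos hq]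
      _ ≤ ENNReal.ofReal (∑ j, ‖r j‖ ^ 2) * ENNReal.ofReal (((n + 2 : ℕ) : ℝ) /
          ((((n + 2 : ℕ) : ℝ) - 1) * (((n + 2 : ℕ) : ℝ) + 0))) := by
          rw [lintegral_const_mul' _ _ ENNReal.ofReal_ne_top, hl]
          gcongr
          exact lintegral_laplace_le (by omega) le_rfl
      _ = _ := by
          rw [← ENNReal.ofReal_mul hb, hn]
          congr 1
          push_cast
          rw [show (Fintype.card κ : ℝ) + n + 1 - Fintype.card κ = n + 1 by ring,
            show (n : ℝ) + 2 - 1 = n + 1 by ring]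
          field_simp
          ring
  calc _ ≤ ∫⁻ _ : (ι × {j // j ≠ k}) → ℂ, ENNReal.ofReal ((∑ j, ‖r j‖ ^ 2) /
        ((Fintype.card ι : ℝ) - Fintype.card κ)) ∂stdC (ι × {j // j ≠ k}) := lintegral_mono_ae hin
    _ = _ := by rw [lintegral_const, measure_univ, mul_one]

theorem lintegral_sum_sq :
    ∫⁻ r, ENNReal.ofReal (∑ j, ‖r j‖ ^ 2) ∂stdC κ = Fintype.card κ := by
  have h : ∀ r : κ → ℂ, ENNReal.ofReal (∑ j, ‖r j‖ ^ 2) = ∑ j, ENNReal.ofReal (‖r j‖ ^ 2) :=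
    fun r => ENNReal.ofReal_sum_of_nonneg fun _ _ => by positivity
  simp_rw [h]
  rw [lintegral_finsetSum _ fun j _ => by fun_prop]
  have h2 : ∀ j : κ, ∫⁻ r : κ → ℂ, ENNReal.ofReal (‖r j‖ ^ 2) ∂stdC κ = 1 := by
    intro j
    have := (measurePreserving_eval (fun _ : κ => circularGaussian 1) j).lintegral_comp
      (f := fun z : ℂ => ENNReal.ofReal (‖z‖ ^ 2)) (by fun_prop)
    rw [lintegral_circularGaussian_sq] at this
    simpa [stdC] using this
  rw [Finset.sum_congr rfl fun j _ => h2 j]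
  simp

/-- Inverse residual of a fixed vector with respect to centred Gaussian columns. -/
theorem lintegral_inv_resid_fixed_le (y : ι → ℂ) (hc : Fintype.card κ + 2 ≤ Fintype.card ι) :
    ∫⁻ z, (ENNReal.ofReal (resid (mat z) y))⁻¹ ∂stdC (ι × κ)
      ≤ ENNReal.ofReal (((Fintype.card ι : ℝ) - 1) / (Fintype.card ι - 1 - Fintype.card κ)) *
        (ENNReal.ofReal (∑ i, ‖y i‖ ^ 2))⁻¹ := by
  have hcr : (Fintype.card κ : ℝ) + 2 ≤ Fintype.card ι := by exact_mod_cast hc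
  by_cases h0 : y = 0
  · subst h0
    have : 0 < ((Fintype.card ι : ℝ) - 1) / (Fintype.card ι - 1 - Fintype.card κ) :=
      div_pos (by linarith) (by linarith)
    simp only [Pi.zero_apply, norm_zero, ne_eq, OfNat.ofNat_ne_zero, not_false_eq_true, zero_pow,
      Finset.sum_const_zero, ENNReal.ofReal_zero, ENNReal.inv_zero]
    rw [ENNReal.mul_top (by simpa using this)]
    exact le_top
  obtain ⟨i⟩ : Nonempty ι := Fintype.card_pos_iff.1 (by omega)
  have hcard := card_ne i
  obtain ⟨R0, hR0, hR0'⟩ := lintegral_resid_eq_quadInv (0 : Matrix ι κ ℂ) (a := y) (by simp) h0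
    (by omega) i
  rw [hR0 rfl] at hR0'
  have h1 := hR0' (fun t => (ENNReal.ofReal t)⁻¹) (by fun_prop)
  simp only [zero_add] at h1
  rw [h1]
  have hy : 0 < ∑ i, ‖y i‖ ^ 2 := by
    obtain ⟨j, hj⟩ : ∃ j, y j ≠ 0 := by
      by_contra! h
      exact h0 (funext h)
    exact Finset.sum_pos' (fun _ _ => by positivity) ⟨j, Finset.mem_univ _, by positivity⟩
  have e1 : ∀ (r : κ → ℂ) (h : {l // l ≠ i} × κ → ℂ),
      (ENNReal.ofReal ((∑ i, ‖y i‖ ^ 2) / (1 + quadInv (mat h) r)))⁻¹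
      = (ENNReal.ofReal (∑ i, ‖y i‖ ^ 2))⁻¹ * (1 + ENNReal.ofReal (quadInv (mat h) r)) := by
    intro r h
    have hq := quadInv_nonneg (mat h) r
    rw [← ENNReal.ofReal_inv_of_pos (by positivity), ← ENNReal.ofReal_inv_of_pos hy,
      ← ENNReal.ofReal_one, ← ENNReal.ofReal_add zero_le_one hq,
      ← ENNReal.ofReal_mul (by positivity), inv_div, div_eq_mul_inv, mul_comm]
  have hne : (ENNReal.ofReal (∑ i, ‖y i‖ ^ 2))⁻¹ ≠ ⊤ := by simpa using hy
  simp_rw [e1, lintegral_const_mul' _ _ hne]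
  rw [mul_comm (ENNReal.ofReal _)]
  gcongr
  have hcardr : (Fintype.card {l // l ≠ i} : ℝ) = Fintype.card ι - 1 := by
    rw [← hcard]; push_cast; ring
  have hd : (0 : ℝ) < Fintype.card ι - 1 - Fintype.card κ := by linarith
  -- With one row removed there are |ι| - 1 rows, and E‖r‖² = |κ|. Hence the mean is at most 1 +
  -- |κ|/(|ι|-1-|κ|) = (|ι|-1)/(|ι|-1-|κ|).
  calc ∫⁻ r, ∫⁻ h, (1 + ENNReal.ofReal (quadInv (mat h) r)) ∂stdC ({l // l ≠ i} × κ) ∂stdC κ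
      ≤ ∫⁻ r, (1 + ENNReal.ofReal ((∑ j, ‖r j‖ ^ 2)) *
          ENNReal.ofReal (((Fintype.card ι : ℝ) - 1 - Fintype.card κ)⁻¹)) ∂stdC κ := by
        refine lintegral_mono fun r => ?_
        rw [lintegral_add_left measurable_const, lintegral_const, measure_univ, mul_one]
        gcongr
        refine (lintegral_quadInv_le r (by omega)).trans_eq ?_
        rw [hcardr, div_eq_mul_inv, ENNReal.ofReal_mul (by positivity)]
    _ = 1 + Fintype.card κ * ENNReal.ofReal (((Fintype.card ι : ℝ) - 1 - Fintype.card κ)⁻¹) := by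
        rw [lintegral_add_left measurable_const, lintegral_const, measure_univ, mul_one,
          lintegral_mul_const' _ _ ENNReal.ofReal_ne_top, lintegral_sum_sq]
    _ = _ := by
        rw [← ENNReal.ofReal_natCast, ← ENNReal.ofReal_mul (by positivity), ← ENNReal.ofReal_one,
          ← ENNReal.ofReal_add zero_le_one (by positivity)]
        congr 1
        field_simp
        ring

/-- A squared norm is a residual with respect to a matrix without columns, which makes the residual
formulas available with all |ι| degrees of freedom. -/
theorem lintegral_inv_norm_le (a : ι → ℂ) (hM : 2 ≤ Fintype.card ι) :
    ∫⁻ x, (ENNReal.ofReal (∑ i, ‖(a + x) i‖ ^ 2))⁻¹ ∂stdC ι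
      ≤ ENNReal.ofReal (Fintype.card ι / (((Fintype.card ι : ℝ) - 1) *
        (Fintype.card ι + ∑ i, ‖a i‖ ^ 2))) := by
  have h : ∀ x : ι → ℂ, resid (0 : Matrix ι Empty ℂ) x = ∑ i, ‖x i‖ ^ 2 := fun x =>
    resid_mul_of_orthogonal (by simp)
  have hl := lintegral_inv_resid (0 : Matrix ι Empty ℂ) (by simp) (n := Fintype.card ι) (by simp) a
  simp only [h] at hl
  rw [hl]
  exact lintegral_laplace_le hM (by positivity)

/-- Diagonal entry of the inverse of a noncentral complex Wishart matrix, when the `k`-th column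
of the mean is orthogonal to the other ones. -/
theorem lintegral_inv_gram_le (A : Matrix ι κ ℂ) (k : κ) (hA : (dropCol A k)ᴴ *ᵥ A.col k = 0)
    (hc : Fintype.card κ < Fintype.card ι) :
    ∫⁻ z, ENNReal.ofReal ((((A + mat z)ᴴ * (A + mat z))⁻¹ k k).re) ∂stdC (ι × κ)
      ≤ ENNReal.ofReal (Fintype.card ι / (((Fintype.card ι : ℝ) - Fintype.card κ) *
        (Fintype.card ι + ∑ i, ‖A i k‖ ^ 2))) := by
  have hcard := card_ne k
  set a := A.col k with ha
  set B := dropCol A k with hB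
  obtain ⟨n, hn⟩ := Nat.exists_eq_add_of_lt hc
  have hmr : Measurable fun p : (ι × {j // j ≠ k} → ℂ) × (ι → ℂ) => resid (B + mat p.1) (a + p.2) :=
    (entryMeasurable_fst B).resid (measurable_const.add measurable_snd)
  have hmr0 : Measurable fun p : (ι × {j // j ≠ k} → ℂ) × (ι → ℂ) => resid (mat p.1) (a + p.2) := by
    have := (entryMeasurable_fst (0 : Matrix ι {j // j ≠ k} ℂ)).resid
      (x := fun p : (ι × {j // j ≠ k} → ℂ) × (ι → ℂ) => a + p.2)
      (measurable_const.add measurable_snd)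
    simpa only [zero_add] using this
  have e1 : ∀ᵐ z ∂stdC (ι × κ), ENNReal.ofReal ((((A + mat z)ᴴ * (A + mat z))⁻¹ k k).re)
      = (fun (H : Matrix ι {j // j ≠ k} ℂ) (x : ι → ℂ) => (ENNReal.ofReal (resid (B + H) (a + x)))⁻¹)
        (dropCol (mat z) k) ((mat z).col k) := by
    filter_upwards [ae_col_generic A k hc.le] with z hz
    rw [inv_gram_apply _ k hz.1 hz.2, Complex.ofReal_re, ENNReal.ofReal_inv_of_pos
      (lt_of_le_of_ne (resid_nonneg _ _) hz.2.symm)]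
    rfl
  rw [lintegral_congr_ae e1, lintegral_split_col k
    (fun (H : Matrix ι {j // j ≠ k} ℂ) (x : ι → ℂ) => (ENNReal.ofReal (resid (B + H) (a + x)))⁻¹)
    hmr.ennreal_ofReal.inv]
  have hM : (1 : ℝ) < Fintype.card ι := by
    have : 1 < Fintype.card ι := by omega
    exact_mod_cast this
  -- Integrating out column k first leaves the other columns only in the Laplace transform of the
  -- residual of the fixed vector a, which is the quantity compared by `lintegral_exp_resid_le`.
  have lap : ∀ B₁ : Matrix ι {j // j ≠ k} ℂ,
      ∫⁻ h, ∫⁻ x, (ENNReal.ofReal (resid (B₁ + mat h) (a + x)))⁻¹ ∂stdC ι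
        ∂stdC (ι × {j // j ≠ k})
      = ∫⁻ s in Set.Ioi (0 : ℝ), ENNReal.ofReal (((1 + s) ^ (n + 2))⁻¹) *
        ∫⁻ h, ENNReal.ofReal (Real.exp (-(s / (1 + s)) * resid (B₁ + mat h) a))
          ∂stdC (ι × {j // j ≠ k}) := by
    intro B₁
    have hm₁ : Measurable fun h : ι × {j // j ≠ k} → ℂ => resid (B₁ + mat h) a :=
      (entryMeasurable_add_mat B₁).resid measurable_const
    have : ∀ᵐ h ∂stdC (ι × {j // j ≠ k}),
        ∫⁻ x, (ENNReal.ofReal (resid (B₁ + mat h) (a + x)))⁻¹ ∂stdC ι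
        = ∫⁻ s in Set.Ioi (0 : ℝ), ENNReal.ofReal (((1 + s) ^ (n + 2))⁻¹ *
          Real.exp (-(s / (1 + s)) * resid (B₁ + mat h) a)) := by
      filter_upwards [ae_isUnit_gram (ι := ι) _ rfl (by omega) B₁] with h hh
      exact lintegral_inv_resid _ hh (by omega) a
    rw [lintegral_congr_ae this, lintegral_lintegral_swap (Measurable.aemeasurable
      (Measurable.ennreal_ofReal (Measurable.mul (by fun_prop) (Real.measurable_exp.comp
        (Measurable.mul (by fun_prop) (hm₁.comp measurable_fst))))))]
    refine setLIntegral_congr_fun measurableSet_Ioi fun s hs => ?_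
    have hs' : (0 : ℝ) ≤ ((1 + s) ^ (n + 2))⁻¹ := by
      have : (0 : ℝ) < s := hs
      positivity
    simp_rw [ENNReal.ofReal_mul hs']
    rw [lintegral_const_mul' _ _ ENNReal.ofReal_ne_top]
  -- The mean B of the other columns is dropped. The order of integration is then reversed: the
  -- centred columns are averaged for a fixed vector a + x, and x comes last.
  calc _ ≤ ∫⁻ h, ∫⁻ x, (ENNReal.ofReal (resid (0 + mat h) (a + x)))⁻¹ ∂stdC ι
        ∂stdC (ι × {j // j ≠ k}) := by
        rw [lap, lap]
        refine setLIntegral_mono' measurableSet_Ioi fun s hs => ?_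
        refine mul_le_mul' le_rfl ?_
        have hs' : (0 : ℝ) < s := hs
        have := lintegral_exp_resid_le B hA (by omega) (c := s / (1 + s)) (by positivity)
        simpa only [zero_add] using this
    _ = ∫⁻ x, ∫⁻ h, (ENNReal.ofReal (resid (mat h) (a + x)))⁻¹ ∂stdC (ι × {j // j ≠ k})
        ∂stdC ι := by
        simp only [zero_add]
        rw [lintegral_lintegral_swap hmr0.ennreal_ofReal.inv.aemeasurable]
    _ ≤ ∫⁻ x, ENNReal.ofReal (((Fintype.card ι : ℝ) - 1) /
        (Fintype.card ι - 1 - Fintype.card {j // j ≠ k})) *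
        (ENNReal.ofReal (∑ i, ‖(a + x) i‖ ^ 2))⁻¹ ∂stdC ι :=
        lintegral_mono fun x => lintegral_inv_resid_fixed_le (a + x) (by omega)
    _ ≤ ENNReal.ofReal (((Fintype.card ι : ℝ) - 1) /
        (Fintype.card ι - 1 - Fintype.card {j // j ≠ k})) *
        ENNReal.ofReal (Fintype.card ι / (((Fintype.card ι : ℝ) - 1) *
        (Fintype.card ι + ∑ i, ‖a i‖ ^ 2))) := by
        rw [lintegral_const_mul' _ _ ENNReal.ofReal_ne_top]
        gcongr
        exact lintegral_inv_norm_le a (by omega)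
    _ = _ := by
        have hk : (Fintype.card {j // j ≠ k} : ℝ) = Fintype.card κ - 1 := by
          rw [← hcard]; push_cast; ring
        have hlt : (Fintype.card κ : ℝ) < Fintype.card ι := by exact_mod_cast hc
        rw [hk, show (Fintype.card ι : ℝ) - 1 - (Fintype.card κ - 1)
          = Fintype.card ι - Fintype.card κ by ring, ← ENNReal.ofReal_mul
            (div_nonneg (by linarith) (by linarith))]
        congr 1
        have h1 : (Fintype.card ι : ℝ) - 1 ≠ 0 := by linarith
        have h2 : (Fintype.card ι : ℝ) - Fintype.card κ ≠ 0 := by linarith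
        have h3 : (Fintype.card ι : ℝ) + ∑ i, ‖a i‖ ^ 2 ≠ 0 := by positivity
        change _ = (Fintype.card ι : ℝ) / (((Fintype.card ι : ℝ) - Fintype.card κ) *
          (Fintype.card ι + ∑ i, ‖a i‖ ^ 2))
        field_simp

end wishart


/-! ### Mean of the inverse of a noncentral Wishart matrix. -/

section wishartMean
open scoped ComplexOrder
variable {ι κ : Type*} [Fintype ι] [Fintype κ] [DecidableEq ι] [DecidableEq κ]

theorem measurable_mul_mat_mul (U : Matrix ι ι ℂ) (V : Matrix κ κ ℂ) :
    Measurable (fun (z : ι × κ → ℂ) (p : ι × κ) => (U * mat z * V : Matrix ι κ ℂ) p.1 p.2) :=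
  measurable_pi_iff.2 fun p =>
    (((EntryMeasurable.const U).mul entryMeasurable_mat).mul (EntryMeasurable.const V)) p.1 p.2

theorem stdC_map_unitary {U : Matrix ι ι ℂ} {V : Matrix κ κ ℂ} (hU : Uᴴ * U = 1)
    (hV : Vᴴ * V = 1) :
    (stdC (ι × κ)).map (fun z p => (U * mat z * V : Matrix ι κ ℂ) p.1 p.2) = stdC (ι × κ) := by
  refine stdC_map _ (fun t p => (Uᴴ * mat t * Vᴴ : Matrix ι κ ℂ) p.1 p.2)
    ?_ (fun t z => ?_) (fun t => ?_)
  · exact measurable_mul_mat_mul U V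
  · rw [star_dotProduct_eq_trace, star_dotProduct_eq_trace]
    change ((mat t)ᴴ * (U * mat z * V)).trace = ((Uᴴ * mat t * Vᴴ)ᴴ * mat z).trace
    simp only [conjTranspose_mul, conjTranspose_conjTranspose]
    rw [← Matrix.mul_assoc, trace_mul_comm _ V]
    simp only [Matrix.mul_assoc]
  · apply sum_sq_eq_of_trace
    change ((Uᴴ * mat t * Vᴴ)ᴴ * (Uᴴ * mat t * Vᴴ)).trace = _
    simp only [conjTranspose_mul, conjTranspose_conjTranspose]
    have e : V * ((mat t)ᴴ * U) * (Uᴴ * mat t * Vᴴ) = V * ((mat t)ᴴ * mat t * Vᴴ) := by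
      calc _ = V * ((mat t)ᴴ * (U * Uᴴ) * mat t * Vᴴ) := by simp only [Matrix.mul_assoc]
        _ = _ := by rw [mul_eq_one_comm.1 hU, Matrix.mul_one]
    rw [e, trace_mul_comm, Matrix.mul_assoc, hV, Matrix.mul_one]

/-- Exhibits the inverse as a Gram matrix itself. Diagonal entries thus are squared norms, and
off-diagonal ones are controlled by them. In the singular case both sides are `0`. -/
theorem inv_gram_eq_gram (H : Matrix ι κ ℂ) :
    (Hᴴ * H)⁻¹ = (H * (Hᴴ * H)⁻¹)ᴴ * (H * (Hᴴ * H)⁻¹) := by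
  have hh : ((Hᴴ * H)⁻¹)ᴴ = (Hᴴ * H)⁻¹ := (isHermitian_conjTranspose_mul_self H).inv.eq
  rw [conjTranspose_mul, hh]
  by_cases h : IsUnit (Hᴴ * H).det
  · rw [Matrix.mul_assoc, ← Matrix.mul_assoc Hᴴ, mul_nonsing_inv _ h, Matrix.mul_one]
  · simp [nonsing_inv_apply_not_isUnit _ h]

theorem inv_gram_apply_self (H : Matrix ι κ ℂ) (k : κ) :
    (Hᴴ * H)⁻¹ k k = ((∑ i, ‖(H * (Hᴴ * H)⁻¹) i k‖ ^ 2 : ℝ) : ℂ) := by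
  conv_lhs => rw [inv_gram_eq_gram]
  rw [Matrix.mul_apply]
  push_cast
  exact Finset.sum_congr rfl fun i _ => by
    rw [conjTranspose_apply, RCLike.star_def, Complex.conj_mul']

theorem inv_gram_re_nonneg (H : Matrix ι κ ℂ) (k : κ) : 0 ≤ ((Hᴴ * H)⁻¹ k k).re := by
  rw [inv_gram_apply_self, Complex.ofReal_re]; positivity

/-- Reduces the integrability of all entries to that of the diagonal ones. -/
theorem norm_inv_gram_apply_le (H : Matrix ι κ ℂ) (i j : κ) :
    ‖(Hᴴ * H)⁻¹ i j‖ ≤ ((Hᴴ * H)⁻¹ i i).re + ((Hᴴ * H)⁻¹ j j).re := by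
  rw [inv_gram_apply_self, inv_gram_apply_self, Complex.ofReal_re, Complex.ofReal_re]
  conv_lhs => rw [inv_gram_eq_gram]
  generalize H * (Hᴴ * H)⁻¹ = F
  rw [Matrix.mul_apply, ← Finset.sum_add_distrib]
  refine (norm_sum_le _ _).trans (Finset.sum_le_sum fun l _ => ?_)
  rw [conjTranspose_apply, norm_mul, norm_star]
  nlinarith [sq_nonneg (‖F l i‖ - ‖F l j‖), sq_nonneg ‖F l i‖, sq_nonneg ‖F l j‖]

/-- Inverse Gram matrix of a Gaussian matrix with mean `A`. -/
def invGram (A : Matrix ι κ ℂ) (z : ι × κ → ℂ) : Matrix κ κ ℂ :=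
  ((A + mat z)ᴴ * (A + mat z))⁻¹

theorem entryMeasurable_invGram (A : Matrix ι κ ℂ) : EntryMeasurable (invGram A) :=
  ((entryMeasurable_add_mat A).conjTranspose.mul (entryMeasurable_add_mat A)).inv

theorem invGram_re_nonneg (A : Matrix ι κ ℂ) (z : ι × κ → ℂ) (k : κ) :
    0 ≤ (invGram A z k k).re := inv_gram_re_nonneg _ _

theorem integral_comp_of_map_eq {Ω : Type*} [MeasurableSpace Ω] {μ : Measure Ω} {f : Ω → Ω}
    (hf : Measurable f) (hμ : μ.map f = μ) {g : Ω → ℂ} (hg : Measurable g) :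
    ∫ z, g (f z) ∂μ = ∫ z, g z ∂μ := by
  conv_rhs => rw [← hμ]
  rw [integral_map hf.aemeasurable hg.aestronglyMeasurable]

/-- Singular S is allowed, since both inverses are then `0`. -/
theorem inv_smul_of_ne_zero {c : ℂ} (hc : c ≠ 0) (S : Matrix κ κ ℂ) : (c • S)⁻¹ = c⁻¹ • S⁻¹ := by
  by_cases h : IsUnit S.det
  · exact inv_smul' S (Units.mk0 c hc) h
  · have h' : ¬IsUnit (c • S).det := by
      rw [det_smul]
      intro h2
      exact h (isUnit_of_mul_isUnit_right h2)
    rw [nonsing_inv_apply_not_isUnit _ h, nonsing_inv_apply_not_isUnit _ h', smul_zero]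

theorem dropCol_orthogonal {A : Matrix ι κ ℂ} {l : κ → ℂ} (hA : Aᴴ * A = diagonal l) (k : κ) :
    (dropCol A k)ᴴ *ᵥ A.col k = 0 := by
  ext ⟨j, hj⟩
  have := congrFun (congrFun hA j) k
  rw [diagonal_apply_ne _ hj, Matrix.mul_apply] at this
  simpa [mulVec, dotProduct, dropCol] using this

theorem integrable_invGram_diag {A : Matrix ι κ ℂ} {l : κ → ℂ} (hA : Aᴴ * A = diagonal l)
    (hc : Fintype.card κ < Fintype.card ι) (k : κ) :
    Integrable (fun z => (invGram A z k k).re) (stdC (ι × κ)) := by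
  refine ⟨(Complex.measurable_re.comp (entryMeasurable_invGram A k k)).aestronglyMeasurable, ?_⟩
  rw [hasFiniteIntegral_iff_ofReal
    (Filter.Eventually.of_forall fun z => invGram_re_nonneg A z k)]
  exact (lintegral_inv_gram_le A k (dropCol_orthogonal hA k) hc).trans_lt ENNReal.ofReal_lt_top

theorem integrable_invGram_of_diag {A : Matrix ι κ ℂ} {l : κ → ℂ} (hA : Aᴴ * A = diagonal l)
    (hc : Fintype.card κ < Fintype.card ι) (i j : κ) :
    Integrable (fun z => invGram A z i j) (stdC (ι × κ)) :=
  ((integrable_invGram_diag hA hc i).add (integrable_invGram_diag hA hc j)).mono'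
    (entryMeasurable_invGram A i j).aestronglyMeasurable
    (Filter.Eventually.of_forall fun _ => norm_inv_gram_apply_le _ _ _)

theorem integral_invGram_diag_le {A : Matrix ι κ ℂ} {l : κ → ℂ} (hA : Aᴴ * A = diagonal l)
    (hc : Fintype.card κ < Fintype.card ι) (k : κ) :
    ∫ z, (invGram A z k k).re ∂stdC (ι × κ)
      ≤ Fintype.card ι / (((Fintype.card ι : ℝ) - Fintype.card κ) *
        (Fintype.card ι + ∑ i, ‖A i k‖ ^ 2)) := by
  have hlt : (Fintype.card κ : ℝ) < Fintype.card ι := by exact_mod_cast hc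
  have h0 : 0 ≤ (Fintype.card ι : ℝ) / (((Fintype.card ι : ℝ) - Fintype.card κ) *
      (Fintype.card ι + ∑ i, ‖A i k‖ ^ 2)) :=
    div_nonneg (by positivity) (mul_nonneg (by linarith) (by positivity))
  rw [← ENNReal.ofReal_le_ofReal_iff h0, ofReal_integral_eq_lintegral_ofReal
    (integrable_invGram_diag hA hc k)
    (Filter.Eventually.of_forall fun z => invGram_re_nonneg A z k)]
  exact lintegral_inv_gram_le A k (dropCol_orthogonal hA k) hc

/-- A unitary matrix that reflects one column of a matrix with orthogonal columns. -/
theorem exists_reflection {A : Matrix ι κ ℂ} {l : κ → ℂ} (hA : Aᴴ * A = diagonal l) (i : κ) :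
    ∃ U : Matrix ι ι ℂ, Uᴴ * U = 1 ∧
      U * A = A * diagonal fun j => if j = i then (-1 : ℂ) else 1 := by
  set a := A.col i with ha
  have hcol : ∀ j, star a ⬝ᵥ A.col j = if j = i then l i else 0 := by
    intro j
    have := congrFun (congrFun hA i) j
    rw [Matrix.mul_apply, diagonal_apply] at this
    by_cases h : j = i
    · subst h; simpa [dotProduct, ha] using this
    · rw [if_neg (Ne.symm h)] at this
      rw [if_neg h]
      simpa [dotProduct, ha] using this
  have hnorm : star a ⬝ᵥ a = ((∑ m, ‖a m‖ ^ 2 : ℝ) : ℂ) := star_dotProduct_self a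
  have hli : l i = star a ⬝ᵥ a := by rw [ha, hcol i, if_pos rfl]
  by_cases h0 : l i = 0
  · refine ⟨1, by simp, ?_⟩
    have ha0 : a = 0 := by
      rw [hli] at h0
      exact dotProduct_star_self_eq_zero.1 h0
    ext m j
    rw [Matrix.one_mul, mul_diagonal]
    by_cases h : j = i
    · subst h
      have : A m j = 0 := congrFun ha0 m
      simp [this]
    · simp [h]
  -- The Householder reflection along column i, with l i = ‖a‖². It fixes the other columns because
  -- they are orthogonal to a.
  · refine ⟨1 - (2 / l i) • vecMulVec a (star a), ?_, ?_⟩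
    · have hst : star (l i) = l i := by
        rw [hli, hnorm]; simp
      have hvv : vecMulVec a (star a) * vecMulVec a (star a) = l i • vecMulVec a (star a) := by
        rw [vecMulVec_mul_vecMulVec, ← hli]
        ext x y
        simp [vecMulVec_apply]
        ring
      have hct : (vecMulVec a (star a))ᴴ = vecMulVec a (star a) := by
        rw [conjTranspose_vecMulVec, star_star]
      rw [conjTranspose_sub, conjTranspose_one, conjTranspose_smul, hct]
      simp only [Matrix.sub_mul, Matrix.mul_sub, Matrix.smul_mul, Matrix.mul_smul, hvv, smul_smul,
        Matrix.one_mul, Matrix.mul_one]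
      have e1 : star (2 / l i) = 2 / l i := by
        rw [star_div₀, hst]; simp
      rw [e1]
      rw [div_mul_cancel₀ _ h0, two_smul]
      simp
    · ext m j
      have h1 : (vecMulVec a (star a) * A) m j = a m * (star a ⬝ᵥ A.col j) := by
        rw [vecMulVec_mul, vecMulVec_apply]
        rfl
      rw [Matrix.sub_mul, Matrix.one_mul, Matrix.smul_mul, Matrix.sub_apply, Matrix.smul_apply, h1, hcol,
        mul_diagonal, smul_eq_mul]
      by_cases h : j = i
      · subst h
        have : a m = A m j := rfl
        rw [if_pos rfl, if_pos rfl, this]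
        field_simp
        ring
      · simp [h]

/-- Let U reflect column i of the mean and let L flip the sign of coordinate i. Then Z and U Z L
have the same law, and the substitution conjugates the inverse Gram matrix by L, which changes the
sign of the (i, j) entry. The mean therefore equals its own negative. -/
theorem integral_invGram_off_diag {A : Matrix ι κ ℂ} {l : κ → ℂ} (hA : Aᴴ * A = diagonal l)
    {i j : κ} (hij : i ≠ j) : ∫ z, invGram A z i j ∂stdC (ι × κ) = 0 := by
  obtain ⟨U, hU, hUA⟩ := exists_reflection hA i
  set L : Matrix κ κ ℂ := diagonal fun j => if j = i then (-1 : ℂ) else 1 with hL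
  have hLL : L * L = 1 := by
    rw [hL, diagonal_mul_diagonal, ← diagonal_one]
    congr 1
    ext j
    by_cases h : j = i <;> simp [h]
  have hLh : Lᴴ = L := by
    rw [hL, diagonal_conjTranspose]
    congr 1
    ext j
    by_cases h : j = i <;> simp [h]
  have hinv : ∀ z, invGram A (fun p => (U * mat z * L : Matrix ι κ ℂ) p.1 p.2)
      = L * invGram A z * L := by
    intro z
    unfold invGram
    have e1 : A + mat (fun p => (U * mat z * L : Matrix ι κ ℂ) p.1 p.2) = U * (A + mat z) * L := by
      change A + U * mat z * L = _
      rw [Matrix.mul_add, hUA, Matrix.add_mul, Matrix.mul_assoc A, hLL, Matrix.mul_one]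
    rw [e1]
    have e2 : (U * (A + mat z) * L)ᴴ * (U * (A + mat z) * L)
        = L * ((A + mat z)ᴴ * (A + mat z)) * L := by
      simp only [conjTranspose_mul, hLh]
      calc _ = L * ((A + mat z)ᴴ * (Uᴴ * U) * (A + mat z)) * L := by simp only [Matrix.mul_assoc]
        _ = _ := by rw [hU, Matrix.mul_one]
    rw [e2, Matrix.mul_inv_rev, Matrix.mul_inv_rev, inv_eq_left_inv hLL, Matrix.mul_assoc]
  have hm := stdC_map_unitary (ι := ι) hU (V := L) (by rw [hLh, hLL])
  have h1 : ∫ z, invGram A z i j ∂stdC (ι × κ) = -∫ z, invGram A z i j ∂stdC (ι × κ) := by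
    have h2 := integral_comp_of_map_eq (measurable_mul_mat_mul U L) hm (entryMeasurable_invGram A i j)
    conv_lhs => rw [← h2]
    rw [← integral_neg]
    refine integral_congr_ae (Filter.Eventually.of_forall fun z => ?_)
    simp only [hinv]
    rw [hL, mul_diagonal, diagonal_mul]
    simp [hij.symm]
  exact self_eq_neg.1 h1

theorem exists_unitary_diag (A : Matrix ι κ ℂ) :
    ∃ (V : Matrix κ κ ℂ) (l : κ → ℝ), Vᴴ * V = 1 ∧ (∀ i, 0 ≤ l i) ∧
      Aᴴ * A = V * diagonal (fun i => (l i : ℂ)) * Vᴴ := by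
  have hA := posSemidef_conjTranspose_mul_self A
  refine ⟨hA.isHermitian.eigenvectorUnitary, hA.isHermitian.eigenvalues, ?_,
    hA.eigenvalues_nonneg, ?_⟩
  · have := Unitary.coe_star_mul_self hA.isHermitian.eigenvectorUnitary
    rwa [star_eq_conjTranspose] at this
  · have := hA.isHermitian.spectral_theorem
    rw [Unitary.conjStarAlgAut_apply] at this
    exact this

/-- `E W⁻¹ ≤ M / (M - K) (M + Aᴴ A)⁻¹` on the diagonal, for `W` the Gram matrix of an `M × K`
Gaussian matrix with mean `A`. -/
theorem integral_invGram_le (A : Matrix ι κ ℂ) (hc : Fintype.card κ < Fintype.card ι) (k : κ) :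
    Integrable (fun z => (invGram A z k k).re) (stdC (ι × κ)) ∧
    ∫ z, (invGram A z k k).re ∂stdC (ι × κ)
      ≤ Fintype.card ι / ((Fintype.card ι : ℝ) - Fintype.card κ) *
        ((((Fintype.card ι : ℂ) • (1 : Matrix κ κ ℂ) + Aᴴ * A)⁻¹ k k).re) := by
  -- The mean A V has orthogonal columns of squared norms l i. In this basis the mean inverse is
  -- diagonal, as is (M + AᴴA)⁻¹ with entries 1/(M + l i), so the claim is an inequality between
  -- eigenvalues, weighted by |V k i|².
  obtain ⟨V, l, hV, hl, hdiag⟩ := exists_unitary_diag A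
  have hV' : V * Vᴴ = 1 := mul_eq_one_comm.1 hV
  set B := A * V with hB
  have hBB : Bᴴ * B = diagonal fun i => (l i : ℂ) := by
    rw [hB, conjTranspose_mul]
    calc _ = Vᴴ * (Aᴴ * A) * V := by simp only [Matrix.mul_assoc]
      _ = (Vᴴ * V) * diagonal (fun i => (l i : ℂ)) * (Vᴴ * V) := by
        rw [hdiag]; simp only [Matrix.mul_assoc]
      _ = _ := by rw [hV, Matrix.one_mul, Matrix.mul_one]
  let f : (ι × κ → ℂ) → (ι × κ → ℂ) :=
    fun z p => ((1 : Matrix ι ι ℂ) * mat z * V : Matrix ι κ ℂ) p.1 p.2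
  have hf : Measurable f := measurable_mul_mat_mul 1 V
  have hmap : (stdC (ι × κ)).map f = stdC (ι × κ) := stdC_map_unitary (by simp) hV
  have hinv : ∀ z, invGram A z = V * invGram B (f z) * Vᴴ := by
    intro z
    unfold invGram
    have e1 : A + mat z = (B + mat (f z)) * Vᴴ := by
      change _ = (A * V + (1 : Matrix ι ι ℂ) * mat z * V) * Vᴴ
      rw [Matrix.one_mul, ← Matrix.add_mul, Matrix.mul_assoc, hV', Matrix.mul_one]
    have e2 : ((B + mat (f z)) * Vᴴ)ᴴ * ((B + mat (f z)) * Vᴴ)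
        = V * ((B + mat (f z))ᴴ * (B + mat (f z))) * Vᴴ := by
      simp only [conjTranspose_mul, conjTranspose_conjTranspose, Matrix.mul_assoc]
    rw [e1, e2, Matrix.mul_inv_rev, Matrix.mul_inv_rev, inv_eq_left_inv hV, inv_eq_left_inv hV',
      Matrix.mul_assoc]
  have hent : ∀ S : Matrix κ κ ℂ, (V * S * Vᴴ) k k = ∑ i, ∑ j, V k i * star (V k j) * S i j := by
    intro S
    simp only [Matrix.mul_apply, conjTranspose_apply, Finset.sum_mul]
    rw [Finset.sum_comm]
    exact Finset.sum_congr rfl fun i _ => Finset.sum_congr rfl fun j _ => by ring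
  have hintB : ∀ i j, Integrable (fun z => invGram B (f z) i j) (stdC (ι × κ)) := by
    intro i j
    have := integrable_invGram_of_diag hBB hc i j
    rw [← hmap] at this
    exact this.comp_measurable hf
  have hint : Integrable (fun z => invGram A z k k) (stdC (ι × κ)) := by
    simp only [hinv, hent]
    exact integrable_finsetSum _ fun i _ => integrable_finsetSum _ fun j _ =>
      (hintB i j).const_mul _
  have hval : ∀ i j, ∫ z, invGram B (f z) i j ∂stdC (ι × κ) = ∫ z, invGram B z i j ∂stdC (ι × κ) := by
    intro i j
    exact integral_comp_of_map_eq hf hmap (entryMeasurable_invGram B i j)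
  have hE : ∫ z, invGram A z k k ∂stdC (ι × κ)
      = ((∑ i, ‖V k i‖ ^ 2 * ∫ z, (invGram B z i i).re ∂stdC (ι × κ) : ℝ) : ℂ) := by
    simp only [hinv, hent]
    rw [integral_finsetSum _ fun i _ => integrable_finsetSum _ fun j _ => (hintB i j).const_mul _]
    push_cast
    refine Finset.sum_congr rfl fun i _ => ?_
    rw [integral_finsetSum _ fun j _ => (hintB i j).const_mul _, Finset.sum_eq_single i]
    · rw [integral_const_mul, hval, RCLike.star_def, Complex.mul_conj', ← integral_complex_ofReal]
      congr 1
      refine integral_congr_ae (Filter.Eventually.of_forall fun z => ?_)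
      simp only [invGram]
      rw [inv_gram_apply_self, Complex.ofReal_re]
    · intro j _ hj
      rw [integral_const_mul, hval, integral_invGram_off_diag hBB hj.symm, mul_zero]
    · simp
  refine ⟨hint.re, ?_⟩
  have hre : ∫ z, (invGram A z k k).re ∂stdC (ι × κ)
      = ∑ i, ‖V k i‖ ^ 2 * ∫ z, (invGram B z i i).re ∂stdC (ι × κ) := by
    have := integral_re hint
    simp only [RCLike.re_eq_complex_re] at this
    rw [this, hE, Complex.ofReal_re]
  have hM : (0 : ℝ) < Fintype.card ι := by
    have : 0 < Fintype.card ι := by omega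
    exact_mod_cast this
  have hlt : (Fintype.card κ : ℝ) < Fintype.card ι := by exact_mod_cast hc
  have hinvM : (((Fintype.card ι : ℂ) • (1 : Matrix κ κ ℂ) + Aᴴ * A)⁻¹ k k).re
      = ∑ i, ‖V k i‖ ^ 2 * ((Fintype.card ι : ℝ) + l i)⁻¹ := by
    have e1 : (Fintype.card ι : ℂ) • (1 : Matrix κ κ ℂ) + Aᴴ * A
        = V * diagonal (fun i => (Fintype.card ι + l i : ℂ)) * Vᴴ := by
      have e0 : diagonal (fun i => (Fintype.card ι + l i : ℂ))
          = (Fintype.card ι : ℂ) • (1 : Matrix κ κ ℂ) + diagonal fun i => (l i : ℂ) := by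
        rw [← diagonal_one, ← diagonal_smul, diagonal_add]
        congr 1
        ext i
        simp
      rw [hdiag, e0, Matrix.mul_add, Matrix.add_mul, Matrix.mul_smul, Matrix.mul_one,
        Matrix.smul_mul, hV']
    have e2 : (V * diagonal (fun i => (Fintype.card ι + l i : ℂ)) * Vᴴ)⁻¹
        = V * diagonal (fun i => (((Fintype.card ι + l i)⁻¹ : ℝ) : ℂ)) * Vᴴ := by
      apply inv_eq_left_inv
      calc _ = V * (diagonal (fun i => (((Fintype.card ι + l i)⁻¹ : ℝ) : ℂ)) * (Vᴴ * V) *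
            diagonal (fun i => (Fintype.card ι + l i : ℂ))) * Vᴴ := by
            simp only [Matrix.mul_assoc]
        _ = V * 1 * Vᴴ := by
            rw [hV, Matrix.mul_one, diagonal_mul_diagonal, ← diagonal_one]
            congr 3
            ext i
            have := hl i
            have h2 : ((Fintype.card ι : ℝ) + l i) ≠ 0 := by positivity
            have h3 : ((((Fintype.card ι : ℝ) + l i : ℝ)) : ℂ) ≠ 0 := by exact_mod_cast h2
            push_cast at h3 ⊢
            exact inv_mul_cancel₀ h3
        _ = _ := by rw [Matrix.mul_one, hV']
    rw [e1, e2, hent, Complex.re_sum]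
    refine Finset.sum_congr rfl fun i _ => ?_
    rw [Finset.sum_eq_single i]
    · rw [diagonal_apply_eq, RCLike.star_def, Complex.mul_conj', ← Complex.ofReal_pow,
        ← Complex.ofReal_mul, Complex.ofReal_re]
    · intro j _ hj
      rw [diagonal_apply_ne _ hj.symm, mul_zero]
    · simp
  rw [hre, hinvM, Finset.mul_sum]
  refine Finset.sum_le_sum fun i _ => ?_
  have hcol : ∑ m, ‖B m i‖ ^ 2 = l i := by
    have := congrFun (congrFun hBB i) i
    rw [Matrix.mul_apply, diagonal_apply_eq] at this
    have h2 : ((∑ m, ‖B m i‖ ^ 2 : ℝ) : ℂ) = l i := by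
      rw [← this]
      push_cast
      exact Finset.sum_congr rfl fun m _ => by
        rw [conjTranspose_apply, RCLike.star_def, Complex.conj_mul']
    exact_mod_cast h2
  have hb := integral_invGram_diag_le hBB hc i
  rw [hcol] at hb
  have hli := hl i
  calc _ ≤ ‖V k i‖ ^ 2 * (Fintype.card ι / (((Fintype.card ι : ℝ) - Fintype.card κ) *
        (Fintype.card ι + l i))) := by gcongr
    _ = _ := by
      have h1 : (Fintype.card ι : ℝ) - Fintype.card κ ≠ 0 := by linarith
      have h2 : (Fintype.card ι : ℝ) + l i ≠ 0 := by positivity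
      field_simp

/-- Mean of the inverse Gram matrix of a Gaussian matrix with independent columns of mean
`A` and variances `ψ`. -/
theorem integral_inv_gram_scaled_le (A : Matrix ι κ ℂ) {ψ : κ → ℝ} (hψ : ∀ j, 0 < ψ j)
    (hc : Fintype.card κ < Fintype.card ι) (k : κ) {H : (ι × κ → ℂ) → Matrix ι κ ℂ}
    (hH : ∀ z, H z = A + mat z * diagonal fun j => ((Real.sqrt (ψ j) : ℝ) : ℂ)) :
    (∀ᵐ z ∂stdC (ι × κ), IsUnit ((H z)ᴴ * H z)) ∧
    Integrable (fun z => (((H z)ᴴ * H z)⁻¹ k k).re) (stdC (ι × κ)) ∧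
    ∫ z, (((H z)ᴴ * H z)⁻¹ k k).re ∂stdC (ι × κ)
      ≤ ((Fintype.card ι : ℝ) - Fintype.card κ)⁻¹ *
        (((diagonal fun j => (ψ j : ℂ)) + (Fintype.card ι : ℂ)⁻¹ • (Aᴴ * A))⁻¹ k k).re := by
  set D : Matrix κ κ ℂ := diagonal fun j => ((Real.sqrt (ψ j) : ℝ) : ℂ) with hD
  set E : Matrix κ κ ℂ := diagonal fun j => (((Real.sqrt (ψ j))⁻¹ : ℝ) : ℂ) with hE
  have hs : ∀ j, (Real.sqrt (ψ j)) ≠ 0 := fun j => (Real.sqrt_pos.2 (hψ j)).ne'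
  have hDE : D * E = 1 := by
    rw [hD, hE, diagonal_mul_diagonal, ← diagonal_one]
    congr 1
    ext j
    rw [← Complex.ofReal_mul, mul_inv_cancel₀ (hs j), Complex.ofReal_one]
  have hED : E * D = 1 := mul_eq_one_comm.1 hDE
  have hDh : Dᴴ = D := by
    rw [hD, diagonal_conjTranspose]; congr 1; ext j; simp
  have hEh : Eᴴ = E := by
    rw [hE, diagonal_conjTranspose]; congr 1; ext j; simp
  have hDinv : D⁻¹ = E := inv_eq_left_inv hED
  -- Factoring out the standard deviations leaves unit variances around the mean A E. The diagonal
  -- factor D cancels from both sides, each picking up (ψ k)⁻¹.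
  set B := A * E with hB
  have hHB : ∀ z, H z = (B + mat z) * D := by
    intro z
    rw [hH, Matrix.add_mul, hB, Matrix.mul_assoc, hED, Matrix.mul_one]
  have hgram : ∀ z, (H z)ᴴ * H z = D * ((B + mat z)ᴴ * (B + mat z)) * D := by
    intro z
    rw [hHB, conjTranspose_mul, hDh]
    simp only [Matrix.mul_assoc]
  have hkk : ∀ S : Matrix κ κ ℂ, ((D * S * D)⁻¹ k k).re = (ψ k)⁻¹ * (S⁻¹ k k).re := by
    intro S
    rw [Matrix.mul_inv_rev, Matrix.mul_inv_rev, hDinv, hE, diagonal_mul, mul_diagonal]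
    have : ((((Real.sqrt (ψ k))⁻¹ : ℝ) : ℂ) * (S⁻¹ k k * (((Real.sqrt (ψ k))⁻¹ : ℝ) : ℂ)))
        = (((ψ k)⁻¹ : ℝ) : ℂ) * S⁻¹ k k := by
      conv_rhs => rw [← Real.mul_self_sqrt (hψ k).le]
      push_cast
      ring
    rw [this, Complex.re_ofReal_mul]
  have hinv : ∀ z, (((H z)ᴴ * H z)⁻¹ k k).re = (ψ k)⁻¹ * (invGram B z k k).re := by
    intro z
    rw [hgram, hkk]
    rfl
  obtain ⟨hint, hle⟩ := integral_invGram_le B hc k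
  have hM : (0 : ℝ) < Fintype.card ι := by
    have : 0 < Fintype.card ι := by omega
    exact_mod_cast this
  refine ⟨?_, ?_, ?_⟩
  · filter_upwards [ae_isUnit_gram (ι := ι) _ rfl hc.le B] with z hz
    rw [hgram, isUnit_iff_isUnit_det, det_mul, det_mul]
    have : IsUnit D.det := by
      rw [← isUnit_iff_isUnit_det]
      exact IsUnit.of_mul_eq_one E hDE
    exact (this.mul hz).mul this
  · simp only [hinv]
    exact hint.const_mul _
  · simp only [hinv]
    rw [integral_const_mul]
    have hMc : (Fintype.card ι : ℂ) ≠ 0 := by exact_mod_cast hM.ne'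
    have e1 : (diagonal fun j => (ψ j : ℂ)) + (Fintype.card ι : ℂ)⁻¹ • (Aᴴ * A)
        = (Fintype.card ι : ℂ)⁻¹ • (D * ((Fintype.card ι : ℂ) • (1 : Matrix κ κ ℂ) + Bᴴ * B) * D) := by
      have hBB : D * (Bᴴ * B) * D = Aᴴ * A := by
        rw [hB, conjTranspose_mul, hEh]
        calc _ = (D * E) * (Aᴴ * A) * (E * D) := by simp only [Matrix.mul_assoc]
          _ = _ := by rw [hDE, hED, Matrix.one_mul, Matrix.mul_one]
      have hDD : D * D = diagonal fun j => (ψ j : ℂ) := by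
        rw [hD, diagonal_mul_diagonal]
        congr 1
        ext j
        rw [← Complex.ofReal_mul, Real.mul_self_sqrt (hψ j).le]
      rw [Matrix.mul_add, Matrix.add_mul, hBB, smul_add, Matrix.mul_smul, Matrix.mul_one,
        Matrix.smul_mul, hDD, smul_smul, inv_mul_cancel₀ hMc, one_smul]
    have e2 : (((diagonal fun j => (ψ j : ℂ)) + (Fintype.card ι : ℂ)⁻¹ • (Aᴴ * A))⁻¹ k k).re
        = Fintype.card ι * ((ψ k)⁻¹ *
          ((((Fintype.card ι : ℂ) • (1 : Matrix κ κ ℂ) + Bᴴ * B)⁻¹ k k).re)) := by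
      rw [e1, ← hkk]
      rw [inv_smul_of_ne_zero (inv_ne_zero hMc), inv_inv, Matrix.smul_apply, smul_eq_mul, ← Complex.ofReal_natCast, Complex.re_ofReal_mul]
    rw [e2]
    have hψk := hψ k
    calc _ ≤ (ψ k)⁻¹ * (Fintype.card ι / ((Fintype.card ι : ℝ) - Fintype.card κ) *
        ((((Fintype.card ι : ℂ) • (1 : Matrix κ κ ℂ) + Bᴴ * B)⁻¹ k k).re)) := by gcongr
      _ = _ := by rw [div_eq_mul_inv]; ring

end wishartMean


/-! ### Second moments of Gaussian linear forms. -/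

section moments
variable {ι α β : Type*} [Fintype ι] [Fintype α] [Fintype β]

/-- Sign changes of selected coordinates preserve the law; this is how first moments, cross moments
and means of linear forms are shown to vanish. -/
theorem stdC_map_flip (p : ι → Prop) [DecidablePred p] :
    (stdC ι).map (fun z i => if p i then -z i else z i) = stdC ι := by
  refine stdC_map _ (fun z i => if p i then -z i else z i) ?_ (fun t z => ?_) fun t => ?_
  · refine measurable_pi_iff.2 fun i => ?_
    by_cases h : p i <;> simp only [h, if_true, if_false] <;> fun_prop
  · simp only [dotProduct, Pi.star_apply]
    refine Finset.sum_congr rfl fun i _ => ?_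
    by_cases h : p i <;> simp [h]
  · refine Finset.sum_congr rfl fun i _ => ?_
    by_cases h : p i <;> simp [h]

theorem measurable_flip (p : ι → Prop) [DecidablePred p] :
    Measurable fun (z : ι → ℂ) i => if p i then -z i else z i := by
  refine measurable_pi_iff.2 fun i => ?_
  by_cases h : p i <;> simp only [h, if_true, if_false] <;> fun_prop

theorem lintegral_stdC_apply_sq (i : ι) :
    ∫⁻ z, ENNReal.ofReal (‖z i‖ ^ 2) ∂stdC ι = 1 := by
  have := (measurePreserving_eval (fun _ : ι => circularGaussian 1) i).lintegral_comp
    (f := fun z : ℂ => ENNReal.ofReal (‖z‖ ^ 2)) (by fun_prop)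
  rw [lintegral_circularGaussian_sq] at this
  simpa [stdC] using this

theorem memLp_two_of_lintegral {Ω : Type*} [MeasurableSpace Ω] {μ : Measure Ω} {f : Ω → ℂ}
    (hf : AEStronglyMeasurable f μ) {t : ℝ} (h : ∫⁻ ω, ENNReal.ofReal (‖f ω‖ ^ 2) ∂μ
      = ENNReal.ofReal t) : MemLp f 2 μ := by
  refine ⟨hf, ?_⟩
  rw [eLpNorm_lt_top_iff_lintegral_rpow_enorm_lt_top (by norm_num) (by norm_num)]
  have : ∀ ω, ‖f ω‖ₑ ^ (2 : ℝ≥0∞).toReal = ENNReal.ofReal (‖f ω‖ ^ 2) := by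
    intro ω
    rw [ENNReal.ofReal_pow (norm_nonneg _), ofReal_norm]
    norm_num
  simp_rw [this]
  rw [h]
  exact ENNReal.ofReal_lt_top

theorem integral_sq_of_lintegral {Ω : Type*} [MeasurableSpace Ω] {μ : Measure Ω} {f : Ω → ℂ}
    (hf : AEStronglyMeasurable f μ) {t : ℝ} (ht : 0 ≤ t)
    (h : ∫⁻ ω, ENNReal.ofReal (‖f ω‖ ^ 2) ∂μ = ENNReal.ofReal t) : power μ f = t := by
  have hm : AEStronglyMeasurable (fun ω => ‖f ω‖ ^ 2) μ := hf.norm.pow 2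
  unfold power
  rw [integral_eq_lintegral_of_nonneg_ae (Filter.Eventually.of_forall fun _ => by positivity) hm, h, ENNReal.toReal_ofReal ht]

theorem memLp_stdC_apply (i : ι) : MemLp (fun z : ι → ℂ => z i) 2 (stdC ι) :=
  memLp_two_of_lintegral (measurable_pi_apply i).aestronglyMeasurable (t := 1)
    (by rw [lintegral_stdC_apply_sq, ENNReal.ofReal_one])

theorem integral_stdC_apply (i : ι) : ∫ z : ι → ℂ, z i ∂stdC ι = 0 := by
  classical
  have h := integral_comp_of_map_eq (measurable_flip fun _ : ι => True)
    (stdC_map_flip fun _ : ι => True) (measurable_pi_apply i)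
  simp only [if_true] at h
  rw [integral_neg] at h
  exact self_eq_neg.1 h.symm

theorem integral_stdC_mul_star [DecidableEq ι] (i j : ι) :
    ∫ z : ι → ℂ, z i * star (z j) ∂stdC ι = if i = j then 1 else 0 := by
  by_cases hij : i = j
  · subst hij
    rw [if_pos rfl]
    have h := integral_sq_of_lintegral (measurable_pi_apply i).aestronglyMeasurable zero_le_one
      ((lintegral_stdC_apply_sq (ι := ι) i).trans ENNReal.ofReal_one.symm)
    unfold power at h
    have h2 : ∀ z : ι → ℂ, z i * star (z i) = ((‖z i‖ ^ 2 : ℝ) : ℂ) := by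
      intro z
      rw [RCLike.star_def, Complex.mul_conj']
      push_cast
      rfl
    simp_rw [h2]
    rw [integral_complex_ofReal, h, Complex.ofReal_one]
  · rw [if_neg hij]
    have h := integral_comp_of_map_eq (measurable_flip fun l : ι => l = i)
      (stdC_map_flip fun l : ι => l = i) (g := fun z : ι → ℂ => z i * star (z j))
      ((measurable_pi_apply i).mul (continuous_star.measurable.comp (measurable_pi_apply j)))
    simp only [if_true, if_neg (Ne.symm hij), neg_mul] at h
    rw [integral_neg] at h
    exact self_eq_neg.1 h.symm

theorem lintegral_dotProduct_sq (u : ι → ℂ) :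
    ∫⁻ z, ENNReal.ofReal (‖u ⬝ᵥ z‖ ^ 2) ∂stdC ι = ENNReal.ofReal (∑ i, ‖u i‖ ^ 2) := by
  classical
  by_cases hu : u = 0
  · simp [hu]
  have hr : 0 < ∑ i, ‖u i‖ ^ 2 := by
    obtain ⟨j, hj⟩ : ∃ j, u j ≠ 0 := by
      by_contra! h
      exact hu (funext h)
    exact Finset.sum_pos' (fun _ _ => by positivity) ⟨j, Finset.mem_univ _, by positivity⟩
  set r := Real.sqrt (∑ i, ‖u i‖ ^ 2) with hrdef
  have hr0 : 0 < r := Real.sqrt_pos.2 hr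
  have hr2 : r ^ 2 = ∑ i, ‖u i‖ ^ 2 := Real.sq_sqrt hr.le
  have hrc : (r : ℂ) ≠ 0 := by exact_mod_cast hr0.ne'
  -- The normalized form u ⬝ z / ‖u‖ is a single standard Gaussian variable, being the image under a
  -- co-isometry onto a one-dimensional space.
  have h := lintegral_stdC_comp (κ := Unit) (fun z : ι → ℂ => fun _ => (r : ℂ)⁻¹ * (u ⬝ᵥ z))
    (fun t i => (r : ℂ)⁻¹ * star (u i) * t ()) (by unfold dotProduct; fun_prop)
    (fun t z => by
      simp only [dotProduct, Finset.mul_sum, Finset.univ_unique, Finset.sum_singleton, Pi.star_apply,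
        star_mul', star_star, star_inv₀]
      refine Finset.sum_congr rfl fun i _ => ?_
      simp
      ring)
    (fun t => by
      simp only [norm_mul, norm_inv, norm_star, mul_pow, Finset.univ_unique, Finset.sum_singleton,
        Complex.norm_real, Real.norm_eq_abs, abs_of_pos hr0, ← Finset.sum_mul, ← Finset.mul_sum,
        inv_pow, hr2]
      rw [inv_mul_cancel₀ hr.ne', one_mul])
    (fun z => ENNReal.ofReal (‖z ()‖ ^ 2)) (by fun_prop)
  rw [lintegral_stdC_apply_sq] at h
  have e : ∀ z : ι → ℂ, ENNReal.ofReal (‖u ⬝ᵥ z‖ ^ 2)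
      = ENNReal.ofReal (r ^ 2) * ENNReal.ofReal (‖(r : ℂ)⁻¹ * (u ⬝ᵥ z)‖ ^ 2) := by
    intro z
    rw [← ENNReal.ofReal_mul (by positivity), norm_mul, norm_inv, Complex.norm_real,
      Real.norm_eq_abs, abs_of_pos hr0]
    congr 1
    field_simp
  simp_rw [e]
  rw [lintegral_const_mul' _ _ ENNReal.ofReal_ne_top, h, mul_one, hr2]

/-- Second moment of a conditionally Gaussian linear form. -/
theorem lintegral_linear_form_sq (u : (α → ℂ) → β → ℂ) (hu : Measurable u) :
    ∫⁻ z : α ⊕ β → ℂ, ENNReal.ofReal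
        (‖u (fun a => z (Sum.inl a)) ⬝ᵥ (fun b => z (Sum.inr b))‖ ^ 2) ∂stdC (α ⊕ β)
      = ∫⁻ x, ENNReal.ofReal (∑ b, ‖u x b‖ ^ 2) ∂stdC α := by
  classical
  rw [lintegral_stdC_sum]
  · simp only [Sum.elim_inl, Sum.elim_inr]
    exact lintegral_congr fun x => lintegral_dotProduct_sq (u x)
  · refine Measurable.ennreal_ofReal (Measurable.pow_const (Measurable.norm ?_) 2)
    exact measurable_dotProduct (hu.comp (by fun_prop)) (by fun_prop)

theorem measurable_linear_form {u : (α → ℂ) → β → ℂ} (hu : Measurable u) :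
    Measurable fun z : α ⊕ β → ℂ => u (fun a => z (Sum.inl a)) ⬝ᵥ (fun b => z (Sum.inr b)) := by
  classical
  exact measurable_dotProduct (hu.comp (by fun_prop)) (by fun_prop)

/-- Flipping the sign of the second block negates the form. The resulting identity I = -I needs no
integrability of the coefficients. -/
theorem integral_linear_form {u : (α → ℂ) → β → ℂ} (hu : Measurable u) :
    ∫ z : α ⊕ β → ℂ, u (fun a => z (Sum.inl a)) ⬝ᵥ (fun b => z (Sum.inr b)) ∂stdC (α ⊕ β) = 0 := by
  classical
  have h := integral_comp_of_map_eq (measurable_flip fun l : α ⊕ β => l.isRight = true)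
      (stdC_map_flip fun l : α ⊕ β => l.isRight = true) (measurable_linear_form hu)
  simp only [Sum.isRight_inl, Sum.isRight_inr, if_true, Bool.false_eq_true, if_false] at h
  have e : ∀ z : α ⊕ β → ℂ, (u (fun a => z (Sum.inl a)) ⬝ᵥ fun b => -z (Sum.inr b))
      = -(u (fun a => z (Sum.inl a)) ⬝ᵥ fun b => z (Sum.inr b)) := by
    intro z
    simp [dotProduct]
  simp_rw [e] at h
  rw [integral_neg] at h
  exact self_eq_neg.1 h.symm

theorem lintegral_mul_apply_sq (n : (α → ℂ) → ℝ) (hn : Measurable n) (hn0 : ∀ x, 0 ≤ n x) (b : β) :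
    ∫⁻ z : α ⊕ β → ℂ, ENNReal.ofReal (n (fun a => z (Sum.inl a)) * ‖z (Sum.inr b)‖ ^ 2)
        ∂stdC (α ⊕ β) = ∫⁻ x, ENNReal.ofReal (n x) ∂stdC α := by
  rw [lintegral_stdC_sum]
  · simp only [Sum.elim_inl, Sum.elim_inr]
    refine lintegral_congr fun x => ?_
    simp_rw [ENNReal.ofReal_mul (hn0 x)]
    rw [lintegral_const_mul' _ _ ENNReal.ofReal_ne_top, lintegral_stdC_apply_sq, mul_one]
  · have : Measurable fun z : α ⊕ β → ℂ => n (fun a => z (Sum.inl a)) := hn.comp (by fun_prop)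
    fun_prop

end moments

/-! ### From the primitive variables to independent estimates and errors. -/

section model
variable {M K τ : ℕ}

/-- Index set of the primitive random variables. -/
abbrev SourceIdx (M K τ : ℕ) := (Fin M × Fin K) ⊕ ((Fin M × Fin τ) ⊕ (Fin M ⊕ Fin K))

/-- Index set of the transformed variables: estimates and symbols, then errors and noise. -/
abbrev MixIdx (M K : ℕ) := ((Fin M × Fin K) ⊕ Fin K) ⊕ ((Fin M × Fin K) ⊕ Fin M)

/-- Rotation of channels and projected pilot noise into estimates and estimation errors. -/
def mix (Q : Matrix (Fin τ) (Fin K) ℂ) (a b : Fin K → ℝ) (u : Fin M → ℂ)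
    (z : SourceIdx M K τ → ℂ) : MixIdx M K → ℂ :=
  Sum.elim
    (Sum.elim
      (fun q => (a q.2 : ℂ) * z (Sum.inl q)
        + (b q.2 : ℂ) * (u q.1 * ∑ t, Q t q.2 * z (Sum.inr (Sum.inl (q.1, t)))))
      (fun k => z (Sum.inr (Sum.inr (Sum.inr k)))))
    (Sum.elim
      (fun q => (b q.2 : ℂ) * z (Sum.inl q)
        - (a q.2 : ℂ) * (u q.1 * ∑ t, Q t q.2 * z (Sum.inr (Sum.inl (q.1, t)))))
      (fun m => z (Sum.inr (Sum.inr (Sum.inl m)))))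

/-- Adjoint of `mix`. -/
def mixAdj (Q : Matrix (Fin τ) (Fin K) ℂ) (a b : Fin K → ℝ) (u : Fin M → ℂ)
    (t : MixIdx M K → ℂ) : SourceIdx M K τ → ℂ :=
  Sum.elim
    (fun q => (a q.2 : ℂ) * t (Sum.inl (Sum.inl q)) + (b q.2 : ℂ) * t (Sum.inr (Sum.inl q)))
    (Sum.elim
      (fun q => star ((Q *ᵥ fun k => u q.1 * ((b k : ℂ) * star (t (Sum.inl (Sum.inl (q.1, k))))
        - (a k : ℂ) * star (t (Sum.inr (Sum.inl (q.1, k)))))) q.2))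
      (Sum.elim (fun m => t (Sum.inr (Sum.inr m))) (fun k => t (Sum.inl (Sum.inr k)))))

theorem measurable_mix (Q : Matrix (Fin τ) (Fin K) ℂ) (a b : Fin K → ℝ) (u : Fin M → ℂ) :
    Measurable (mix Q a b u) := by
  refine measurable_pi_iff.2 fun i => ?_
  rcases i with (i | i) | (i | i) <;> simp only [mix, Sum.elim_inl, Sum.elim_inr] <;> fun_prop

theorem sum_norm_sq_mulVec {Q : Matrix (Fin τ) (Fin K) ℂ} (hQ : Qᴴ * Q = 1) (y : Fin K → ℂ) :
    ∑ t, ‖(Q *ᵥ y) t‖ ^ 2 = ∑ k, ‖y k‖ ^ 2 := by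
  have h : star (Q *ᵥ y) ⬝ᵥ (Q *ᵥ y) = star y ⬝ᵥ y := by
    rw [star_mulVec, ← dotProduct_mulVec, mulVec_mulVec, hQ, one_mulVec]
  rw [star_dotProduct_self, star_dotProduct_self] at h
  exact_mod_cast h

/-- Symbols and data noise are merely permuted by `mix`; this regrouping leaves only the channel and
pilot-noise blocks to be matched. -/
theorem add_add_eq_of_add_eq {S : Type*} [CommRing S] {x y z w a b : S} (h : x + z = a + b) :
    x + y + (z + w) = a + (b + (w + y)) := by
  linear_combination h

/-- Orthonormal pilots and unimodular phases make the projected pilot noise standard Gaussian,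
independent of the channels, and each pair (channel, noise) then undergoes the orthogonal
transformation with rows (a, b) and (b, -a). The adjoint is thus an isometry, as `stdC_map`
requires. -/
theorem stdC_map_mix {Q : Matrix (Fin τ) (Fin K) ℂ} (hQ : Qᴴ * Q = 1) {a b : Fin K → ℝ}
    {u : Fin M → ℂ} (hab : ∀ k, a k ^ 2 + b k ^ 2 = 1) (hu : ∀ m, ‖u m‖ = 1) :
    (stdC (SourceIdx M K τ)).map (mix Q a b u) = stdC (MixIdx M K) := by
  refine stdC_map _ (mixAdj Q a b u) (measurable_mix Q a b u) (fun t z => ?_) fun t => ?_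
  · simp only [dotProduct, Fintype.sum_sum_type, mix, mixAdj, Sum.elim_inl, Sum.elim_inr,
      Pi.star_apply, star_star]
    have h1 : ∑ q : Fin M × Fin τ, (Q *ᵥ fun k => u q.1 * ((b k : ℂ) *
          star (t (Sum.inl (Sum.inl (q.1, k)))) - (a k : ℂ) *
          star (t (Sum.inr (Sum.inl (q.1, k)))))) q.2 * z (Sum.inr (Sum.inl q))
        = ∑ q : Fin M × Fin K, ((b q.2 : ℂ) * star (t (Sum.inl (Sum.inl q))) - (a q.2 : ℂ) *
          star (t (Sum.inr (Sum.inl q)))) *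
          (u q.1 * ∑ s, Q s q.2 * z (Sum.inr (Sum.inl (q.1, s)))) := by
      rw [Fintype.sum_prod_type, Fintype.sum_prod_type]
      refine Finset.sum_congr rfl fun m _ => ?_
      simp only [mulVec, dotProduct, Finset.sum_mul, Finset.mul_sum]
      rw [Finset.sum_comm]
      refine Finset.sum_congr rfl fun k _ => Finset.sum_congr rfl fun s _ => ?_
      ring
    rw [h1]
    refine add_add_eq_of_add_eq (S := ℂ) ?_
    rw [← Finset.sum_add_distrib, ← Finset.sum_add_distrib]
    refine Finset.sum_congr rfl fun q _ => ?_
    simp only [star_add, star_mul', RCLike.star_def, Complex.conj_ofReal]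
    ring
  · simp only [Fintype.sum_sum_type, mixAdj, Sum.elim_inl, Sum.elim_inr, norm_star]
    have h1 : ∑ q : Fin M × Fin τ, ‖(Q *ᵥ fun k => u q.1 * ((b k : ℂ) *
          star (t (Sum.inl (Sum.inl (q.1, k)))) - (a k : ℂ) *
          star (t (Sum.inr (Sum.inl (q.1, k)))))) q.2‖ ^ 2
        = ∑ q : Fin M × Fin K, ‖(b q.2 : ℂ) * t (Sum.inl (Sum.inl q)) - (a q.2 : ℂ) *
          t (Sum.inr (Sum.inl q))‖ ^ 2 := by
      rw [Fintype.sum_prod_type, Fintype.sum_prod_type]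
      refine Finset.sum_congr rfl fun m _ => ?_
      simp only
      rw [sum_norm_sq_mulVec hQ]
      refine Finset.sum_congr rfl fun k _ => ?_
      rw [norm_mul, hu, one_mul, ← norm_star]
      simp
    rw [h1]
    refine (add_add_eq_of_add_eq (S := ℝ) (Eq.symm ?_)).symm
    rw [← Finset.sum_add_distrib, ← Finset.sum_add_distrib]
    refine Finset.sum_congr rfl fun q _ => ?_
    have h := hab q.2
    simp only [← Complex.normSq_eq_norm_sq, Complex.normSq_apply, Complex.add_re, Complex.add_im,
      Complex.sub_re, Complex.sub_im, Complex.mul_re, Complex.mul_im, Complex.ofReal_re,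
      Complex.ofReal_im, zero_mul, sub_zero, add_zero]
    linear_combination ((t (Sum.inl (Sum.inl q))).re ^ 2 + (t (Sum.inl (Sum.inl q))).im ^ 2 +
      (t (Sum.inr (Sum.inl q))).re ^ 2 + (t (Sum.inr (Sum.inl q))).im ^ 2) * h

variable {p : Params M K τ} {Ω : Type*} [MeasurableSpace Ω] {P : Measure Ω}

/-- Normalization of the primitive variables to unit variance. -/
def Params.normalize (p : Params M K τ) : SourceIdx M K τ → ℝ :=
  Sum.elim (fun _ => 1) (Sum.elim (fun _ => p.σ⁻¹) (Sum.elim (fun _ => p.σ⁻¹) fun _ => 1))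

/-- The primitive random variables as one family. -/
def Model.source (X : Model p P) : SourceIdx M K τ → Ω → ℂ :=
  Sum.elim (fun i => X.hTilde i.1 i.2) (Sum.elim (fun i => X.W i.1 i.2) (Sum.elim X.w X.s))

/-- The primitive random variables, normalized to unit variance. -/
def Model.stdSource (X : Model p P) (ω : Ω) : SourceIdx M K τ → ℂ :=
  fun i => (p.normalize i : ℂ) * X.source i ω

theorem circularGaussian_map_inv {σ : ℝ} (hσ : 0 < σ) :
    (circularGaussian (σ ^ 2).toNNReal).map (fun z => ((σ⁻¹ : ℝ) : ℂ) * z) = circularGaussian 1 := by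
  rw [← circularGaussian_map_mul, Measure.map_map (by fun_prop) (by fun_prop)]
  convert Measure.map_id using 2
  ext z
  have : (σ : ℂ) ≠ 0 := by exact_mod_cast hσ.ne'
  simp [this]

theorem Model.hasLaw_stdSource (X : Model p P) (i : SourceIdx M K τ) :
    HasLaw (fun ω => X.stdSource ω i) (circularGaussian 1) P := by
  have key : ∀ {Z : Ω → ℂ}, HasLaw Z (circularGaussian (p.σ ^ 2).toNNReal) P →
      HasLaw (fun ω => ((p.σ⁻¹ : ℝ) : ℂ) * Z ω) (circularGaussian 1) P := by
    intro Z hZ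
    refine ⟨by have := hZ.aemeasurable; fun_prop, ?_⟩
    have h := circularGaussian_map_inv p.σ_pos
    rw [← hZ.map_eq, AEMeasurable.map_map_of_aemeasurable (by fun_prop) hZ.aemeasurable] at h
    exact h
  rcases i with q | q | m | k <;>
    simp only [Model.stdSource, Params.normalize, Model.source, Sum.elim_inl, Sum.elim_inr,
      Complex.ofReal_one, one_mul]
  · exact X.law_hTilde _ _
  · exact key (X.law_W _ _)
  · exact key (X.law_w _)
  · exact X.law_s _

theorem Model.aemeasurable_stdSource (X : Model p P) : AEMeasurable X.stdSource P :=
  aemeasurable_pi_iff.2 fun i => (X.hasLaw_stdSource i).aemeasurable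

theorem Model.map_stdSource (X : Model p P) : P.map X.stdSource = stdC (SourceIdx M K τ) := by
  have h : iIndepFun (fun i ω => X.stdSource ω i) P :=
    X.indep.comp (fun i z => (p.normalize i : ℂ) * z) fun i => by fun_prop
  have hp := h.isProbabilityMeasure
  rw [iIndepFun_iff_map_fun_eq_pi_map fun i => (X.hasLaw_stdSource i).aemeasurable] at h
  change P.map (fun ω i => X.stdSource ω i) = _
  rw [h]
  unfold stdC
  congr 1
  ext i : 1
  exact (X.hasLaw_stdSource i).map_eq

end model


/-! ### The MMSE estimate in terms of the rotated variables. -/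

section estimates
variable {M K τ : ℕ} (p : Params M K τ)

theorem Params.tau_pos {M K τ : ℕ} (p : Params M K τ) (k : Fin K) : 0 < τ := by
  rcases Nat.eq_zero_or_pos τ with h | h
  · exfalso
    have h1 := congrFun (congrFun p.Q_orthonormal k) k
    have : IsEmpty (Fin τ) := by rw [h]; infer_instance
    simp [Matrix.mul_apply] at h1
  · exact h

theorem Params.α_pos (k : Fin K) : 0 < p.α k :=
  div_pos (p.β_pos k) (by linarith [p.δ_nonneg k])

theorem Params.snr_pos (k : Fin K) : 0 < p.ρ * τ * p.pPilot k * p.α k * ‖p.Φ‖ ^ 2 := by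
  have h1 := p.ρ_pos
  have h2 : (0 : ℝ) < τ := by exact_mod_cast p.tau_pos k
  have h3 := p.pPilot_pos k
  have h4 := p.α_pos k
  have h5 := norm_pos_iff.2 p.Φ_ne_zero
  positivity

theorem Params.μ_pos (k : Fin K) : 0 < p.μ k :=
  div_pos (p.snr_pos k) (add_pos (p.snr_pos k) (pow_pos p.σ_pos 2))

theorem Params.μ_lt_one (k : Fin K) : p.μ k < 1 :=
  (div_lt_one (add_pos (p.snr_pos k) (pow_pos p.σ_pos 2))).2 (by linarith [pow_pos p.σ_pos 2])

theorem Params.error_pos (k : Fin K) : 0 < p.α k - p.μ k * p.α k := by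
  nlinarith [p.α_pos k, p.μ_lt_one k]

theorem Params.sqrt_error (k : Fin K) :
    Real.sqrt (p.α k - p.μ k * p.α k) = Real.sqrt (1 - p.μ k) * Real.sqrt (p.α k) := by
  rw [← Real.sqrt_mul (by linarith [p.μ_lt_one k])]
  congr 1
  ring

theorem Params.sqrt_estimate (k : Fin K) :
    Real.sqrt (p.μ k * p.α k) = Real.sqrt (p.μ k) * Real.sqrt (p.α k) :=
  Real.sqrt_mul (p.μ_pos k).le _

/-- Balance between the pilot signal and the pilot noise. -/
theorem Params.sqrt_snr (k : Fin K) :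
    Real.sqrt p.ρ * Real.sqrt (τ * p.pPilot k) * Real.sqrt (p.α k) * ‖p.Φ‖ * Real.sqrt (1 - p.μ k)
      = p.σ * Real.sqrt (p.μ k) := by
  have hs := p.σ_pos
  have h2 : (0 : ℝ) ≤ τ * p.pPilot k := mul_nonneg (Nat.cast_nonneg _) (p.pPilot_pos k).le
  rw [← sq_eq_sq₀ (by positivity) (by positivity)]
  simp only [mul_pow]
  rw [Real.sq_sqrt p.ρ_pos.le, Real.sq_sqrt h2, Real.sq_sqrt (p.α_pos k).le,
    Real.sq_sqrt (by linarith [p.μ_lt_one k]), Real.sq_sqrt (p.μ_pos k).le]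
  have h3 := p.snr_pos k
  unfold Params.μ
  have h4 : p.ρ * τ * p.pPilot k * p.α k * ‖p.Φ‖ ^ 2 + p.σ ^ 2 ≠ 0 := by positivity
  field_simp
  ring

theorem Params.norm_D (m : Fin M) : ‖p.D m m‖ = 1 := by
  rw [Params.D, diagonal_apply_eq, neg_mul, mul_comm, ← neg_mul, ← Complex.ofReal_neg,
    Complex.norm_exp_ofReal_mul_I]

theorem Params.D_eq : p.D = diagonal fun m => p.D m m := by
  ext i j
  by_cases h : i = j
  · subst h; simp
  · simp [Params.D, h]

theorem Params.D_conjTranspose_mul : p.Dᴴ * p.D = 1 := by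
  rw [p.D_eq, diagonal_conjTranspose, diagonal_mul_diagonal, ← diagonal_one]
  congr 1
  ext m
  rw [Pi.star_apply, RCLike.star_def, Complex.conj_mul', p.norm_D]
  simp

/-- Conjugate phase of the pilot gain at a cell. -/
def Params.phase (m : Fin M) : ℂ := star (p.Φ * p.D m m) / (‖p.Φ‖ : ℂ)

theorem Params.norm_phase (m : Fin M) : ‖p.phase m‖ = 1 := by
  have := norm_pos_iff.2 p.Φ_ne_zero
  rw [Params.phase, norm_div, norm_star, norm_mul, p.norm_D, mul_one, Complex.norm_real, norm_norm,
    div_self this.ne']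

/-- Gain of a normalized estimate in the projected pilot observation. -/
def Params.pilotGain (k : Fin K) (m : Fin M) : ℂ :=
  ((Real.sqrt p.ρ : ℝ) : ℂ) * p.Φ * ((Real.sqrt (τ * p.pPilot k) : ℝ) : ℂ) * p.D m m *
    ((Real.sqrt (p.α k) : ℝ) : ℂ) / ((Real.sqrt (p.μ k) : ℝ) : ℂ)

theorem Params.sqrt_μ_ne_zero (k : Fin K) : ((Real.sqrt (p.μ k) : ℝ) : ℂ) ≠ 0 := by
  exact_mod_cast (Real.sqrt_pos.2 (p.μ_pos k)).ne'

theorem Params.pilotGain_mul_sqrt (k : Fin K) (m : Fin M) :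
    p.pilotGain k m * ((Real.sqrt (p.μ k) : ℝ) : ℂ) = ((Real.sqrt p.ρ : ℝ) : ℂ) * p.Φ *
      ((Real.sqrt (τ * p.pPilot k) : ℝ) : ℂ) * p.D m m * ((Real.sqrt (p.α k) : ℝ) : ℂ) :=
  div_mul_cancel₀ _ (p.sqrt_μ_ne_zero k)

/-- The weights √μ and √(1-μ) are in the ratio of signal to noise amplitude in the pilot
observation, and the phase cancels that of Φ D. So one gain reproduces both the channel term and,
once σ undoes the normalization, the noise term. -/
theorem Params.pilotGain_mul_phase (k : Fin K) (m : Fin M) :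
    p.pilotGain k m * (((Real.sqrt (1 - p.μ k) : ℝ) : ℂ) * p.phase m) = p.σ := by
  have hΦ : (‖p.Φ‖ : ℂ) ≠ 0 := by exact_mod_cast (norm_pos_iff.2 p.Φ_ne_zero).ne'
  have h1 : p.Φ * p.D m m * star (p.Φ * p.D m m) = (‖p.Φ‖ : ℂ) ^ 2 := by
    rw [RCLike.star_def, Complex.mul_conj', norm_mul, p.norm_D, mul_one]
  have h2 : ((Real.sqrt p.ρ : ℝ) : ℂ) * ((Real.sqrt (τ * p.pPilot k) : ℝ) : ℂ) *
      ((Real.sqrt (p.α k) : ℝ) : ℂ) * (‖p.Φ‖ : ℂ) * ((Real.sqrt (1 - p.μ k) : ℝ) : ℂ)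
      = p.σ * ((Real.sqrt (p.μ k) : ℝ) : ℂ) := by exact_mod_cast p.sqrt_snr k
  refine mul_right_cancel₀ (p.sqrt_μ_ne_zero k) ?_
  rw [← h2, mul_right_comm, p.pilotGain_mul_sqrt, Params.phase]
  field_simp
  linear_combination (((Real.sqrt p.ρ : ℝ) : ℂ) * ((Real.sqrt (τ * p.pPilot k) : ℝ) : ℂ) *
      ((Real.sqrt (p.α k) : ℝ) : ℂ) * ((Real.sqrt (1 - p.μ k) : ℝ) : ℂ)) * h1

theorem Params.pilotGain_ne_zero (k : Fin K) (m : Fin M) : p.pilotGain k m ≠ 0 := by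
  intro h
  have := p.pilotGain_mul_phase k m
  rw [h, zero_mul] at this
  exact p.σ_pos.ne' (by exact_mod_cast this.symm)

variable {p} {Ω : Type*} [MeasurableSpace Ω] {P : Measure Ω} (X : Model p P)

/-- Normalized estimates, symbols, normalized estimation errors and normalized noise. -/
def Model.mixed (ω : Ω) : MixIdx M K → ℂ :=
  mix p.Q (fun k => Real.sqrt (p.μ k)) (fun k => Real.sqrt (1 - p.μ k)) p.phase (X.stdSource ω)

theorem Model.aemeasurable_mixed : AEMeasurable X.mixed P :=
  (measurable_mix _ _ _ _).comp_aemeasurable X.aemeasurable_stdSource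

theorem Model.map_mixed : P.map X.mixed = stdC (MixIdx M K) := by
  rw [← stdC_map_mix p.Q_orthonormal (a := fun k => Real.sqrt (p.μ k))
    (b := fun k => Real.sqrt (1 - p.μ k)) (u := p.phase) (fun k => ?_) p.norm_phase,
    ← X.map_stdSource, AEMeasurable.map_map_of_aemeasurable (measurable_mix _ _ _ _).aemeasurable
      X.aemeasurable_stdSource]
  · rfl
  · rw [Real.sq_sqrt (p.μ_pos k).le, Real.sq_sqrt (by linarith [p.μ_lt_one k])]
    ring

/-- Normalized estimates. -/
def Model.est (ω : Ω) : Fin M × Fin K → ℂ := fun q => X.mixed ω (Sum.inl (Sum.inl q))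

/-- Normalized estimation errors. -/
def Model.err (ω : Ω) : Fin M × Fin K → ℂ := fun q => X.mixed ω (Sum.inr (Sum.inl q))

theorem Model.est_apply (m : Fin M) (k : Fin K) (ω : Ω) : X.est ω (m, k) =
    ((Real.sqrt (p.μ k) : ℝ) : ℂ) * X.hTilde m k ω + ((Real.sqrt (1 - p.μ k) : ℝ) : ℂ) *
      (p.phase m * ∑ t, p.Q t k * (((p.σ⁻¹ : ℝ) : ℂ) * X.W m t ω)) := by
  simp [Model.est, Model.mixed, mix, Model.stdSource, Params.normalize, Model.source]

theorem Model.err_apply (m : Fin M) (k : Fin K) (ω : Ω) : X.err ω (m, k) =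
    ((Real.sqrt (1 - p.μ k) : ℝ) : ℂ) * X.hTilde m k ω - ((Real.sqrt (p.μ k) : ℝ) : ℂ) *
      (p.phase m * ∑ t, p.Q t k * (((p.σ⁻¹ : ℝ) : ℂ) * X.W m t ω)) := by
  simp [Model.err, Model.mixed, mix, Model.stdSource, Params.normalize, Model.source]

theorem Model.mixed_s (k : Fin K) (ω : Ω) : X.mixed ω (Sum.inl (Sum.inr k)) = X.s k ω := by
  simp [Model.mixed, mix, Model.stdSource, Params.normalize, Model.source]

theorem Model.mixed_w (m : Fin M) (ω : Ω) :
    (p.σ : ℂ) * X.mixed ω (Sum.inr (Sum.inr m)) = X.w m ω := by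
  have : (p.σ : ℂ) ≠ 0 := by exact_mod_cast p.σ_pos.ne'
  simp [Model.mixed, mix, Model.stdSource, Params.normalize, Model.source, this]

theorem Model.nlos_eq (m : Fin M) (k : Fin K) (ω : Ω) : X.nlos k ω m =
    ((Real.sqrt (p.μ k * p.α k) : ℝ) : ℂ) * X.est ω (m, k) +
      ((Real.sqrt (p.α k - p.μ k * p.α k) : ℝ) : ℂ) * X.err ω (m, k) := by
  have h : ((Real.sqrt (p.μ k) : ℝ) : ℂ) ^ 2 + ((Real.sqrt (1 - p.μ k) : ℝ) : ℂ) ^ 2 = 1 := by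
    rw [← Complex.ofReal_pow, ← Complex.ofReal_pow, Real.sq_sqrt (p.μ_pos k).le,
      Real.sq_sqrt (by linarith [p.μ_lt_one k])]
    push_cast
    ring
  rw [X.est_apply, X.err_apply, p.sqrt_error, p.sqrt_estimate, Model.nlos, ← Params.α]
  push_cast
  linear_combination (-((Real.sqrt (p.α k) : ℝ) : ℂ) * X.hTilde m k ω) * h

/-- Deterministic part of the projected pilot observation. -/
def Params.pilotMean (p : Params M K τ) (k : Fin K) (m : Fin M) : ℂ :=
  ((Real.sqrt p.ρ : ℝ) : ℂ) * p.Φ * p.D m m * ((Real.sqrt (τ * p.pPilot k) : ℝ) : ℂ) *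
    (((Real.sqrt (p.β k * p.δ k / (p.δ k + 1)) : ℝ) : ℂ) * p.hBar k m)

/-- The centred observation is a nonzero scalar multiple of the normalized estimate, cell by cell.
It carries no trace of `Model.err`. -/
theorem Model.y_eq (m : Fin M) (k : Fin K) (ω : Ω) :
    X.y k ω m = p.pilotMean k m + p.pilotGain k m * X.est ω (m, k) := by
  have hs : (p.σ : ℂ) ≠ 0 := by exact_mod_cast p.σ_pos.ne'
  have e1 : X.y k ω m = ((((Real.sqrt p.ρ : ℝ) : ℂ) * p.Φ) •
      (p.D * X.H ω * p.pilotEnergy * p.Qᴴ * p.Q)) m k + ∑ t, X.W m t ω * p.Q t k := by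
    change ((X.Y ω) * p.Q) m k = _
    rw [Model.Y, Matrix.add_mul, Matrix.smul_mul, Matrix.add_apply]
    rfl
  have e2 : (p.D * X.H ω * p.pilotEnergy) m k = p.D m m * X.h k ω m *
      ((Real.sqrt (τ * p.pPilot k) : ℝ) : ℂ) := by
    rw [Params.pilotEnergy, mul_diagonal, p.D_eq, diagonal_mul, diagonal_apply_eq]
    rfl
  rw [e1, Matrix.mul_assoc, p.Q_orthonormal, Matrix.mul_one, Matrix.smul_apply, e2, X.est_apply, mul_add,
    ← mul_assoc, p.pilotGain_mul_sqrt, ← mul_assoc ((Real.sqrt (1 - p.μ k) : ℝ) : ℂ), ← mul_assoc,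
    p.pilotGain_mul_phase, Finset.mul_sum]
  have e3 : ∑ t, (p.σ : ℂ) * (p.Q t k * (((p.σ⁻¹ : ℝ) : ℂ) * X.W m t ω))
      = ∑ t, X.W m t ω * p.Q t k := by
    refine Finset.sum_congr rfl fun t _ => ?_
    push_cast
    field_simp
  rw [e3, ← add_assoc]
  congr 1
  simp only [Model.h, Pi.add_apply, Pi.smul_apply, smul_eq_mul, Params.pilotMean, Model.nlos,
    Params.α]
  ring

theorem Model.integral_mixed (i : MixIdx M K) : ∫ ω, X.mixed ω i ∂P = 0 := by
  have h := integral_stdC_apply i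
  rw [← X.map_mixed, integral_map X.aemeasurable_mixed
    (measurable_pi_apply i).aestronglyMeasurable] at h
  exact h

theorem Model.memLp_mixed (i : MixIdx M K) : MemLp (fun ω => X.mixed ω i) 2 P := by
  have h := memLp_stdC_apply i
  rw [← X.map_mixed, memLp_map_measure_iff (measurable_pi_apply i).aestronglyMeasurable
    X.aemeasurable_mixed] at h
  exact h

theorem Model.integral_mixed_mul_star (i j : MixIdx M K) :
    ∫ ω, X.mixed ω i * star (X.mixed ω j) ∂P = if i = j then 1 else 0 := by
  have h := integral_stdC_mul_star i j
  have hm : Measurable fun z : MixIdx M K → ℂ => z i * star (z j) :=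
    (measurable_pi_apply i).mul (continuous_star.measurable.comp (measurable_pi_apply j))
  rw [← X.map_mixed, integral_map X.aemeasurable_mixed hm.aestronglyMeasurable] at h
  exact h

theorem Model.integrable_mixed_mul_star (i j : MixIdx M K) :
    Integrable (fun ω => X.mixed ω i * star (X.mixed ω j)) P :=
  (X.memLp_mixed i).integrable_mul (X.memLp_mixed j).star

variable [IsProbabilityMeasure P]

theorem Model.integrable_mixed (i : MixIdx M K) : Integrable (fun ω => X.mixed ω i) P :=
  (X.memLp_mixed i).integrable (by norm_num)

theorem Model.meanVec_nlos (k : Fin K) : meanVec P (X.nlos k) = 0 := by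
  ext m
  simp only [meanVec, X.nlos_eq, Model.est, Model.err]
  rw [integral_add ((X.integrable_mixed _).const_mul _) ((X.integrable_mixed _).const_mul _),
    integral_const_mul, integral_const_mul, X.integral_mixed, X.integral_mixed]
  simp

theorem Model.meanVec_y (k : Fin K) : meanVec P (X.y k) = p.pilotMean k := by
  ext m
  simp only [meanVec, X.y_eq, Model.est]
  rw [integral_add (integrable_const _) ((X.integrable_mixed _).const_mul _), integral_const_mul,
    X.integral_mixed]
  simp

theorem Model.cov_nlos_y (k : Fin K) : cov P (X.nlos k) (X.y k) =
    diagonal fun m => ((Real.sqrt (p.μ k * p.α k) : ℝ) : ℂ) * star (p.pilotGain k m) := by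
  ext i j
  simp only [cov, X.meanVec_nlos, X.meanVec_y, of_apply, Pi.zero_apply, sub_zero, X.y_eq,
    X.nlos_eq, add_sub_cancel_left]
  have e : ∀ ω, (((Real.sqrt (p.μ k * p.α k) : ℝ) : ℂ) * X.est ω (i, k) +
      ((Real.sqrt (p.α k - p.μ k * p.α k) : ℝ) : ℂ) * X.err ω (i, k)) *
      star (p.pilotGain k j * X.est ω (j, k))
      = ((Real.sqrt (p.μ k * p.α k) : ℝ) : ℂ) * star (p.pilotGain k j) *
          (X.mixed ω (Sum.inl (Sum.inl (i, k))) * star (X.mixed ω (Sum.inl (Sum.inl (j, k)))))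
        + ((Real.sqrt (p.α k - p.μ k * p.α k) : ℝ) : ℂ) * star (p.pilotGain k j) *
          (X.mixed ω (Sum.inr (Sum.inl (i, k))) * star (X.mixed ω (Sum.inl (Sum.inl (j, k))))) := by
    intro ω
    rw [star_mul']
    unfold Model.est Model.err
    ring
  simp_rw [e]
  rw [integral_add ((X.integrable_mixed_mul_star _ _).const_mul _)
    ((X.integrable_mixed_mul_star _ _).const_mul _), integral_const_mul, integral_const_mul,
    X.integral_mixed_mul_star, X.integral_mixed_mul_star]
  by_cases h : i = j
  · subst h; simp
  · simp [h]

theorem Model.cov_y_y (k : Fin K) : cov P (X.y k) (X.y k) =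
    diagonal fun m => p.pilotGain k m * star (p.pilotGain k m) := by
  ext i j
  simp only [cov, X.meanVec_y, of_apply, X.y_eq, add_sub_cancel_left]
  have e : ∀ ω, p.pilotGain k i * X.est ω (i, k) * star (p.pilotGain k j * X.est ω (j, k))
      = p.pilotGain k i * star (p.pilotGain k j) *
          (X.mixed ω (Sum.inl (Sum.inl (i, k))) * star (X.mixed ω (Sum.inl (Sum.inl (j, k))))) := by
    intro ω
    rw [star_mul']
    unfold Model.est
    ring
  simp_rw [e]
  rw [integral_const_mul, X.integral_mixed_mul_star]
  by_cases h : i = j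
  · subst h; simp
  · simp [h]

/-- Both covariances are diagonal, so the MMSE filter just divides out the pilot gain and replaces
it by √(μ α). The part of the channel along `Model.err` is uncorrelated with the observation and
contributes nothing. -/
theorem Model.hHat_eq (k : Fin K) (ω : Ω) (m : Fin M) : X.hHat k ω m =
    ((Real.sqrt (p.β k * p.δ k / (p.δ k + 1)) : ℝ) : ℂ) * p.hBar k m +
      ((Real.sqrt (p.μ k * p.α k) : ℝ) : ℂ) * X.est ω (m, k) := by
  have hi : (cov P (X.y k) (X.y k))⁻¹
      = diagonal fun m => (p.pilotGain k m * star (p.pilotGain k m))⁻¹ := by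
    refine inv_eq_right_inv ?_
    rw [X.cov_y_y, diagonal_mul_diagonal, ← diagonal_one]
    congr 1
    ext m
    exact mul_inv_cancel₀ (mul_ne_zero (p.pilotGain_ne_zero k m)
      (star_ne_zero.2 (p.pilotGain_ne_zero k m)))
  rw [Model.hHat, hi, X.cov_nlos_y, diagonal_mul_diagonal, Pi.add_apply, Pi.smul_apply,
    mulVec_diagonal, Pi.sub_apply, X.meanVec_y, X.y_eq, add_sub_cancel_left, smul_eq_mul]
  congr 1
  have h1 := p.pilotGain_ne_zero k m
  have h2 := star_ne_zero.2 h1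
  field_simp

/-- Estimated channel matrix as a function of the normalized estimates. -/
def Params.channel (p : Params M K τ) (z : Fin M × Fin K → ℂ) : Matrix (Fin M) (Fin K) ℂ :=
  p.HBar + mat z * diagonal fun j => ((Real.sqrt (p.μ j * p.α j) : ℝ) : ℂ)

theorem Model.HHat_eq (ω : Ω) : X.HHat ω = p.channel (X.est ω) := by
  ext m k
  rw [Model.HHat, of_apply, X.hHat_eq, Params.channel, Matrix.add_apply, mul_diagonal, Params.HBar,
    of_apply, mat, of_apply, show p.β k * p.δ k / (p.δ k + 1) = p.δ k * p.α k by
      unfold Params.α; ring, mul_comm (X.est ω (m, k))]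

theorem Model.h_eq (k : Fin K) (ω : Ω) (m : Fin M) : X.h k ω m = X.HHat ω m k +
    ((Real.sqrt (p.α k - p.μ k * p.α k) : ℝ) : ℂ) * X.err ω (m, k) := by
  rw [Model.HHat, of_apply, X.hHat_eq, Model.h, Pi.add_apply, Pi.smul_apply, X.nlos_eq, smul_eq_mul,
    add_assoc]

end estimates


/-! ### Forms linear in the errors and noise, with coefficients given by the estimates. -/

section conditional
variable {α β κ : Type*} [Fintype α] [Fintype β] [Fintype κ] {Ω : Type*} [MeasurableSpace Ω]
  {P : Measure Ω} {V : Ω → (α ⊕ κ) ⊕ β → ℂ}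

theorem lintegral_comp_of_map_eq {ι : Type*} [Fintype ι] {V : Ω → ι → ℂ} (hV : AEMeasurable V P)
    (hm : P.map V = stdC ι) {F : (ι → ℂ) → ℝ≥0∞} (hF : Measurable F) :
    ∫⁻ ω, F (V ω) ∂P = ∫⁻ z, F z ∂stdC ι := by
  rw [← hm, lintegral_map' hF.aemeasurable hV]

theorem lintegral_ofReal_sum_sq {g : (α → ℂ) → β → ℂ}
    (hi : Integrable (fun x => ∑ b, ‖g x b‖ ^ 2) (stdC α)) :
    ∫⁻ x, ENNReal.ofReal (∑ b, ‖g x b‖ ^ 2) ∂stdC α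
      = ENNReal.ofReal (∫ x, ∑ b, ‖g x b‖ ^ 2 ∂stdC α) :=
  (ofReal_integral_eq_lintegral_ofReal hi
    (Filter.Eventually.of_forall fun _ => by positivity)).symm

theorem measurable_inl_comp {g : (α → ℂ) → β → ℂ} (hg : Measurable g) :
    Measurable fun x : α ⊕ κ → ℂ => g fun a => x (Sum.inl a) := hg.comp (by fun_prop)

theorem measurable_sum_sq {g : (α → ℂ) → β → ℂ} (hg : Measurable g) :
    Measurable fun x => ∑ b, ‖g x b‖ ^ 2 := by fun_prop

/-- The form `g(ζ) ⬝ ε` of a family split into `ζ`, symbols and `ε`. -/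
def form (V : Ω → (α ⊕ κ) ⊕ β → ℂ) (g : (α → ℂ) → β → ℂ) (ω : Ω) : ℂ :=
  g (fun a => V ω (Sum.inl (Sum.inl a))) ⬝ᵥ fun b => V ω (Sum.inr b)

theorem aemeasurable_form (hV : AEMeasurable V P) {g : (α → ℂ) → β → ℂ} (hg : Measurable g) :
    AEMeasurable (form V g) P :=
  (measurable_linear_form (measurable_inl_comp (κ := κ) hg)).comp_aemeasurable hV

theorem aemeasurable_symbol_mul_form (hV : AEMeasurable V P) {g : (α → ℂ) → β → ℂ}
    (hg : Measurable g) (s : κ) :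
    AEMeasurable (fun ω => V ω (Sum.inl (Sum.inr s)) * form V g ω) P :=
  ((measurable_pi_apply _).comp_aemeasurable hV).mul (aemeasurable_form hV hg)

theorem lintegral_form_sq (hV : AEMeasurable V P) (hm : P.map V = stdC ((α ⊕ κ) ⊕ β))
    {g : (α → ℂ) → β → ℂ} (hg : Measurable g)
    (hi : Integrable (fun x => ∑ b, ‖g x b‖ ^ 2) (stdC α)) :
    ∫⁻ ω, ENNReal.ofReal (‖form V g ω‖ ^ 2) ∂P
      = ENNReal.ofReal (∫ x, ∑ b, ‖g x b‖ ^ 2 ∂stdC α) := by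
  classical
  have hg' := measurable_inl_comp (κ := κ) hg
  rw [← lintegral_ofReal_sum_sq hi, ← stdC_map_comp_inj (f := (Sum.inl : α → α ⊕ κ)) Sum.inl_injective,
    lintegral_map (measurable_sum_sq hg).ennreal_ofReal (by fun_prop)]
  refine Eq.trans ?_ (lintegral_linear_form_sq _ hg')
  exact lintegral_comp_of_map_eq hV hm
    (F := fun z => ENNReal.ofReal (‖g (fun a => z (Sum.inl (Sum.inl a))) ⬝ᵥ
      fun b => z (Sum.inr b)‖ ^ 2)) ((measurable_linear_form hg').norm.pow_const 2).ennreal_ofReal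

/-- The symbol is absorbed into the coefficients. It is independent of the estimates and of unit
variance, so it drops out of the second moment. -/
theorem lintegral_symbol_mul_form_sq (hV : AEMeasurable V P) (hm : P.map V = stdC ((α ⊕ κ) ⊕ β))
    {g : (α → ℂ) → β → ℂ} (hg : Measurable g)
    (hi : Integrable (fun x => ∑ b, ‖g x b‖ ^ 2) (stdC α)) (s : κ) :
    ∫⁻ ω, ENNReal.ofReal (‖V ω (Sum.inl (Sum.inr s)) * form V g ω‖ ^ 2) ∂P
      = ENNReal.ofReal (∫ x, ∑ b, ‖g x b‖ ^ 2 ∂stdC α) := by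
  have hg' : Measurable fun x : α ⊕ κ → ℂ => x (Sum.inr s) • g fun a => x (Sum.inl a) :=
    measurable_pi_iff.2 fun b => (measurable_pi_apply _).mul
      ((measurable_pi_apply b).comp (measurable_inl_comp hg))
  have h1 := lintegral_comp_of_map_eq hV hm
    (F := fun z => ENNReal.ofReal (‖(z (Sum.inl (Sum.inr s)) • g (fun a => z (Sum.inl (Sum.inl a))))
      ⬝ᵥ fun b => z (Sum.inr b)‖ ^ 2))
    ((measurable_linear_form hg').norm.pow_const 2).ennreal_ofReal
  simp only [smul_dotProduct, smul_eq_mul] at h1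
  refine h1.trans ?_
  have h2 := lintegral_linear_form_sq (α := α ⊕ κ) (β := β) _ hg'
  simp only [smul_dotProduct, smul_eq_mul] at h2
  refine h2.trans ?_
  rw [← lintegral_ofReal_sum_sq hi, ← lintegral_mul_apply_sq (fun x => ∑ b, ‖g x b‖ ^ 2)
    (measurable_sum_sq hg) (fun _ => by positivity) s]
  refine lintegral_congr fun x => ?_
  congr 1
  rw [Finset.sum_mul]
  refine Finset.sum_congr rfl fun b _ => ?_
  rw [Pi.smul_apply, smul_eq_mul, norm_mul]
  ring

theorem integral_form (hV : AEMeasurable V P) (hm : P.map V = stdC ((α ⊕ κ) ⊕ β))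
    {g : (α → ℂ) → β → ℂ} (hg : Measurable g) : ∫ ω, form V g ω ∂P = 0 := by
  have hg' := measurable_inl_comp (κ := κ) hg
  have h := integral_linear_form hg'
  rw [← hm, integral_map hV (measurable_linear_form hg').aestronglyMeasurable] at h
  exact h

end conditional

/-! ### Detector, gains, powers and the rate bound. -/

section forms
variable {M K τ : ℕ} (p : Params M K τ)

/-- ZF detection matrix as a function of the normalized estimates. -/
def Params.detector (z : Fin M × Fin K → ℂ) : Matrix (Fin M) (Fin K) ℂ :=
  (p.Φ • (p.D * p.channel z)) * ((p.Φ • (p.D * p.channel z))ᴴ * (p.Φ • (p.D * p.channel z)))⁻¹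

theorem EntryMeasurable.const_smul {Ω ι κ : Type*} [MeasurableSpace Ω] (c : ℂ) {F : Ω → Matrix ι κ ℂ}
    (hF : EntryMeasurable F) : EntryMeasurable fun ω => c • F ω :=
  fun i j => (hF i j).const_mul c

theorem Params.entryMeasurable_channel : EntryMeasurable p.channel :=
  (EntryMeasurable.const _).add (entryMeasurable_mat.mul (EntryMeasurable.const _))

theorem Params.entryMeasurable_detector : EntryMeasurable p.detector := by
  have h : EntryMeasurable fun z => p.Φ • (p.D * p.channel z) :=
    ((EntryMeasurable.const _).mul p.entryMeasurable_channel).const_smul _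
  exact h.mul (h.conjTranspose.mul h).inv

theorem Params.gram_effective (z : Fin M × Fin K → ℂ) :
    (p.Φ • (p.D * p.channel z))ᴴ * (p.Φ • (p.D * p.channel z))
      = ((‖p.Φ‖ ^ 2 : ℝ) : ℂ) • ((p.channel z)ᴴ * p.channel z) := by
  rw [conjTranspose_smul, Matrix.smul_mul, Matrix.mul_smul, smul_smul, conjTranspose_mul,
    Matrix.mul_assoc, ← Matrix.mul_assoc _ p.D, p.D_conjTranspose_mul, Matrix.one_mul]
  congr 1
  rw [RCLike.star_def, Complex.conj_mul']
  push_cast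
  rfl

theorem Params.normSq_Φ_ne_zero : ((‖p.Φ‖ ^ 2 : ℝ) : ℂ) ≠ 0 := by
  exact_mod_cast (pow_pos (norm_pos_iff.2 p.Φ_ne_zero) 2).ne'

theorem Params.detector_mul {z : Fin M × Fin K → ℂ}
    (h : IsUnit ((p.channel z)ᴴ * p.channel z)) :
    (p.detector z)ᴴ * (p.Φ • (p.D * p.channel z)) = 1 := by
  have hu : IsUnit ((p.Φ • (p.D * p.channel z))ᴴ * (p.Φ • (p.D * p.channel z))).det := by
    rw [p.gram_effective, det_smul]
    exact (p.normSq_Φ_ne_zero.isUnit.pow _).mul ((isUnit_iff_isUnit_det _).1 h)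
  rw [Params.detector, conjTranspose_mul, Matrix.mul_assoc, conjTranspose_nonsing_inv,
    (isHermitian_conjTranspose_mul_self _).eq, nonsing_inv_mul _ hu]

/-- Squared norm of a detection vector. -/
def Params.detSq (k : Fin K) (z : Fin M × Fin K → ℂ) : ℝ := ∑ m, ‖p.detector z m k‖ ^ 2

/-- A column of A(AᴴA)⁻¹ has squared norm [(AᴴA)⁻¹]_kk, and D, being unitary, disappears from the
Gram matrix. The noise amplification is thereby a Wishart moment. -/
theorem Params.detSq_eq (k : Fin K) (z : Fin M × Fin K → ℂ) : p.detSq k z =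
    (‖p.Φ‖ ^ 2)⁻¹ * (((p.channel z)ᴴ * p.channel z)⁻¹ k k).re := by
  have h := inv_gram_apply_self (p.Φ • (p.D * p.channel z)) k
  rw [← Complex.ofReal_re (p.detSq k z), Params.detSq, Params.detector, ← h, p.gram_effective,
    inv_smul_of_ne_zero p.normSq_Φ_ne_zero, Matrix.smul_apply, smul_eq_mul, ← Complex.ofReal_inv,
    Complex.re_ofReal_mul]

theorem Params.detSq_nonneg (k : Fin K) (z : Fin M × Fin K → ℂ) : 0 ≤ p.detSq k z :=
  Finset.sum_nonneg fun _ _ => by positivity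

theorem Params.channel_moment (hKM : K < M) (k : Fin K) :
    (∀ᵐ z ∂stdC (Fin M × Fin K), IsUnit ((p.channel z)ᴴ * p.channel z)) ∧
    Integrable (fun z => (((p.channel z)ᴴ * p.channel z)⁻¹ k k).re) (stdC (Fin M × Fin K)) ∧
    ∫ z, (((p.channel z)ᴴ * p.channel z)⁻¹ k k).re ∂stdC (Fin M × Fin K) ≤
      ((M : ℝ) - K)⁻¹ * ((p.Ψ + (M : ℂ)⁻¹ • (p.HBarᴴ * p.HBar))⁻¹ k k).re := by
  have h := integral_inv_gram_scaled_le p.HBar (ψ := fun j => p.μ j * p.α j)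
    (fun j => mul_pos (p.μ_pos j) (p.α_pos j)) (by simpa using hKM) k (H := p.channel) fun _ => rfl
  simpa only [Fintype.card_fin, Params.Ψ] using h

/-- Mean squared norm of a detection vector. -/
def Params.meanDetSq (k : Fin K) : ℝ := ∫ z, p.detSq k z ∂stdC (Fin M × Fin K)

theorem Params.integrable_detSq (hKM : K < M) (k : Fin K) :
    Integrable (p.detSq k) (stdC (Fin M × Fin K)) := by
  simp only [funext (p.detSq_eq k)]
  exact (p.channel_moment hKM k).2.1.const_mul _

theorem Params.meanDetSq_le (hKM : K < M) (k : Fin K) : ‖p.Φ‖ ^ 2 * p.meanDetSq k ≤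
    ((M : ℝ) - K)⁻¹ * ((p.Ψ + (M : ℂ)⁻¹ • (p.HBarᴴ * p.HBar))⁻¹ k k).re := by
  have hΦ : (‖p.Φ‖ ^ 2) ≠ 0 := (pow_pos (norm_pos_iff.2 p.Φ_ne_zero) 2).ne'
  unfold Params.meanDetSq
  simp only [p.detSq_eq]
  rw [integral_const_mul, mul_inv_cancel_left₀ hΦ]
  exact (p.channel_moment hKM k).2.2

/-- If the mean vanished, the detection vector would be zero for some full-rank estimate,
contradicting the zero-forcing identity `detector_mul`. Positivity is needed to divide by the
interference power. -/
theorem Params.meanDetSq_pos (hKM : K < M) (k : Fin K) : 0 < p.meanDetSq k := by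
  refine lt_of_le_of_ne (integral_nonneg (p.detSq_nonneg k)) fun h => ?_
  have h0 := (integral_eq_zero_iff_of_nonneg (p.detSq_nonneg k) (p.integrable_detSq hKM k)).1 h.symm
  obtain ⟨z, hz, hu⟩ := (h0.and (p.channel_moment hKM k).1).exists
  have hz' : ∀ m, p.detector z m k = 0 := by
    intro m
    have := (Finset.sum_eq_zero_iff_of_nonneg fun _ _ => by positivity).1
      (show ∑ m, ‖p.detector z m k‖ ^ 2 = 0 from hz) m (Finset.mem_univ m)
    simpa using this
  have h1 := congrFun (congrFun (p.detector_mul hu) k) k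
  rw [Matrix.mul_apply, one_apply_eq] at h1
  simp [hz'] at h1

/-- Coefficients of the estimation errors and the noise in the detected error of a user. -/
def Params.errCoeff (k k' : Fin K) (z : Fin M × Fin K → ℂ) : (Fin M × Fin K) ⊕ Fin M → ℂ :=
  Sum.elim (fun q => if q.2 = k' then ((Real.sqrt (p.ρ * p.pData k') : ℝ) : ℂ) * p.Φ *
    ((Real.sqrt (p.α k' - p.μ k' * p.α k') : ℝ) : ℂ) * (star (p.detector z q.1 k) * p.D q.1 q.1)
    else 0) fun _ => 0

/-- Coefficients of the estimation errors and the noise in the detected noise. -/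
def Params.noiseCoeff (k : Fin K) (z : Fin M × Fin K → ℂ) : (Fin M × Fin K) ⊕ Fin M → ℂ :=
  Sum.elim (fun _ => 0) fun m => p.σ * star (p.detector z m k)

theorem Params.measurable_star_detector (m : Fin M) (k : Fin K) :
    Measurable fun z => star (p.detector z m k) :=
  continuous_star.measurable.comp (p.entryMeasurable_detector m k)

theorem Params.measurable_errCoeff (k k' : Fin K) : Measurable (p.errCoeff k k') := by
  refine measurable_pi_iff.2 fun i => ?_
  rcases i with q | m
  · simp only [Params.errCoeff, Sum.elim_inl]
    split_ifs
    · exact ((p.measurable_star_detector _ _).mul_const _).const_mul _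
    · exact measurable_const
  · exact measurable_const

theorem Params.measurable_noiseCoeff (k : Fin K) : Measurable (p.noiseCoeff k) := by
  refine measurable_pi_iff.2 fun i => ?_
  rcases i with q | m
  · exact measurable_const
  · exact (p.measurable_star_detector _ _).const_mul _

theorem Params.sum_errCoeff (k k' : Fin K) (z : Fin M × Fin K → ℂ) :
    ∑ b, ‖p.errCoeff k k' z b‖ ^ 2 =
      p.ρ * p.pData k' * ‖p.Φ‖ ^ 2 * (p.α k' - p.μ k' * p.α k') * p.detSq k z := by
  rw [Fintype.sum_sum_type, Fintype.sum_prod_type, Params.detSq, Finset.mul_sum]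
  simp only [Params.errCoeff, Sum.elim_inl, Sum.elim_inr, norm_zero, ne_eq, OfNat.ofNat_ne_zero,
    not_false_eq_true, zero_pow, Finset.sum_const_zero, add_zero]
  refine Finset.sum_congr rfl fun m _ => ?_
  rw [Finset.sum_eq_single k' (fun j _ hj => by simp [hj]) (by simp), if_pos rfl]
  simp only [norm_mul, norm_star, p.norm_D, mul_one, Complex.norm_real, Real.norm_eq_abs, mul_pow,
    sq_abs]
  rw [Real.sq_sqrt (mul_nonneg p.ρ_pos.le (p.pData_nonneg _)), Real.sq_sqrt (p.error_pos k').le]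

theorem Params.sum_noiseCoeff (k : Fin K) (z : Fin M × Fin K → ℂ) :
    ∑ b, ‖p.noiseCoeff k z b‖ ^ 2 = p.σ ^ 2 * p.detSq k z := by
  rw [Fintype.sum_sum_type, Params.detSq, Finset.mul_sum]
  simp [Params.noiseCoeff, mul_pow]

variable {p} {Ω : Type*} [MeasurableSpace Ω] {P : Measure Ω} (X : Model p P)
  [IsProbabilityMeasure P]

theorem Model.c_eq (k : Fin K) (ω : Ω) (m : Fin M) : X.c k ω m = p.detector (X.est ω) m k := by
  rw [Model.c, Model.zf, X.HHat_eq]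
  rfl

theorem Model.N_eq (k : Fin K) : X.N k = form X.mixed (p.noiseCoeff k) := by
  ext ω
  simp only [Model.N, form, dotProduct, Fintype.sum_sum_type, Params.noiseCoeff, Sum.elim_inl,
    Sum.elim_inr, zero_mul, Finset.sum_const_zero, zero_add, Pi.star_apply, X.c_eq]
  refine Finset.sum_congr rfl fun m _ => ?_
  rw [← X.mixed_w]
  unfold Model.est
  ring

theorem Model.form_errCoeff (k k' : Fin K) (ω : Ω) : form X.mixed (p.errCoeff k k') ω =
    ((Real.sqrt (p.ρ * p.pData k') : ℝ) : ℂ) * p.Φ *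
      (star (X.c k ω) ⬝ᵥ (p.D *ᵥ fun m =>
        ((Real.sqrt (p.α k' - p.μ k' * p.α k') : ℝ) : ℂ) * X.err ω (m, k'))) := by
  simp only [form, dotProduct, Fintype.sum_sum_type, Params.errCoeff, Sum.elim_inl,
    Sum.elim_inr, zero_mul, Finset.sum_const_zero, add_zero, Pi.star_apply, X.c_eq]
  rw [Fintype.sum_prod_type, Finset.mul_sum]
  refine Finset.sum_congr rfl fun m _ => ?_
  rw [Finset.sum_eq_single k' (fun j _ hj => by simp [hj]) (by simp), if_pos rfl, p.D_eq,
    mulVec_diagonal, diagonal_apply_eq]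
  unfold Model.est Model.err
  ring

/-- Zero forcing removes the estimated channels of the other users and normalizes the user's own, so
only the estimation error of user k' remains random given the estimates. -/
theorem Model.gain_eq (k k' : Fin K) {ω : Ω} (h : IsUnit ((X.HHat ω)ᴴ * X.HHat ω)) :
    X.gain k k' ω = (if k = k' then ((Real.sqrt (p.ρ * p.pData k') : ℝ) : ℂ) else 0) +
      form X.mixed (p.errCoeff k k') ω := by
  have h0 : p.Φ * (star (X.c k ω) ⬝ᵥ (p.D *ᵥ fun m => X.HHat ω m k')) = if k = k' then 1 else 0 := by
    rw [X.HHat_eq] at h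
    have h1 := congrFun (congrFun (p.detector_mul h) k) k'
    rw [Matrix.mul_smul, Matrix.smul_apply, Matrix.one_apply] at h1
    rw [← h1, X.HHat_eq, smul_eq_mul]
    congr 1
    rw [Matrix.mul_apply]
    refine Finset.sum_congr rfl fun m _ => ?_
    rw [Pi.star_apply, X.c_eq]
    rfl
  have h2 : X.h k' ω = (fun m => X.HHat ω m k') + fun m =>
      ((Real.sqrt (p.α k' - p.μ k' * p.α k') : ℝ) : ℂ) * X.err ω (m, k') :=
    funext fun m => X.h_eq k' ω m
  rw [X.form_errCoeff, Model.gain, h2, mulVec_add, dotProduct_add, mul_add, mul_assoc _ p.Φ, h0]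
  split_ifs <;> simp

theorem Model.ae_isUnit_gram (hKM : K < M) (k : Fin K) :
    ∀ᵐ ω ∂P, IsUnit ((X.HHat ω)ᴴ * X.HHat ω) := by
  have h1 : (stdC (MixIdx M K)).map (fun z (q : Fin M × Fin K) => z (Sum.inl (Sum.inl q)))
      = stdC (Fin M × Fin K) :=
    stdC_map_comp_inj (f := fun q => Sum.inl (Sum.inl q))
      (Sum.inl_injective.comp Sum.inl_injective)
  have h := (p.channel_moment hKM k).1
  rw [← h1, ← X.map_mixed] at h
  have hr : Measurable fun (z : MixIdx M K → ℂ) (q : Fin M × Fin K) => z (Sum.inl (Sum.inl q)) := by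
    fun_prop
  have h2 := ae_of_ae_map X.aemeasurable_mixed (ae_of_ae_map hr.aemeasurable h)
  filter_upwards [h2] with ω hω
  rw [X.HHat_eq]
  exact hω

theorem Model.lintegral_err (hKM : K < M) (k k' : Fin K) :
    ∫⁻ ω, ENNReal.ofReal (‖form X.mixed (p.errCoeff k k') ω‖ ^ 2) ∂P = ENNReal.ofReal
      (p.ρ * p.pData k' * ‖p.Φ‖ ^ 2 * (p.α k' - p.μ k' * p.α k') * p.meanDetSq k) := by
  have hs := p.sum_errCoeff k k'
  rw [lintegral_form_sq X.aemeasurable_mixed X.map_mixed (p.measurable_errCoeff k k')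
    (by simp only [hs]; exact (p.integrable_detSq hKM k).const_mul _)]
  simp only [hs]
  rw [integral_const_mul, Params.meanDetSq]

theorem Model.lintegral_symbol_mul_err (hKM : K < M) (k k' : Fin K) :
    ∫⁻ ω, ENNReal.ofReal (‖X.s k' ω * form X.mixed (p.errCoeff k k') ω‖ ^ 2) ∂P = ENNReal.ofReal
      (p.ρ * p.pData k' * ‖p.Φ‖ ^ 2 * (p.α k' - p.μ k' * p.α k') * p.meanDetSq k) := by
  have hs := p.sum_errCoeff k k'
  have h := lintegral_symbol_mul_form_sq X.aemeasurable_mixed X.map_mixed (p.measurable_errCoeff k k')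
    (by simp only [hs]; exact (p.integrable_detSq hKM k).const_mul _) k'
  simp only [X.mixed_s, hs] at h
  rw [h, integral_const_mul, Params.meanDetSq]

theorem Model.aestronglyMeasurable_symbol_mul_err (k k' : Fin K) :
    AEStronglyMeasurable (fun ω => X.s k' ω * form X.mixed (p.errCoeff k k') ω) P := by
  have h := aemeasurable_symbol_mul_form X.aemeasurable_mixed (p.measurable_errCoeff k k') k'
  simp only [X.mixed_s] at h
  exact h.aestronglyMeasurable

theorem Model.memLp_symbol_mul_err (hKM : K < M) (k k' : Fin K) :
    MemLp (fun ω => X.s k' ω * form X.mixed (p.errCoeff k k') ω) 2 P :=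
  memLp_two_of_lintegral (X.aestronglyMeasurable_symbol_mul_err k k')
    (X.lintegral_symbol_mul_err hKM k k')

theorem Params.errPower_nonneg (hKM : K < M) (k k' : Fin K) :
    0 ≤ p.ρ * p.pData k' * ‖p.Φ‖ ^ 2 * (p.α k' - p.μ k' * p.α k') * p.meanDetSq k := by
  have h1 := p.ρ_pos
  have h2 := p.pData_nonneg k'
  have h3 := p.error_pos k'
  have h4 := p.meanDetSq_pos hKM k
  positivity

theorem Model.power_symbol_mul_err (hKM : K < M) (k k' : Fin K) :
    power P (fun ω => X.s k' ω * form X.mixed (p.errCoeff k k') ω) =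
      p.ρ * p.pData k' * ‖p.Φ‖ ^ 2 * (p.α k' - p.μ k' * p.α k') * p.meanDetSq k :=
  integral_sq_of_lintegral (X.aestronglyMeasurable_symbol_mul_err k k')
    (Params.errPower_nonneg hKM k k') (X.lintegral_symbol_mul_err hKM k k')

theorem Model.memLp_err (hKM : K < M) (k k' : Fin K) :
    MemLp (form X.mixed (p.errCoeff k k')) 2 P :=
  memLp_two_of_lintegral (aemeasurable_form X.aemeasurable_mixed
    (p.measurable_errCoeff k k')).aestronglyMeasurable (X.lintegral_err hKM k k')

theorem Model.gain_self_ae_eq (hKM : K < M) (k : Fin K) : X.gain k k =ᵐ[P] fun ω =>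
    ((Real.sqrt (p.ρ * p.pData k) : ℝ) : ℂ) + form X.mixed (p.errCoeff k k) ω := by
  filter_upwards [X.ae_isUnit_gram hKM k] with ω hω
  rw [X.gain_eq k k hω, if_pos rfl]

theorem Model.memLp_gain_self (hKM : K < M) (k : Fin K) : MemLp (X.gain k k) 2 P := by
  rw [memLp_congr_ae (X.gain_self_ae_eq hKM k)]
  have h : MemLp (fun _ : Ω => ((Real.sqrt (p.ρ * p.pData k) : ℝ) : ℂ)) 2 P := memLp_const _
  exact h.add (X.memLp_err hKM k k)

theorem Model.integral_gain_self (hKM : K < M) (k : Fin K) :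
    ∫ ω, X.gain k k ω ∂P = ((Real.sqrt (p.ρ * p.pData k) : ℝ) : ℂ) := by
  rw [integral_congr_ae (X.gain_self_ae_eq hKM k), integral_add (integrable_const _)
    ((X.memLp_err hKM k k).integrable (by norm_num)),
    integral_form X.aemeasurable_mixed X.map_mixed (p.measurable_errCoeff k k)]
  simp

/-- The error form has mean zero, so subtracting the mean gain removes exactly the deterministic
part. Leakage then has the same shape as interference. -/
theorem Model.Ls_ae_eq (hKM : K < M) (k : Fin K) :
    X.Ls k =ᵐ[P] fun ω => X.s k ω * form X.mixed (p.errCoeff k k) ω := by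
  filter_upwards [X.gain_self_ae_eq hKM k] with ω hω
  rw [Model.Ls, hω, X.integral_gain_self hKM k]
  ring

theorem Model.UI_ae_eq (hKM : K < M) {k k' : Fin K} (hk : k' ≠ k) :
    X.UI k k' =ᵐ[P] fun ω => X.s k' ω * form X.mixed (p.errCoeff k k') ω := by
  filter_upwards [X.ae_isUnit_gram hKM k] with ω hω
  rw [Model.UI, X.gain_eq k k' hω, if_neg hk.symm]
  ring

theorem power_congr {Z Z' : Ω → ℂ} (h : Z =ᵐ[P] Z') : power P Z = power P Z' :=
  integral_congr_ae (h.mono fun ω hω => by simp only [hω])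

theorem Model.lintegral_N (hKM : K < M) (k : Fin K) :
    ∫⁻ ω, ENNReal.ofReal (‖X.N k ω‖ ^ 2) ∂P = ENNReal.ofReal (p.σ ^ 2 * p.meanDetSq k) := by
  have hs := p.sum_noiseCoeff k
  rw [X.N_eq, lintegral_form_sq X.aemeasurable_mixed X.map_mixed (p.measurable_noiseCoeff k)
    (by simp only [hs]; exact (p.integrable_detSq hKM k).const_mul _)]
  simp only [hs]
  rw [integral_const_mul, Params.meanDetSq]

theorem Model.aestronglyMeasurable_N (k : Fin K) : AEStronglyMeasurable (X.N k) P := by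
  rw [X.N_eq]
  exact (aemeasurable_form X.aemeasurable_mixed (p.measurable_noiseCoeff k)).aestronglyMeasurable

theorem Model.memLp_N (hKM : K < M) (k : Fin K) : MemLp (X.N k) 2 P :=
  memLp_two_of_lintegral (X.aestronglyMeasurable_N k) (X.lintegral_N hKM k)

theorem Model.power_N (hKM : K < M) (k : Fin K) : power P (X.N k) = p.σ ^ 2 * p.meanDetSq k :=
  integral_sq_of_lintegral (X.aestronglyMeasurable_N k)
    (mul_nonneg (sq_nonneg _) (p.meanDetSq_pos hKM k).le) (X.lintegral_N hKM k)

theorem Model.power_Ds (hKM : K < M) (k : Fin K) : power P (X.Ds k) = p.ρ * p.pData k := by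
  have h := X.integral_mixed_mul_star (Sum.inl (Sum.inr k)) (Sum.inl (Sum.inr k))
  simp only [X.mixed_s, if_true, RCLike.star_def, Complex.mul_conj', ← Complex.ofReal_pow] at h
  rw [integral_complex_ofReal, Complex.ofReal_eq_one] at h
  unfold power Model.Ds
  simp only [X.integral_gain_self hKM, norm_mul, mul_pow, Complex.norm_real, Real.norm_eq_abs,
    sq_abs]
  rw [integral_const_mul, h, mul_one, Real.sq_sqrt (mul_nonneg p.ρ_pos.le (p.pData_nonneg k))]

/-- An equality: leakage supplies the k' = k term missing from the interference sum. The only loss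
in the rate bound is in `Params.meanDetSq_le`. -/
theorem Model.interference_eq (hKM : K < M) (k : Fin K) :
    power P (X.Ls k) + ∑ k' ∈ Finset.univ.erase k, power P (X.UI k k') + power P (X.N k)
      = p.ρ * ‖p.Φ‖ ^ 2 * p.meanDetSq k *
        (∑ k', p.pData k' * (p.α k' - p.μ k' * p.α k') + p.σ ^ 2 / (p.ρ * ‖p.Φ‖ ^ 2)) := by
  have h1 := p.ρ_pos.ne'
  have h2 := (norm_pos_iff.2 p.Φ_ne_zero).ne'
  have hUI : ∑ k' ∈ Finset.univ.erase k, power P (X.UI k k')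
      = ∑ k' ∈ Finset.univ.erase k,
        p.ρ * p.pData k' * ‖p.Φ‖ ^ 2 * (p.α k' - p.μ k' * p.α k') * p.meanDetSq k :=
    Finset.sum_congr rfl fun k' hk' => by
      rw [power_congr (X.UI_ae_eq hKM (Finset.ne_of_mem_erase hk')), X.power_symbol_mul_err hKM]
  rw [hUI, power_congr (X.Ls_ae_eq hKM k), X.power_symbol_mul_err hKM, X.power_N hKM,
    Finset.add_sum_erase _ (fun k' =>
      p.ρ * p.pData k' * ‖p.Φ‖ ^ 2 * (p.α k' - p.μ k' * p.α k') * p.meanDetSq k) (Finset.mem_univ k),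
    mul_add, Finset.mul_sum]
  congr 1
  · exact Finset.sum_congr rfl fun _ _ => by ring
  · field_simp

theorem Model.sinrZF_le (hKM : K < M) (k : Fin K) :
    0 ≤ p.sinrZF k ∧ p.sinrZF k ≤ power P (X.Ds k) /
      (power P (X.Ls k) + ∑ k' ∈ Finset.univ.erase k, power P (X.UI k k') + power P (X.N k)) := by
  rw [X.interference_eq hKM, X.power_Ds hKM, Params.sinrZF]
  set B := ((p.Ψ + (M : ℂ)⁻¹ • (p.HBarᴴ * p.HBar))⁻¹ k k).re
  set S := ∑ k', p.pData k' * (p.α k' - p.μ k' * p.α k') + p.σ ^ 2 / (p.ρ * ‖p.Φ‖ ^ 2)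
  have hρ := p.ρ_pos
  have hΦ := norm_pos_iff.2 p.Φ_ne_zero
  have hσ := p.σ_pos
  have hp := p.pData_nonneg k
  have hC := p.meanDetSq_pos hKM k
  have hMK : (0 : ℝ) < M - K := sub_pos.2 (by exact_mod_cast hKM)
  have hS : 0 < S := add_pos_of_nonneg_of_pos
    (Finset.sum_nonneg fun j _ => mul_nonneg (p.pData_nonneg j) (p.error_pos j).le) (by positivity)
  -- The Wishart bound in product form. It also yields B > 0, so no separate argument is needed for
  -- the matrix in the closed form.
  have hB : ((M : ℝ) - K) * (‖p.Φ‖ ^ 2 * p.meanDetSq k) ≤ B :=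
    (le_inv_mul_iff₀ hMK).1 (p.meanDetSq_le hKM k)
  have hB0 : 0 < B := lt_of_lt_of_le (by positivity) hB
  refine ⟨by positivity, ?_⟩
  rw [div_le_div_iff₀ (by positivity) (by positivity)]
  calc _ = (p.ρ * p.pData k * S) * (((M : ℝ) - K) * (‖p.Φ‖ ^ 2 * p.meanDetSq k)) := by ring
    _ ≤ (p.ρ * p.pData k * S) * B := by gcongr
    _ = _ := by ring

end forms

end RAQMIMO

end


theorem theorem2 {M K τ T : ℕ} (hKM : K < M) (hT : 0 < T) (hτT : τ ≤ T)
    (p : RAQMIMO.Params M K τ) {Ω : Type*} [MeasurableSpace Ω] (P : MeasureTheory.Measure Ω)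
    [MeasureTheory.IsProbabilityMeasure P] (X : RAQMIMO.Model p P) (k : Fin K) :
    (∀ᵐ ω ∂P, IsUnit ((X.HHat ω)ᴴ * X.HHat ω)) ∧
    MeasureTheory.MemLp (X.gain k k) 2 P ∧
    MeasureTheory.MemLp (X.Ls k) 2 P ∧
    (∀ k', k' ≠ k → MeasureTheory.MemLp (X.UI k k') 2 P) ∧
    MeasureTheory.MemLp (X.N k) 2 P ∧
    ((T : ℝ) - τ) / T * Real.logb 2 (1 + p.sinrZF k) ≤ X.rate T k := by
  refine ⟨X.ae_isUnit_gram hKM k, X.memLp_gain_self hKM k,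
    (memLp_congr_ae (X.Ls_ae_eq hKM k)).2 (X.memLp_symbol_mul_err hKM k k),
    fun k' hk' => (memLp_congr_ae (X.UI_ae_eq hKM hk')).2 (X.memLp_symbol_mul_err hKM k k'),
    X.memLp_N hKM k, ?_⟩
  have h := X.sinrZF_le hKM k
  refine mul_le_mul_of_nonneg_left (Real.logb_le_logb_of_le one_lt_two (by linarith) (by linarith))
    (div_nonneg (sub_nonneg.2 (by exact_mod_cast hτT)) (Nat.cast_nonneg _))
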